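/- Let $N\ge 2$ and let $M,L,L_1,J,J_1$ be positive integers. Let $$A_ku=\sum_{j=1}^M\sum_{|\alpha|\le J}a^j_{\alpha,k}D^\alpha u^j\quad(1\le k\le L),\qquad B_ku=\sum_{i=1}^N\sum_{j=1}^M\sum_{|\alpha|\le J_1}\nu_i b^j_{\alpha,i,k}D^\alpha u^j+\sum_{j=1}^M\sum_{|\alpha|\le J_1}b^j_{\alpha,0,k}D^\alpha u^j\quad(1\le k\le L_1)$$ be operators with constant complex coefficients acting on $\mathbb C^M$-valued functions $u$ on subsets of $\mathbb R^N$, where $\nu$ is a unit normal, and put $Au=(A_ku)_k$, $Bu=(B_ku)_k$. A solution of $Au=0$ in an open set $D$ is a function all of whose partial derivatives up to order $\max(J,J_1)$ are continuous in $D$ and which satisfies the equation pointwise. For a hyperplane $\Pi$ with unit normal $\nu$, let $T_\Pi$ be the reflection in $\Pi$, and let $H^+_\Pi$, $H^-_\Pi$ be the open half-spaces bounded by $\Pi$ for which $\nu$ is the exterior, respectively interior, normal. For a function given on one side of a hyperplane, "$Bu=0$ at a point of the hyperplane" means that $Bu$, taken with the exterior normal of that side, tends to $0$ at that point from that side. Assume: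 * (Unique continuation.) If $Au=0$ in an open connected set $D$ and $u=0$ in some nonempty open subset of $D$, then $u=0$ in $D$. * (Reflection principle.) For every hyperplane $\Pi$ with unit normal $\nu$ there is an operator $\tilde T_{\Pi,\nu}$, acting on functions on open subsets of $H^-_\Pi$ compatibly with restriction to smaller open sets, such that, for every open $D^+\subset H^+_\Pi$ and every solution $u^+$ of $Au^+=0$ in $D^+$, the function $u^-=\tilde T_{\Pi,\nu}(u^+\circ T_\Pi)$ satisfies $Au^-=0$ in $T_\Pi(D^+)$, and moreover: * (a) if $x\in\Pi$, $B_r(x)\cap H^+_\Pi\subset D^+$ and $Bu^+=0$ on $B_r(x)\cap\Pi$, then $Bu^-=0$ on $B_r(x)\cap\Pi$, and the function equal to $u^+$ in $B_r(x)\cap H^+_\Pi$ and to $u^-$ in $B_r(x)\cap H^-_\Pi$ extends to a solution of $Au=0$ in $B_r(x)$; * (b) if $x\in\Pi$, $Au=0$ in $B_r(x)$ and $u=\tilde T_{\Pi,\nu}(u|_{B_r(x)\cap H^+_\Pi}\circ T_\Pi)$ in $B_r(x)\cap H^-_\Pi$, then $Bu=0$ on $B_r(x)\cap\Pi$, for both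 unit normals of $\Pi$; * (c) if $\Pi_1$ is any hyperplane, $x\in\Pi_1$, $B_r(x)\cap H^+_{\Pi_1}\subset D^+$ for a choice of unit normal to $\Pi_1$, and $Bu^+=0$ on $B_r(x)\cap\Pi_1$, then $Bu^-=0$ on $T_\Pi(B_r(x)\cap\Pi_1)$. Let $\Sigma\subset\mathbb R^N$ be a nonempty polyhedral obstacle: a nonempty bounded closed set with connected complement $G=\mathbb R^N\setminus\Sigma$, equal to the closure of its interior, whose boundary is the union of finitely many given cells, a cell being the closure of a relatively open subset of a hyperplane. Let $u$ satisfy $Au=0$ in $G$ and $Bu=0$ on the flat portions of the boundary, that is, for each of these cells $C$, contained in a hyperplane $\Pi$, each point $x$ in the interior of $C$ relative to $\Pi$, and each choice of unit normal to $\Pi$ such that $B_r(x)\cap H^+_\Pi\subset G$ for some $r>0$, one has $Bu=0$ at $x$ from the side $H^+_\Pi$. A point $x\in G$ is a flat point for $u$ if there are a hyperplane $\Pi$ through $x$ and $r>0$ with $B_r(x)\subset G$ and $Bu=0$ on $\Pi\cap B_r(x)$. A hyperplane $\Pi$ is a reflection hyperplane for $u$ if $Bu=0$ on $\Pi\setminus\overline{B_R(0)}$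 for some $R>0$. Let $\Sigma'$ be a finite union of compact $N$-dimensional polyhedra with $\Sigma'\setminus\Sigma\ne\emptyset$, and let $\tilde G$ be the unbounded connected component of $\mathbb R^N\setminus(\Sigma\cup\Sigma')$. Assume that every $x\in\partial\tilde G\cap G$ is a flat point for $u$. Then there exist $N$ reflection hyperplanes $\Pi_1,\ldots,\Pi_N$ for $u$ whose normals $\nu_1,\ldots,\nu_N$ are linearly independent. -/

import Mathlib

open Set Filter Topology
open scoped RealInnerProductSpace

noncomputable section

namespace Polyhedral

/-- Euclidean space of dimension `N`. -/
abbrev Space (N : ℕ) := EuclideanSpace ℝ (Fin N)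

/-! ### Hyperplanes and reflections -/

/-- A pair `(Π, ν)`: a hyperplane `Π = {x | ⟪ν, x⟫ = c}` with a choice of unit normal `ν`. -/
structure OrientedHyperplane (N : ℕ) where
  normal : Space N
  offset : ℝ
  norm_normal : ‖normal‖ = 1

namespace OrientedHyperplane

variable {N : ℕ} (H : OrientedHyperplane N)

/-- The hyperplane itself. -/
def plane : Set (Space N) := {x | ⟪H.normal, x⟫ = H.offset}

/-- The open half-space for which `ν` is the exterior normal. -/
def posSide : Set (Space N) := {x | ⟪H.normal, x⟫ < H.offset}

/-- The open half-space for which `ν` is the interior normal. -/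
def negSide : Set (Space N) := {x | H.offset < ⟪H.normal, x⟫}

/-- The reflection in the hyperplane. -/
def reflect (x : Space N) : Space N := x - (2 * (⟪H.normal, x⟫ - H.offset)) • H.normal

/-- The linear part of the reflection, which acts on directions such as normals. -/
def reflectDir (v : Space N) : Space N := v - (2 * ⟪H.normal, v⟫) • H.normal

end OrientedHyperplane

/-! ### Differential and boundary operators with constant coefficients -/

/-- The partial derivative in the `i`-th coordinate direction. -/
def pderiv {N : ℕ} (i : Fin N) (f : Space N → ℂ) : Space N → ℂ :=
  fun x => fderiv ℝ f x (EuclideanSpace.single i 1)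

/-- `D^α f = ∂₁^{α₁} ⋯ ∂_N^{α_N} f`. -/
def multiDeriv {N : ℕ} (α : Fin N → ℕ) (f : Space N → ℂ) : Space N → ℂ :=
  (List.finRange N).foldr (fun i g => (pderiv i)^[α i] g) f

/-- The finite set of multi-indices of weight at most `J`. -/
def multiIndices (N J : ℕ) : Finset (Fin N → ℕ) :=
  {α ∈ Fintype.piFinset (fun _ : Fin N => Finset.range (J + 1)) | ∑ i, α i ≤ J}

/-- The coefficients of the operators `A₁, …, A_L` of order at most `J` and of the boundary
operators `B₁, …, B_{L₁}` of order at most `J₁`, acting on functions with values in `ℂ^M`. -/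
structure Operators (N M L L₁ J J₁ : ℕ) where
  a : Fin L → Fin M → (Fin N → ℕ) → ℂ
  b : Fin L₁ → Fin N → Fin M → (Fin N → ℕ) → ℂ
  b₀ : Fin L₁ → Fin M → (Fin N → ℕ) → ℂ

namespace Operators

variable {N M L L₁ J J₁ : ℕ} (P : Operators N M L L₁ J J₁)

/-- `A_k u = ∑_j ∑_{|α| ≤ J} a^j_{α,k} D^α u^j`. -/
def A (k : Fin L) (u : Space N → Fin M → ℂ) (x : Space N) : ℂ :=
  ∑ j, ∑ α ∈ multiIndices N J, P.a k j α * multiDeriv α (fun y => u y j) x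

/-- `B_k u = ∑_i ∑_j ∑_{|α| ≤ J₁} ν_i b^j_{α,i,k} D^α u^j + ∑_j ∑_{|α| ≤ J₁} b^j_{α,0,k} D^α u^j`,
for the normal `ν`. -/
def B (k : Fin L₁) (ν : Space N) (u : Space N → Fin M → ℂ) (x : Space N) : ℂ :=
  ∑ i, ∑ j, ∑ α ∈ multiIndices N J₁,
      (ν i : ℂ) * P.b k i j α * multiDeriv α (fun y => u y j) x
    + ∑ j, ∑ α ∈ multiIndices N J₁, P.b₀ k j α * multiDeriv α (fun y => u y j) x

/-- `u` satisfies `Au = 0` in the open set `D`. A function on `D` is represented by a function on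
the whole space whose values off `D` play no role. All partial derivatives that occur in `A` and
`B` are required to be continuous in `D`, which is the regularity assumed of solutions. -/
def IsSolution (D : Set (Space N)) (u : Space N → Fin M → ℂ) : Prop :=
  ContDiffOn ℝ ((max J J₁ : ℕ) : WithTop ℕ∞) u D ∧ ∀ x ∈ D, ∀ k, P.A k u x = 0

/-- `Bu = 0`, for the normal `ν`, at all points of `S` (points near which `u` is regular). -/
def VanishOn (ν : Space N) (u : Space N → Fin M → ℂ) (S : Set (Space N)) : Prop :=
  ∀ y ∈ S, ∀ k, P.B k ν u y = 0

/-- `Bu = 0`, for the normal `ν`, at all points of `S`, as a boundary condition from the side `Ω`: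
`Bu` tends to zero at the points of `S` from within `Ω`. -/
def VanishOnFrom (Ω : Set (Space N)) (ν : Space N) (u : Space N → Fin M → ℂ)
    (S : Set (Space N)) : Prop :=
  ∀ y ∈ S, ∀ k, Tendsto (P.B k ν u) (𝓝[Ω] y) (𝓝 0)

/-- The unique continuation property of `A`. -/
def UniqueContinuation : Prop :=
  ∀ (D : Set (Space N)) (u : Space N → Fin M → ℂ), IsOpen D → IsConnected D →
    P.IsSolution D u →
    ∀ D' ⊆ D, IsOpen D' → D'.Nonempty → (∀ x ∈ D', u x = 0) → ∀ x ∈ D, u x = 0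

/-- The operator `T` is a reflection operator for the hyperplane `Π` with unit normal `ν`. -/
structure IsReflectionOperator (H : OrientedHyperplane N)
    (T : (Space N → Fin M → ℂ) → Space N → Fin M → ℂ) : Prop where
  /-- `T` acts on functions on any open subset of `H⁻`, compatibly with restriction. -/
  restrict : ∀ D : Set (Space N), IsOpen D → D ⊆ H.negSide →
    ∀ v w, EqOn v w D → EqOn (T v) (T w) D
  /-- `u⁻ = T (u⁺ ∘ T_Π)` is a solution in `D⁻ = T_Π(D⁺)` if `u⁺` is a solution in `D⁺ ⊆ H⁺`. -/
  isSolution : ∀ (D : Set (Space N)) (u : Space N → Fin M → ℂ), IsOpen D → D ⊆ H.posSide →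
    P.IsSolution D u → P.IsSolution (H.reflect '' D) (T (u ∘ H.reflect))
  /-- If moreover `Bu⁺ = 0` on `B_r(x) ∩ Π`, then `Bu⁻ = 0` there as well, and `u⁺`, `u⁻` together
  form a solution in `B_r(x)`. -/
  glue : ∀ (D : Set (Space N)) (u : Space N → Fin M → ℂ), IsOpen D → D ⊆ H.posSide →
    P.IsSolution D u → ∀ x ∈ H.plane, ∀ r > 0, Metric.ball x r ∩ H.posSide ⊆ D →
    P.VanishOnFrom H.posSide H.normal u (Metric.ball x r ∩ H.plane) →
    P.VanishOnFrom H.negSide (-H.normal) (T (u ∘ H.reflect)) (Metric.ball x r ∩ H.plane) ∧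
    ∃ w, P.IsSolution (Metric.ball x r) w ∧
      EqOn w u (Metric.ball x r ∩ H.posSide) ∧
      EqOn w (T (u ∘ H.reflect)) (Metric.ball x r ∩ H.negSide)
  /-- A solution in `B_r(x)`, `x ∈ Π`, that coincides with its reflection satisfies `Bu = 0` on
  `B_r(x) ∩ Π`, on either side. -/
  vanish : ∀ x ∈ H.plane, ∀ r > 0, ∀ u : Space N → Fin M → ℂ,
    P.IsSolution (Metric.ball x r) u →
    EqOn u (T (u ∘ H.reflect)) (Metric.ball x r ∩ H.negSide) →
    P.VanishOn H.normal u (Metric.ball x r ∩ H.plane) ∧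
    P.VanishOn (-H.normal) u (Metric.ball x r ∩ H.plane)
  /-- The condition `Bu⁺ = 0` on a piece of another hyperplane `Π₁` is carried to the reflected
  piece. -/
  transport : ∀ (D : Set (Space N)) (u : Space N → Fin M → ℂ), IsOpen D → D ⊆ H.posSide →
    P.IsSolution D u → ∀ H₁ : OrientedHyperplane N, ∀ x ∈ H₁.plane, ∀ r > 0,
    Metric.ball x r ∩ H₁.posSide ⊆ D →
    P.VanishOnFrom H₁.posSide H₁.normal u (Metric.ball x r ∩ H₁.plane) →
    P.VanishOnFrom (H.reflect '' H₁.posSide) (H.reflectDir H₁.normal) (T (u ∘ H.reflect))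
      (H.reflect '' (Metric.ball x r ∩ H₁.plane))

/-- The structural assumption on `A` and `B`: unique continuation and the reflection principle
(the regularity of solutions is part of `IsSolution`). -/
structure Admissible : Prop where
  uniqueContinuation : P.UniqueContinuation
  reflection : ∀ H : OrientedHyperplane N, ∃ T, P.IsReflectionOperator H T

end Operators

/-! ### Scatterers, cells, polyhedra -/

/-- A scatterer: a bounded closed set with connected complement. -/
structure IsScatterer {N : ℕ} (S : Set (Space N)) : Prop where
  isBounded : Bornology.IsBounded S
  isClosed : IsClosed S
  isConnected_compl : IsConnected Sᶜ

/-- An obstacle: a scatterer that is the closure of its interior. -/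
structure IsObstacle {N : ℕ} (S : Set (Space N)) : Prop extends IsScatterer S where
  closure_interior : closure (interior S) = S

/-- `C` is a cell in the hyperplane `Π`: the closure of a relatively open subset of `Π`. -/
def IsCellIn {N : ℕ} (H : OrientedHyperplane N) (C : Set (Space N)) : Prop :=
  ∃ U : Set (Space N), IsOpen U ∧ C = closure (U ∩ H.plane)

/-- The boundary of `S` is the union of the finite family `𝒞` of cells. -/
structure IsCellDecomposition {N : ℕ} (S : Set (Space N)) (𝒞 : Set (Set (Space N))) : Prop where
  finite : 𝒞.Finite
  isCell : ∀ C ∈ 𝒞, ∃ H, IsCellIn H C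
  frontier_eq : frontier S = ⋃₀ 𝒞

/-- A convex polytope with nonempty interior. -/
def IsConvexPolytope {N : ℕ} (Q : Set (Space N)) : Prop :=
  (∃ V : Finset (Space N), Q = convexHull ℝ (V : Set (Space N))) ∧ (interior Q).Nonempty

/-- A (compact, `N`-dimensional, not necessarily convex) polyhedron: a finite union of
`N`-dimensional convex polytopes. -/
def IsPolyhedron {N : ℕ} (Q : Set (Space N)) : Prop :=
  ∃ 𝒬 : Set (Set (Space N)), 𝒬.Finite ∧ 𝒬.Nonempty ∧ (∀ K ∈ 𝒬, IsConvexPolytope K) ∧ Q = ⋃₀ 𝒬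

/-- The points of `W` whose connected component in `W` is unbounded. If `N ≥ 2` and the complement
of `W` is bounded, there is exactly one unbounded component, and this is it. -/
def unboundedComponent {N : ℕ} (W : Set (Space N)) : Set (Space N) :=
  {x ∈ W | ¬ Bornology.IsBounded (connectedComponentIn W x)}

namespace Operators

variable {N M L L₁ J J₁ : ℕ} (P : Operators N M L L₁ J J₁)

/-- `Bu = 0` on the flat portions of the boundary of `S`: in the interior of every cell of the
family `𝒞`, from every side of the cell on which the complement of `S` lies. -/
def VanishOnCells (S : Set (Space N)) (𝒞 : Set (Set (Space N)))
    (u : Space N → Fin M → ℂ) : Prop :=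
  ∀ C ∈ 𝒞, ∀ H : OrientedHyperplane N, IsCellIn H C →
    ∀ x ∈ H.plane, ∀ r > 0, Metric.ball x r ∩ H.plane ⊆ C →
      Metric.ball x r ∩ H.posSide ⊆ Sᶜ → P.VanishOnFrom H.posSide H.normal u {x}

/-- `x` is a flat point of `u` in the open set `G`. -/
def IsFlatPoint (G : Set (Space N)) (u : Space N → Fin M → ℂ) (x : Space N) : Prop :=
  ∃ H : OrientedHyperplane N, x ∈ H.plane ∧ ∃ r > 0, Metric.ball x r ⊆ G ∧
    P.VanishOn H.normal u (Metric.ball x r ∩ H.plane)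

/-- `Π` is a reflection hyperplane of `u`: `Bu = 0` on `Π` outside some ball. -/
def IsReflectionHyperplane (u : Space N → Fin M → ℂ) (H : OrientedHyperplane N) : Prop :=
  ∃ R > 0, P.VanishOn H.normal u (H.plane \ Metric.closedBall 0 R)

end Operators

end Polyhedral

end

/-!
Suppose that no `N` reflection hyperplanes have independent normals. Then some direction `e ≠ 0` is
parallel to all of them, and the proof derives a contradiction from the existence of a bounded open
set outside the obstacle `S` that is bounded, off `S`, by flat points
(`IsObstacleProblem.false_of_frontier_flat`). Such a set is what `S'` provides: the part of `Sᶜ` off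
the closure of the unbounded component.

*Flat points and symmetry.* Near a flat point with hyperplane `Π` the function `u` coincides with
its reflection in `Π`. By unique continuation this persists in the whole component `D` of the
mirror region (the points of `Sᶜ` on one side of `Π` whose mirror image also lies in `Sᶜ`). If `D`
is unbounded, `Π` is a reflection hyperplane. Where `∂D` meets `Sᶜ`, it lies in `Π` or in the mirror
image of `∂S`, and consists of flat points (`isFlatAt_of_mem_frontier`,
`exists_isFlatAt_of_mem_frontier`), at least at those points that lie on one hyperplane only. The
intersections of two hyperplanes have codimension two and can be avoided
(`subset_of_mem_nhds_of_isSimple`, `exists_line_isSimple`).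

*The reflection group is finite.* Let `Γ` be the group generated by the reflections in the
reflection hyperplanes; it fixes the direction `e`. Call a flat point exceptional if the reflection
in its hyperplane is not in `Γ`. If a functional increases along `e`, a sublevel set of it that
contains `S` also contains all exceptional points: otherwise, near an almost extremal one, there
would be a bounded component `D` and a ray of direction `e` that starts in `D` and never leaves it,
since a crossing point would be flat, with a hyperplane transversal to `e`
(`exceptionalSet_subset_halfSpace`). By a similar ray argument the reflections generating `Γ` map
`S` into every such half-space (`reflect_mem_halfSpace`), and by approximation, with `-e` in place
of `e` if need be, into every half-space containing `S` (`reflect_mem_convexHull`). So `Γ` preserves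
the convex hull of `S`, which is a polytope with interior points, and permutes its vertices: `Γ` is
finite (`finite_reflectionGroup`).

*The symmetric exterior.* Let `W` be the unbounded component of the complement of the `Γ`-orbit of
`S` and the closure of the exceptional set. It is invariant under `Γ`. A bounded open set that is
bounded within `W` by hyperplanes of reflections in `Γ` cannot meet `W`, because its finitely many
images would fill `W` (`false_of_isBounded`). Applied to the bounded component at an exceptional
point, this shows that `∂W` reaches no exceptional point outside `S`; then `W` is bounded by images
of `S` only, the part of `∂W` in `S` is symmetric, and `W = Sᶜ`
(`exceptionalSet_eq_empty_and_invariant`). Hence there are no exceptional points and `Sᶜ` is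
invariant, and `false_of_isBounded`, applied in `Sᶜ` to the set provided by `S'`, is the
contradiction.
-/

noncomputable section

namespace Polyhedral

/-! ### Regularity and locality of the operators -/

section Derivatives

variable {N : ℕ} {U : Set (Space N)}

theorem pderiv_eqOn (hU : IsOpen U) (i : Fin N) {f g : Space N → ℂ} (h : EqOn f g U) :
    EqOn (pderiv i f) (pderiv i g) U := by
  intro x hx
  have : f =ᶠ[𝓝 x] g := h.eventuallyEq_of_mem (hU.mem_nhds hx)
  simp only [pderiv, this.fderiv_eq]

theorem iterate_pderiv_eqOn (hU : IsOpen U) (i : Fin N) (k : ℕ) {f g : Space N → ℂ}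
    (h : EqOn f g U) : EqOn ((pderiv i)^[k] f) ((pderiv i)^[k] g) U := by
  induction k generalizing f g with
  | zero => exact h
  | succ k ih => exact ih (pderiv_eqOn hU i h)

theorem multiDeriv_eqOn (hU : IsOpen U) (α : Fin N → ℕ) {f g : Space N → ℂ} (h : EqOn f g U) :
    EqOn (multiDeriv α f) (multiDeriv α g) U := by
  unfold multiDeriv
  induction List.finRange N with
  | nil => exact h
  | cons i l ih => exact iterate_pderiv_eqOn hU i _ ih

theorem contDiffOn_pderiv (hU : IsOpen U) (i : Fin N) {f : Space N → ℂ} {n : ℕ}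
    (hf : ContDiffOn ℝ (n + 1 : ℕ) f U) : ContDiffOn ℝ n (pderiv i f) U := by
  have h := hf.fderiv_of_isOpen (m := (n : WithTop ℕ∞)) hU (by norm_cast)
  exact h.clm_apply contDiffOn_const

theorem contDiffOn_iterate_pderiv (hU : IsOpen U) (i : Fin N) (k : ℕ) {f : Space N → ℂ} {n : ℕ}
    (hf : ContDiffOn ℝ (n + k : ℕ) f U) : ContDiffOn ℝ n ((pderiv i)^[k] f) U := by
  induction k generalizing f with
  | zero => exact hf
  | succ k ih => exact ih (contDiffOn_pderiv hU i hf)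

theorem iterate_pderiv_sub_eqOn (hU : IsOpen U) (i : Fin N) (k : ℕ) {f g : Space N → ℂ}
    (hf : ContDiffOn ℝ k f U) (hg : ContDiffOn ℝ k g U) :
    EqOn ((pderiv i)^[k] (f - g)) ((pderiv i)^[k] f - (pderiv i)^[k] g) U := by
  induction k generalizing f g with
  | zero => exact fun _ _ => rfl
  | succ k ih =>
    have h : EqOn (pderiv i (f - g)) (pderiv i f - pderiv i g) U := by
      intro x hx
      have hf' := (hf.differentiableOn (by simp)).differentiableAt (hU.mem_nhds hx)
      have hg' := (hg.differentiableOn (by simp)).differentiableAt (hU.mem_nhds hx)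
      simp [pderiv, fderiv_sub hf' hg']
    intro x hx
    rw [Function.iterate_succ_apply, iterate_pderiv_eqOn hU i k h hx,
      ih (contDiffOn_pderiv hU i hf) (contDiffOn_pderiv hU i hg) hx]
    rfl

/-- The part of `multiDeriv` that belongs to a list of directions, with the regularity that is left
after it; the general list is what makes the induction work. -/
theorem contDiffOn_foldr_pderiv_and_sub_eqOn (hU : IsOpen U) (α : Fin N → ℕ)
    (l : List (Fin N)) (n : ℕ) {f g : Space N → ℂ} (hf : ContDiffOn ℝ (n + (l.map α).sum : ℕ) f U)
    (hg : ContDiffOn ℝ (n + (l.map α).sum : ℕ) g U) :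
    ContDiffOn ℝ n (l.foldr (fun i g => (pderiv i)^[α i] g) f) U ∧
      EqOn (l.foldr (fun i g => (pderiv i)^[α i] g) (f - g))
        (l.foldr (fun i g => (pderiv i)^[α i] g) f -
          l.foldr (fun i g => (pderiv i)^[α i] g) g) U := by
  induction l generalizing n f g with
  | nil => exact ⟨by simpa using hf, fun _ _ => rfl⟩
  | cons i l ih =>
    simp only [List.map_cons, List.sum_cons, ← add_assoc] at hf hg
    have h1 := ih _ hf hg
    have h2 := ih _ hg hf
    refine ⟨contDiffOn_iterate_pderiv hU i _ h1.1, fun x hx => ?_⟩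
    have hle : ((α i : ℕ) : WithTop ℕ∞) ≤ ((n + α i : ℕ) : WithTop ℕ∞) := by
      exact_mod_cast Nat.le_add_left _ _
    simp only [List.foldr_cons]
    rw [iterate_pderiv_eqOn hU i _ h1.2 hx,
      iterate_pderiv_sub_eqOn hU i _ (h1.1.of_le hle) (h2.1.of_le hle) hx]

theorem weight_le_of_mem_multiIndices {J : ℕ} {α : Fin N → ℕ} (h : α ∈ multiIndices N J) :
    ((List.finRange N).map α).sum ≤ J := by
  have := (Finset.mem_filter.1 h).2
  rwa [← List.ofFn_eq_map, List.sum_ofFn]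

theorem continuousOn_multiDeriv (hU : IsOpen U) {J n : ℕ} (hJ : J ≤ n) {α : Fin N → ℕ}
    (hα : α ∈ multiIndices N J) {f : Space N → ℂ} (hf : ContDiffOn ℝ n f U) :
    ContinuousOn (multiDeriv α f) U := by
  have hle := (weight_le_of_mem_multiIndices hα).trans hJ
  have hf' : ContDiffOn ℝ (0 + ((List.finRange N).map α).sum : ℕ) f U :=
    hf.of_le (by rw [zero_add]; exact_mod_cast hle)
  exact (contDiffOn_foldr_pderiv_and_sub_eqOn hU α _ 0 hf' hf').1.continuousOn

theorem multiDeriv_sub_eqOn (hU : IsOpen U) {J n : ℕ} (hJ : J ≤ n) {α : Fin N → ℕ}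
    (hα : α ∈ multiIndices N J) {f g : Space N → ℂ} (hf : ContDiffOn ℝ n f U)
    (hg : ContDiffOn ℝ n g U) :
    EqOn (multiDeriv α (f - g)) (multiDeriv α f - multiDeriv α g) U := by
  have hle := (weight_le_of_mem_multiIndices hα).trans hJ
  have hle' : ((0 + ((List.finRange N).map α).sum : ℕ) : WithTop ℕ∞) ≤ n := by
    rw [zero_add]; exact_mod_cast hle
  exact (contDiffOn_foldr_pderiv_and_sub_eqOn hU α _ 0 (hf.of_le hle') (hg.of_le hle')).2

end Derivatives

namespace Operators

variable {N M L L₁ J J₁ : ℕ} {P : Operators N M L L₁ J J₁} {D : Set (Space N)}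
  {u v : Space N → Fin M → ℂ}

theorem B_eqOn (hD : IsOpen D) (h : EqOn u v D) (k : Fin L₁) (ν : Space N) :
    EqOn (P.B k ν u) (P.B k ν v) D := by
  intro x hx
  have (j : Fin M) (α : Fin N → ℕ) :
      multiDeriv α (fun y => u y j) x = multiDeriv α (fun y => v y j) x :=
    multiDeriv_eqOn hD α (fun y hy => congrFun (h hy) j) hx
  simp only [B, this]

theorem IsSolution.mono {D' : Set (Space N)} (h : P.IsSolution D u) (hD : D' ⊆ D) :
    P.IsSolution D' u :=
  ⟨h.1.mono hD, fun x hx => h.2 x (hD hx)⟩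

theorem IsSolution.contDiffOn_apply (h : P.IsSolution D u) (j : Fin M) :
    ContDiffOn ℝ ((max J J₁ : ℕ) : WithTop ℕ∞) (fun y => u y j) D :=
  contDiffOn_pi.1 h.1 j

theorem IsSolution.sub (hD : IsOpen D) (hu : P.IsSolution D u) (hv : P.IsSolution D v) :
    P.IsSolution D (u - v) := by
  refine ⟨hu.1.sub hv.1, fun x hx k => ?_⟩
  have h : P.A k (u - v) x = P.A k u x - P.A k v x := by
    simp only [A, ← Finset.sum_sub_distrib]
    refine Finset.sum_congr rfl fun j _ => Finset.sum_congr rfl fun α hα => ?_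
    have := multiDeriv_sub_eqOn hD (le_max_left J J₁) hα (hu.contDiffOn_apply j)
      (hv.contDiffOn_apply j) hx
    rw [← mul_sub]
    exact congrArg _ this
  rw [h, hu.2 x hx k, hv.2 x hx k, sub_zero]

theorem IsSolution.continuousAt_B (hD : IsOpen D) (hu : P.IsSolution D u) (k : Fin L₁)
    (ν : Space N) {x : Space N} (hx : x ∈ D) : ContinuousAt (P.B k ν u) x := by
  have h (j : Fin M) {α : Fin N → ℕ} (hα : α ∈ multiIndices N J₁) :
      ContinuousAt (multiDeriv α (fun y => u y j)) x :=
    (continuousOn_multiDeriv hD (le_max_right J J₁) hα (hu.contDiffOn_apply j)).continuousAt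
      (hD.mem_nhds hx)
  unfold B
  refine ContinuousAt.add ?_ ?_
  · exact tendsto_finsetSum _ fun i _ => tendsto_finsetSum _ fun j _ =>
      tendsto_finsetSum _ fun α hα => (h j hα).const_mul _
  · exact tendsto_finsetSum _ fun j _ => tendsto_finsetSum _ fun α hα => (h j hα).const_mul _

theorem IsSolution.vanishOnFrom (hD : IsOpen D) (hu : P.IsSolution D u) {ν : Space N}
    {S : Set (Space N)} (hS : S ⊆ D) (h : P.VanishOn ν u S) (Ω : Set (Space N)) :
    P.VanishOnFrom Ω ν u S := by
  intro y hy k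
  have := (hu.continuousAt_B hD k ν (hS hy)).tendsto
  rw [h y hy k] at this
  exact this.mono_left nhdsWithin_le_nhds

/-- Two solutions in a connected open set that agree in a nonempty open subset are equal. -/
theorem UniqueContinuation.eqOn (hP : P.UniqueContinuation) (hD : IsOpen D) (hc : IsPreconnected D)
    (hu : P.IsSolution D u) (hv : P.IsSolution D v) {D' : Set (Space N)} (hD' : IsOpen D')
    (hsub : D' ⊆ D) (hne : D'.Nonempty) (h : EqOn u v D') : EqOn u v D := fun x hx =>
  sub_eq_zero.1 <| hP D (u - v) hD ⟨hne.mono hsub, hc⟩ (hu.sub hD hv) D' hsub hD' hne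
    (fun _ hy => sub_eq_zero.2 (h hy)) x hx

end Operators

/-! ### Geometry of hyperplanes and reflections -/

namespace OrientedHyperplane

variable {N : ℕ} (H : OrientedHyperplane N)

/-- The same hyperplane with the opposite normal. -/
def reverse : OrientedHyperplane N where
  normal := -H.normal
  offset := -H.offset
  norm_normal := by rw [norm_neg, H.norm_normal]

@[simp] theorem mem_plane {x : Space N} : x ∈ H.plane ↔ ⟪H.normal, x⟫ = H.offset := Iff.rfl
@[simp] theorem mem_posSide {x : Space N} : x ∈ H.posSide ↔ ⟪H.normal, x⟫ < H.offset := Iff.rfl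
@[simp] theorem mem_negSide {x : Space N} : x ∈ H.negSide ↔ H.offset < ⟪H.normal, x⟫ := Iff.rfl

@[simp] theorem plane_reverse : H.reverse.plane = H.plane := by
  ext x; simp [reverse, plane]

@[simp] theorem posSide_reverse : H.reverse.posSide = H.negSide := by
  ext x; simp [reverse, posSide, negSide]

@[simp] theorem negSide_reverse : H.reverse.negSide = H.posSide := by
  ext x; simp [reverse, posSide, negSide]

@[simp] theorem reflect_reverse : H.reverse.reflect = H.reflect := by
  ext1 x; simp only [reflect, reverse, inner_neg_left, smul_neg, sub_neg_eq_add]; module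

theorem inner_normal_self : ⟪H.normal, H.normal⟫ = 1 := by
  rw [real_inner_self_eq_norm_sq, H.norm_normal, one_pow]

theorem inner_reflect (x : Space N) : ⟪H.normal, H.reflect x⟫ = 2 * H.offset - ⟪H.normal, x⟫ := by
  rw [reflect, inner_sub_right, inner_smul_right, H.inner_normal_self]; ring

theorem inner_reflectDir (v : Space N) : ⟪H.normal, H.reflectDir v⟫ = -⟪H.normal, v⟫ := by
  rw [reflectDir, inner_sub_right, inner_smul_right, H.inner_normal_self]; ring

@[simp] theorem reflect_reflect (x : Space N) : H.reflect (H.reflect x) = x := by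
  conv_lhs => rw [reflect, inner_reflect, reflect]
  module

@[simp] theorem reflectDir_reflectDir (v : Space N) : H.reflectDir (H.reflectDir v) = v := by
  conv_lhs => rw [reflectDir, inner_reflectDir, reflectDir]
  module

theorem norm_reflectDir (v : Space N) : ‖H.reflectDir v‖ = ‖v‖ := by
  rw [← sq_eq_sq₀ (norm_nonneg _) (norm_nonneg _), reflectDir, norm_sub_sq_real, norm_smul,
    H.norm_normal, inner_smul_right, real_inner_comm v, mul_one, Real.norm_eq_abs, sq_abs]
  ring

/-- `reflectDir` as a linear isometry. -/
def reflDir : Space N ≃ₗᵢ[ℝ] Space N where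
  toFun := H.reflectDir
  invFun := H.reflectDir
  left_inv := H.reflectDir_reflectDir
  right_inv := H.reflectDir_reflectDir
  map_add' v w := by simp only [reflectDir, inner_add_right]; module
  map_smul' t v := by simp only [reflectDir, inner_smul_right, RingHom.id_apply]; module
  norm_map' := H.norm_reflectDir

/-- The reflection as an affine isometry; products of reflections are formed in the group of affine
isometries. -/
def refl : Space N ≃ᵃⁱ[ℝ] Space N :=
  AffineIsometryEquiv.mk' H.reflect H.reflDir 0 fun x => by
    change H.reflect x = H.reflectDir (x - 0) + H.reflect 0
    simp only [reflect, reflectDir, inner_zero_right, sub_zero]; module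

@[simp] theorem coe_refl : ⇑H.refl = H.reflect := rfl

@[simp] theorem refl_linear (v : Space N) : H.refl.linearIsometryEquiv v = H.reflectDir v := by
  rw [refl, AffineIsometryEquiv.linearIsometryEquiv_mk']; rfl

theorem refl_reverse : H.reverse.refl = H.refl := by
  ext1 x; simp

theorem continuous_reflect : Continuous H.reflect := H.refl.continuous

theorem dist_reflect (x y : Space N) : dist (H.reflect x) (H.reflect y) = dist x y :=
  H.refl.dist_map x y

theorem reflect_mem_plane {x : Space N} : H.reflect x ∈ H.plane ↔ x ∈ H.plane := by
  rw [mem_plane, inner_reflect, mem_plane]; constructor <;> intro h <;> linarith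

theorem reflect_mem_posSide {x : Space N} : H.reflect x ∈ H.posSide ↔ x ∈ H.negSide := by
  rw [mem_posSide, inner_reflect, mem_negSide]; constructor <;> intro h <;> linarith

theorem reflect_mem_negSide {x : Space N} : H.reflect x ∈ H.negSide ↔ x ∈ H.posSide := by
  rw [mem_negSide, inner_reflect, mem_posSide]; constructor <;> intro h <;> linarith

theorem reflect_eq_self {x : Space N} : H.reflect x = x ↔ x ∈ H.plane := by
  have hν : H.normal ≠ 0 := norm_ne_zero_iff.1 (by rw [H.norm_normal]; exact one_ne_zero)
  rw [reflect, sub_eq_self, smul_eq_zero_iff_left hν, mem_plane]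
  constructor <;> intro h <;> linarith

theorem reflect_mem_ball {x y : Space N} {r : ℝ} :
    H.reflect y ∈ Metric.ball (H.reflect x) r ↔ y ∈ Metric.ball x r := by
  rw [Metric.mem_ball, dist_reflect, Metric.mem_ball]

theorem isOpen_posSide : IsOpen H.posSide := isOpen_lt (by fun_prop) continuous_const
theorem isOpen_negSide : IsOpen H.negSide := isOpen_lt continuous_const (by fun_prop)
theorem isClosed_plane : IsClosed H.plane := isClosed_eq (by fun_prop) continuous_const

theorem convex_posSide : Convex ℝ H.posSide :=
  convex_halfSpace_lt (innerSL ℝ H.normal).toLinearMap.isLinear _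

theorem convex_negSide : Convex ℝ H.negSide :=
  convex_halfSpace_gt (innerSL ℝ H.normal).toLinearMap.isLinear _

theorem mem_negSide_or_mem_plane_or_mem_posSide (x : Space N) :
    x ∈ H.negSide ∨ x ∈ H.plane ∨ x ∈ H.posSide := by
  rcases lt_trichotomy H.offset ⟪H.normal, x⟫ with h | h | h
  exacts [.inl h, .inr (.inl h.symm), .inr (.inr h)]

theorem add_smul_normal_mem_negSide {x : Space N} (hx : x ∈ H.plane) {t : ℝ} (ht : 0 < t) :
    x + t • H.normal ∈ H.negSide := by
  rw [mem_negSide, inner_add_right, inner_smul_right, H.inner_normal_self, H.mem_plane.1 hx]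
  linarith

theorem mem_closure_negSide_inter_ball {x y : Space N} {r : ℝ} (hy : y ∈ H.plane)
    (h : y ∈ Metric.ball x r) : y ∈ closure (H.negSide ∩ Metric.ball x r) := by
  have hlim : Tendsto (fun t : ℝ => y + t • H.normal) (𝓝[>] 0) (𝓝 y) := by
    have : ContinuousAt (fun t : ℝ => y + t • H.normal) 0 := by fun_prop
    simpa using this.tendsto.mono_left nhdsWithin_le_nhds
  refine mem_closure_of_tendsto hlim ?_
  filter_upwards [self_mem_nhdsWithin, hlim (Metric.isOpen_ball.mem_nhds h)] with t ht hb
  exact ⟨H.add_smul_normal_mem_negSide hy ht, hb⟩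

theorem mem_closure_posSide_inter_ball {x y : Space N} {r : ℝ} (hy : y ∈ H.plane)
    (h : y ∈ Metric.ball x r) : y ∈ closure (H.posSide ∩ Metric.ball x r) := by
  simpa using H.reverse.mem_closure_negSide_inter_ball (by simpa using hy) h

theorem nonempty_negSide_inter_ball {x : Space N} {r : ℝ} (hx : x ∈ H.plane) (hr : 0 < r) :
    (H.negSide ∩ Metric.ball x r).Nonempty :=
  closure_nonempty_iff.1 ⟨x, H.mem_closure_negSide_inter_ball hx (Metric.mem_ball_self hr)⟩

theorem ball_subset_closure {x : Space N} {r : ℝ} :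
    Metric.ball x r ⊆ closure (H.negSide ∩ Metric.ball x r) ∪
      closure (H.posSide ∩ Metric.ball x r) := by
  intro y hy
  rcases H.mem_negSide_or_mem_plane_or_mem_posSide y with h | h | h
  exacts [.inl (subset_closure ⟨h, hy⟩), .inl (H.mem_closure_negSide_inter_ball h hy),
    .inr (subset_closure ⟨h, hy⟩)]

/-- The image of an oriented hyperplane under an affine isometry. -/
def map (g : Space N ≃ᵃⁱ[ℝ] Space N) : OrientedHyperplane N where
  normal := g.linearIsometryEquiv H.normal
  offset := H.offset + ⟪g.linearIsometryEquiv H.normal, g 0⟫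
  norm_normal := by rw [LinearIsometryEquiv.norm_map, H.norm_normal]

theorem inner_map_normal (g : Space N ≃ᵃⁱ[ℝ] Space N) (x : Space N) :
    ⟪(H.map g).normal, g x⟫ - (H.map g).offset = ⟪H.normal, x⟫ - H.offset := by
  have h : g x = g.linearIsometryEquiv x + g 0 := by
    have := g.map_vadd 0 x
    simpa using this
  rw [h, inner_add_right, map, LinearIsometryEquiv.inner_map_map]; ring

theorem map_mem_plane {g : Space N ≃ᵃⁱ[ℝ] Space N} {x : Space N} :
    g x ∈ (H.map g).plane ↔ x ∈ H.plane := by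
  rw [mem_plane, mem_plane, ← sub_eq_zero, inner_map_normal, sub_eq_zero]

theorem map_mem_posSide {g : Space N ≃ᵃⁱ[ℝ] Space N} {x : Space N} :
    g x ∈ (H.map g).posSide ↔ x ∈ H.posSide := by
  rw [mem_posSide, mem_posSide, ← sub_neg, inner_map_normal, sub_neg]

theorem map_plane (g : Space N ≃ᵃⁱ[ℝ] Space N) : (H.map g).plane = g '' H.plane := by
  ext x
  obtain ⟨y, rfl⟩ := g.surjective x
  rw [map_mem_plane, g.injective.mem_set_image]

theorem map_posSide (g : Space N ≃ᵃⁱ[ℝ] Space N) : (H.map g).posSide = g '' H.posSide := by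
  ext x
  obtain ⟨y, rfl⟩ := g.surjective x
  rw [map_mem_posSide, g.injective.mem_set_image]

theorem map_refl_normal (H₁ : OrientedHyperplane N) :
    (H₁.map H.refl).normal = H.reflectDir H₁.normal := H.refl_linear _

end OrientedHyperplane

/-! ### Connectedness and general position -/

theorem _root_.IsPreconnected.subset_of_disjoint_frontier {X : Type*} [TopologicalSpace X]
    {s u : Set X} (hs : IsPreconnected s) (hu : IsOpen u) (hd : Disjoint s (frontier u))
    (hne : (s ∩ u).Nonempty) : s ⊆ u := by
  refine hs.subset_left_of_subset_union (v := (closure u)ᶜ) hu isClosed_closure.isOpen_compl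
    ?_ ?_ hne
  · exact disjoint_compl_right.mono_left subset_closure
  · intro x hx
    by_cases h : x ∈ u
    · exact .inl h
    · refine .inr fun hc => hd.le_bot ⟨hx, ?_⟩
      rw [hu.frontier_eq]; exact ⟨hc, h⟩

section GeneralPosition

variable {N : ℕ}

theorem dense_compl_hyperplane {n : Space N} (hn : n ≠ 0) (c : ℝ) :
    Dense {x : Space N | ⟪n, x⟫ = c}ᶜ := by
  intro x
  have hlim : Tendsto (fun t : ℝ => x + t • n) (𝓝[≠] 0) (𝓝 x) := by
    have : ContinuousAt (fun t : ℝ => x + t • n) 0 := by fun_prop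
    simpa using this.tendsto.mono_left nhdsWithin_le_nhds
  by_cases hx : ⟪n, x⟫ = c
  · refine mem_closure_of_tendsto hlim ?_
    filter_upwards [self_mem_nhdsWithin] with t ht h
    rw [mem_ofPred_eq, inner_add_right, hx, inner_smul_right, add_eq_left, mul_eq_zero,
      inner_self_eq_zero] at h
    exact h.elim ht hn
  · exact subset_closure hx

/-- Finitely many hyperplanes `⟪n i, x⟫ = c i`, with normals that may vanish when the equation then
has no solution, have a dense complement. -/
theorem dense_avoiding {ι : Type*} {s : Set ι} (hs : s.Finite) (n : ι → Space N) (c : ι → ℝ)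
    (h : ∀ i ∈ s, n i = 0 → c i ≠ 0) : Dense {x : Space N | ∀ i ∈ s, ⟪n i, x⟫ ≠ c i} := by
  have : {x : Space N | ∀ i ∈ s, ⟪n i, x⟫ ≠ c i} = ⋂ i ∈ s, {x | ⟪n i, x⟫ = c i}ᶜ := by
    ext x; simp
  rw [this]
  refine (dense_biInter_of_isOpen (fun i _ => ?_) hs.countable fun i hi => ?_)
  · exact (isClosed_eq (by fun_prop) continuous_const).isOpen_compl
  · by_cases hn : n i = 0
    · have : {x : Space N | ⟪n i, x⟫ = c i}ᶜ = univ := by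
        ext x; simp [hn, (h i hi hn).symm]
      rw [this]; exact dense_univ
    · exact dense_compl_hyperplane hn _

/-- A point through which at most one hyperplane of the family `𝓗` passes; hyperplanes that differ
by their orientation only count as one. -/
def IsSimple (𝓗 : Set (OrientedHyperplane N)) (x : Space N) : Prop :=
  ∀ H ∈ 𝓗, ∀ H' ∈ 𝓗, x ∈ H.plane → x ∈ H'.plane → H.plane = H'.plane

/-- Hyperplanes with proportional equations are equal. -/
theorem plane_eq_of_smul_eq {H H' : OrientedHyperplane N} {a b : ℝ} (ha : a ≠ 0)
    (hn : b • H.normal = a • H'.normal) (hc : b * H.offset = a * H'.offset) (hb : b ≠ 0) :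
    H.plane = H'.plane := by
  ext x
  have h : b * ⟪H.normal, x⟫ = a * ⟪H'.normal, x⟫ := by
    rw [← real_inner_smul_left, hn, real_inner_smul_left]
  rw [H.mem_plane, H'.mem_plane, ← mul_right_inj' hb, h, hc, mul_right_inj' ha]

theorem isOpen_avoiding {𝓗 : Set (OrientedHyperplane N)} (h𝓗 : 𝓗.Finite) :
    IsOpen {x : Space N | ∀ H ∈ 𝓗, x ∉ H.plane} := by
  have : {x : Space N | ∀ H ∈ 𝓗, x ∉ H.plane} = ⋂ H ∈ 𝓗, H.planeᶜ := by
    ext x; simp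
  rw [this]
  exact h𝓗.isOpen_biInter fun H _ => H.isClosed_plane.isOpen_compl

theorem dense_avoiding_planes {𝓗 : Set (OrientedHyperplane N)} (h𝓗 : 𝓗.Finite) :
    Dense {x : Space N | ∀ H ∈ 𝓗, x ∉ H.plane} :=
  dense_avoiding h𝓗 _ _ fun H _ h => by
    have := H.norm_normal; rw [h, norm_zero] at this; exact absurd this zero_ne_one

/-- In a fixed direction, almost every line meets the hyperplanes of a finite family one at a
time. -/
theorem exists_line_isSimple {𝓗 : Set (OrientedHyperplane N)} (h𝓗 : 𝓗.Finite) (e : Space N)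
    {U : Set (Space N)} (hU : IsOpen U) (hne : U.Nonempty) :
    ∃ p ∈ U, (∀ H ∈ 𝓗, p ∉ H.plane) ∧ ∀ t : ℝ, IsSimple 𝓗 (p + t • e) := by
  let n : OrientedHyperplane N × OrientedHyperplane N → Space N := fun q =>
    ⟪q.2.normal, e⟫ • q.1.normal - ⟪q.1.normal, e⟫ • q.2.normal
  let c : OrientedHyperplane N × OrientedHyperplane N → ℝ := fun q =>
    ⟪q.2.normal, e⟫ * q.1.offset - ⟪q.1.normal, e⟫ * q.2.offset
  have h2 : Dense {x : Space N | ∀ q ∈ {q ∈ 𝓗 ×ˢ 𝓗 | n q ≠ 0}, ⟪n q, x⟫ ≠ c q} :=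
    dense_avoiding ((h𝓗.prod h𝓗).subset (sep_subset _ _)) _ _ fun q hq h => absurd h hq.2
  obtain ⟨p, hpU, hp2, hp1⟩ := (h2.inter_of_isOpen_right (dense_avoiding_planes h𝓗)
    (isOpen_avoiding h𝓗)).inter_open_nonempty U hU hne
  refine ⟨p, hpU, hp1, fun t H hH H' hH' hx hx' => ?_⟩
  have ha : ⟪H.normal, p⟫ ≠ H.offset := hp1 H hH
  have ha' : ⟪H'.normal, p⟫ ≠ H'.offset := hp1 H' hH'
  rw [H.mem_plane, inner_add_right, inner_smul_right] at hx
  rw [H'.mem_plane, inner_add_right, inner_smul_right] at hx'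
  have hn : ⟪n (H, H'), p⟫ = c (H, H') := by
    simp only [n, c, inner_sub_left, real_inner_smul_left]
    rw [← hx, ← hx']; ring
  have hn0 : n (H, H') = 0 := by
    by_contra h
    exact hp2 (H, H') ⟨⟨hH, hH'⟩, h⟩ hn
  have hc0 : c (H, H') = 0 := by rw [← hn, hn0, inner_zero_left]
  refine plane_eq_of_smul_eq (a := ⟪H.normal, e⟫) (b := ⟪H'.normal, e⟫) ?_ (sub_eq_zero.1 hn0)
    (sub_eq_zero.1 hc0) ?_
  · intro h; rw [h, mul_zero, add_zero] at hx; exact ha hx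
  · intro h; rw [h, mul_zero, add_zero] at hx'; exact ha' hx'

/-- From a point off a finite family of hyperplanes, almost every line meets the hyperplanes one at
a time. -/
theorem dense_line_isSimple {𝓗 : Set (OrientedHyperplane N)} (h𝓗 : 𝓗.Finite) {p : Space N}
    (hp : ∀ H ∈ 𝓗, p ∉ H.plane) :
    Dense {q : Space N | ∀ t : ℝ, IsSimple 𝓗 (p + t • (q - p))} := by
  let n : OrientedHyperplane N × OrientedHyperplane N → Space N := fun q =>
    (⟪q.2.normal, p⟫ - q.2.offset) • q.1.normal - (⟪q.1.normal, p⟫ - q.1.offset) • q.2.normal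
  have h2 : Dense {x : Space N | ∀ q ∈ {q ∈ 𝓗 ×ˢ 𝓗 | n q ≠ 0}, ⟪n q, x⟫ ≠ ⟪n q, p⟫} :=
    dense_avoiding ((h𝓗.prod h𝓗).subset (sep_subset _ _)) _ _ fun q hq h => absurd h hq.2
  refine h2.mono fun q hq t H hH H' hH' hx hx' => ?_
  have ha : ⟪H.normal, p⟫ - H.offset ≠ 0 := sub_ne_zero.2 (hp H hH)
  have ha' : ⟪H'.normal, p⟫ - H'.offset ≠ 0 := sub_ne_zero.2 (hp H' hH')
  rw [H.mem_plane, inner_add_right, inner_smul_right] at hx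
  rw [H'.mem_plane, inner_add_right, inner_smul_right] at hx'
  have ht : t ≠ 0 := by
    rintro rfl; rw [zero_mul, add_zero] at hx; exact hp H hH hx
  have hn : ⟪n (H, H'), q⟫ = ⟪n (H, H'), p⟫ := by
    rw [← sub_eq_zero, ← inner_sub_right]
    refine (mul_eq_zero.1 ?_).resolve_left ht
    simp only [n, inner_sub_left, real_inner_smul_left]
    linear_combination (⟪H'.normal, p⟫ - H'.offset) * hx - (⟪H.normal, p⟫ - H.offset) * hx'
  have hn0 : n (H, H') = 0 := by
    by_contra h
    exact hq (H, H') ⟨⟨hH, hH'⟩, h⟩ hn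
  have hc : ⟪n (H, H'), p⟫ = 0 := by rw [hn0, inner_zero_left]
  simp only [n, inner_sub_left, real_inner_smul_left] at hc
  refine plane_eq_of_smul_eq ha (sub_eq_zero.1 hn0) ?_ ha'
  linear_combination hc

/-- A closed set `C` that is a neighbourhood of each of its points in `W` through which at most one
hyperplane of a finite family passes contains the connected open set `W` as soon as it contains an
open part of it: the intersections of two hyperplanes have codimension two and do not separate. -/
theorem subset_of_mem_nhds_of_isSimple {𝓗 : Set (OrientedHyperplane N)} (h𝓗 : 𝓗.Finite)
    {W C : Set (Space N)} (hW : IsOpen W) (hWc : IsPreconnected W) (hC : IsClosed C)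
    (h : ∀ y ∈ W, y ∈ C → IsSimple 𝓗 y → C ∈ 𝓝 y) (hne : (W ∩ interior C).Nonempty) :
    W ⊆ C := by
  have hfr : frontier (interior C) ⊆ C :=
    frontier_subset_closure.trans (closure_minimal interior_subset hC)
  refine (hWc.subset_of_disjoint_frontier isOpen_interior ?_ hne).trans interior_subset
  rw [disjoint_left]
  intro y hyW hy
  obtain ⟨r, hr, hrW⟩ := Metric.isOpen_iff.1 hW y hyW
  have hB : (Metric.ball y r ∩ interior C).Nonempty :=
    mem_closure_iff.1 hy.1 _ Metric.isOpen_ball (Metric.mem_ball_self hr)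
  obtain ⟨p, ⟨hpB, hpC⟩, hp⟩ := (dense_avoiding_planes h𝓗).inter_open_nonempty _
    (Metric.isOpen_ball.inter isOpen_interior) hB
  have hsub : Metric.ball y r ⊆ C := by
    have h1 : Metric.ball y r ∩ {q | ∀ t : ℝ, IsSimple 𝓗 (p + t • (q - p))} ⊆ C := by
      rintro q ⟨hqB, hq⟩
      have hs : IsPreconnected ((fun t : ℝ => p + t • (q - p)) '' Icc 0 1) :=
        isPreconnected_Icc.image _ (by fun_prop)
      have hsB : (fun t : ℝ => p + t • (q - p)) '' Icc 0 1 ⊆ Metric.ball y r := by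
        rintro _ ⟨t, ht, rfl⟩
        exact (convex_ball y r).add_smul_sub_mem hpB hqB ht
      refine interior_subset (hs.subset_of_disjoint_frontier isOpen_interior ?_
        ⟨p, ⟨0, by simp, by simp⟩, hpC⟩ ⟨1, by simp, by simp⟩)
      rw [disjoint_left]
      intro z hz hzf
      have hzC := h z (hrW (hsB hz)) (hfr hzf) (by obtain ⟨t, -, rfl⟩ := hz; exact hq t)
      rw [isOpen_interior.frontier_eq] at hzf
      exact hzf.2 (mem_interior_iff_mem_nhds.2 hzC)
    exact ((dense_line_isSimple h𝓗 hp).open_subset_closure_inter Metric.isOpen_ball).trans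
      (closure_minimal h1 hC)
  rw [isOpen_interior.frontier_eq] at hy
  exact hy.2 (interior_maximal hsub Metric.isOpen_ball (Metric.mem_ball_self hr))

/-- A small ball about `x` meets only those members of a finite family of hyperplanes that pass
through `x`. -/
theorem exists_ball_avoiding {𝓗 : Set (OrientedHyperplane N)} (h𝓗 : 𝓗.Finite) (x : Space N) :
    ∃ r > 0, ∀ H ∈ 𝓗, (H.plane ∩ Metric.ball x r).Nonempty → x ∈ H.plane := by
  have ho := isOpen_avoiding (h𝓗.subset (sep_subset 𝓗 fun H => x ∉ H.plane))
  obtain ⟨r, hr, h⟩ := Metric.isOpen_iff.1 ho x fun H hH => hH.2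
  refine ⟨r, hr, fun H hH ⟨y, hy, hyB⟩ => ?_⟩
  by_contra hx
  exact h hyB H ⟨hH, hx⟩ hy

end GeneralPosition

/-! ### Neighbourhoods of infinity -/

section Infinity

variable {N : ℕ}

/-- A connected cone stays connected when the points of norm at most `ρ` are removed: radial
stretching maps the cone onto what is left. -/
theorem isPreconnected_cone_diff {S : Set (Space N)} (hS : IsPreconnected S)
    (h0 : (0 : Space N) ∉ S)
    (hcone : ∀ v ∈ S, ∀ t : ℝ, 0 < t → t • v ∈ S) (p : Space N) {ρ : ℝ} (hρ : 0 ≤ ρ) :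
    IsPreconnected {x | x - p ∈ S ∧ ρ < ‖x - p‖} := by
  have hne : ∀ v ∈ S, v ≠ 0 := fun v hv h => h0 (h ▸ hv)
  have hcont : ContinuousOn (fun v : Space N => p + (1 + ρ / ‖v‖) • v) S := by
    refine continuousOn_const.add (ContinuousOn.smul (f := fun v : Space N => 1 + ρ / ‖v‖)
      (g := fun v => v) ?_ continuousOn_id)
    exact continuousOn_const.add (continuousOn_const.div (by fun_prop)
      fun v hv => norm_ne_zero_iff.2 (hne v hv))
  convert hS.image _ hcont using 1
  ext x
  constructor
  · rintro ⟨hx, hxρ⟩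
    have h1 : 0 < ‖x - p‖ - ρ := sub_pos.2 hxρ
    have h2 : 0 < ‖x - p‖ := hρ.trans_lt hxρ
    have h3 : 0 < (‖x - p‖ - ρ) / ‖x - p‖ := div_pos h1 h2
    refine ⟨((‖x - p‖ - ρ) / ‖x - p‖) • (x - p), hcone _ hx _ h3, ?_⟩
    have h4 : ‖((‖x - p‖ - ρ) / ‖x - p‖) • (x - p)‖ = ‖x - p‖ - ρ := by
      rw [norm_smul, Real.norm_of_nonneg h3.le, div_mul_cancel₀ _ h2.ne']
    simp only [h4, smul_smul]
    have h5 : (1 + ρ / (‖x - p‖ - ρ)) * ((‖x - p‖ - ρ) / ‖x - p‖) = 1 := by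
      field_simp; ring
    rw [h5, one_smul, add_sub_cancel]
  · rintro ⟨v, hv, rfl⟩
    have h1 : 0 < ‖v‖ := norm_pos_iff.2 (hne v hv)
    have h2 : 0 < 1 + ρ / ‖v‖ := by positivity
    simp only [mem_ofPred_eq, add_sub_cancel_left]
    refine ⟨hcone v hv _ h2, ?_⟩
    rw [norm_smul, Real.norm_of_nonneg h2.le, add_mul, one_mul, div_mul_cancel₀ _ h1.ne']
    linarith

theorem isPreconnected_compl_closedBall (hN : 2 ≤ N) {ρ : ℝ} (hρ : 0 ≤ ρ) :
    IsPreconnected (Metric.closedBall (0 : Space N) ρ)ᶜ := by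
  have hrank : 1 < Module.rank ℝ (Space N) := by
    rw [← Module.finrank_eq_rank, finrank_euclideanSpace_fin]; exact_mod_cast hN
  convert isPreconnected_cone_diff (isConnected_compl_singleton_of_one_lt_rank hrank
    (0 : Space N)).isPreconnected (by simp) (fun v hv t ht => ?_) 0 hρ using 1
  · ext x
    simp only [mem_compl_iff, Metric.mem_closedBall, dist_zero_right, not_le, sub_zero,
      mem_singleton_iff, mem_ofPred_eq]
    exact ⟨fun h => ⟨norm_pos_iff.1 (hρ.trans_lt h), h⟩, And.right⟩
  · simpa [ht.ne'] using hv

/-- The part of a half-space outside a ball centred on the bounding hyperplane is connected. -/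
theorem OrientedHyperplane.isPreconnected_negSide_diff (H : OrientedHyperplane N) {p : Space N}
    (hp : p ∈ H.plane) {ρ : ℝ} (hρ : 0 ≤ ρ) :
    IsPreconnected (H.negSide \ Metric.closedBall p ρ) := by
  have hconv : Convex ℝ {v : Space N | 0 < ⟪H.normal, v⟫} :=
    convex_halfSpace_gt (innerSL ℝ H.normal).toLinearMap.isLinear _
  convert isPreconnected_cone_diff hconv.isPreconnected (by simp) (fun v hv t ht => ?_) p hρ
    using 1
  · ext x
    simp only [Set.mem_sdiff, mem_negSide, Metric.mem_closedBall, not_le, mem_ofPred_eq,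
      inner_sub_right, H.mem_plane.1 hp, sub_pos, dist_eq_norm]
  · rw [mem_ofPred_eq, inner_smul_right]; exact mul_pos ht hv

theorem exists_norm_gt (hN : 2 ≤ N) (ρ : ℝ) : ∃ x : Space N, ρ < ‖x‖ := by
  have : Nontrivial (Space N) := by
    have : Nonempty (Fin N) := ⟨⟨0, by omega⟩⟩
    infer_instance
  exact NormedSpace.exists_lt_norm ℝ (Space N) ρ

theorem not_isBounded_compl_closedBall (hN : 2 ≤ N) (ρ : ℝ) :
    ¬ Bornology.IsBounded (Metric.closedBall (0 : Space N) ρ)ᶜ := by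
  intro h
  obtain ⟨R, hR⟩ := h.subset_closedBall (0 : Space N)
  obtain ⟨x, hx⟩ := exists_norm_gt hN (max ρ R)
  have h1 : x ∈ Metric.closedBall (0 : Space N) R := hR <| by
    simpa using (le_max_left _ _).trans_lt hx
  rw [mem_closedBall_zero_iff] at h1
  exact absurd ((le_max_right ρ R).trans_lt hx) (not_lt.2 h1)

/-- In dimension at least two a hyperplane contains, for each of its points `x`, a direction in
which the distance to the origin does not decrease. -/
theorem OrientedHyperplane.exists_tangent (H : OrientedHyperplane N) (hN : 2 ≤ N) (x : Space N) :
    ∃ v : Space N, ‖v‖ = 1 ∧ ⟪H.normal, v⟫ = 0 ∧ 0 ≤ ⟪x, v⟫ := by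
  have hfr : 0 < Module.finrank ℝ (ℝ ∙ H.normal)ᗮ := by
    have h1 := Submodule.finrank_add_finrank_orthogonal (ℝ ∙ H.normal)
    have h2 := finrank_span_singleton (K := ℝ) (v := H.normal)
      (norm_ne_zero_iff.1 (by rw [H.norm_normal]; exact one_ne_zero))
    rw [h2, finrank_euclideanSpace_fin] at h1
    omega
  have := Module.finrank_pos_iff.1 hfr
  obtain ⟨⟨w, hw⟩, hw0⟩ := exists_ne (0 : (ℝ ∙ H.normal)ᗮ)
  have hw0' : w ≠ 0 := fun h => hw0 (Subtype.ext h)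
  rw [Submodule.mem_orthogonal_singleton_iff_inner_right] at hw
  have key (w : Space N) (hw : ⟪H.normal, w⟫ = 0) (hw0 : w ≠ 0) (hx : 0 ≤ ⟪x, w⟫) :
      ∃ v : Space N, ‖v‖ = 1 ∧ ⟪H.normal, v⟫ = 0 ∧ 0 ≤ ⟪x, v⟫ :=
    ⟨‖w‖⁻¹ • w, by rw [norm_smul, norm_inv, norm_norm, inv_mul_cancel₀ (norm_ne_zero_iff.2 hw0)],
      by rw [inner_smul_right, hw, mul_zero],
      by rw [inner_smul_right]; exact mul_nonneg (by positivity) hx⟩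
  rcases le_total 0 ⟪x, w⟫ with h | h
  · exact key w hw hw0' h
  · exact key (-w) (by rw [inner_neg_right, hw, neg_zero]) (neg_ne_zero.2 hw0')
      (by rw [inner_neg_right]; linarith)

end Infinity

/-! ### Flat points and the symmetry they produce -/

theorem disjoint_frontier_connectedComponentIn {X : Type*} [TopologicalSpace X]
    [LocallyConnectedSpace X] {F : Set X} (hF : IsOpen F) (p : X) :
    Disjoint F (frontier (connectedComponentIn F p)) := by
  rw [disjoint_left]
  intro y hyF hy
  rw [(hF.connectedComponentIn).frontier_eq] at hy
  obtain ⟨z, hz, hzp⟩ := mem_closure_iff.1 hy.1 _ (hF.connectedComponentIn (x := y))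
    (mem_connectedComponentIn hyF)
  apply hy.2
  rw [connectedComponentIn_eq hzp, ← connectedComponentIn_eq hz]
  exact mem_connectedComponentIn hyF

/-- The part of `G` on the negative side of `H` whose mirror image also lies in `G`: it is here that
a function on `G` can be compared with its reflection. -/
def mirrorRegion {N : ℕ} (H : OrientedHyperplane N) (G : Set (Space N)) : Set (Space N) :=
  H.negSide ∩ (G ∩ H.reflect ⁻¹' G)

section MirrorRegion

variable {N : ℕ} {H : OrientedHyperplane N} {G : Set (Space N)}

theorem isOpen_mirrorRegion (hG : IsOpen G) : IsOpen (mirrorRegion H G) :=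
  H.isOpen_negSide.inter (hG.inter (hG.preimage H.continuous_reflect))

theorem ball_inter_negSide_subset_mirrorRegion {x : Space N} {r : ℝ} (hx : x ∈ H.plane)
    (hr : Metric.ball x r ⊆ G) : Metric.ball x r ∩ H.negSide ⊆ mirrorRegion H G := by
  rintro y ⟨hy, hyn⟩
  refine ⟨hyn, hr hy, hr ?_⟩
  rw [← H.reflect_eq_self.2 hx]
  exact H.reflect_mem_ball.2 hy

end MirrorRegion

namespace Operators

variable {N M L L₁ J J₁ : ℕ} {P : Operators N M L L₁ J J₁} {G : Set (Space N)}
  {u : Space N → Fin M → ℂ} {H : OrientedHyperplane N}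
  {T : (Space N → Fin M → ℂ) → Space N → Fin M → ℂ}

variable (P) in
/-- `x` is a flat point of `u` in `G`, with the hyperplane `H`. -/
def IsFlatAt (G : Set (Space N)) (u : Space N → Fin M → ℂ) (H : OrientedHyperplane N)
    (x : Space N) : Prop :=
  x ∈ H.plane ∧ ∃ r > 0, Metric.ball x r ⊆ G ∧ P.VanishOn H.normal u (Metric.ball x r ∩ H.plane)

theorem eqOn_reflection_of_vanishOn (hP : P.UniqueContinuation) (hT : P.IsReflectionOperator H T)
    (hu : P.IsSolution G u) {x : Space N} (hx : x ∈ H.plane) {r : ℝ} (hr : 0 < r)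
    (hG : Metric.ball x r ⊆ G) (hv : P.VanishOn H.normal u (Metric.ball x r ∩ H.plane)) :
    EqOn u (T (u ∘ H.reflect)) (Metric.ball x r ∩ H.negSide) := by
  have hub := hu.mono hG
  obtain ⟨-, w, hw, hwp, hwn⟩ := hT.glue (Metric.ball x r ∩ H.posSide) u
    (Metric.isOpen_ball.inter H.isOpen_posSide) inter_subset_right (hub.mono inter_subset_left)
    x hx r hr subset_rfl (hub.vanishOnFrom Metric.isOpen_ball inter_subset_left hv _)
  have hne : (Metric.ball x r ∩ H.posSide).Nonempty := by
    have := H.reverse.nonempty_negSide_inter_ball (by simpa using hx) hr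
    rwa [H.negSide_reverse, inter_comm] at this
  have h := hP.eqOn Metric.isOpen_ball (convex_ball x r).isPreconnected hub hw
    (Metric.isOpen_ball.inter H.isOpen_posSide) inter_subset_left hne hwp.symm
  exact fun y hy => (h hy.1).trans (hwn hy)

/-- The identity between `u` and its reflection propagates within connected subsets of the mirror
region. -/
theorem eqOn_reflection_of_subset (hP : P.UniqueContinuation) (hT : P.IsReflectionOperator H T)
    (hu : P.IsSolution G u) {D D' : Set (Space N)} (hD : IsOpen D) (hDc : IsPreconnected D)
    (hDG : D ⊆ mirrorRegion H G) (hD' : IsOpen D') (hsub : D' ⊆ D) (hne : D'.Nonempty)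
    (h : EqOn u (T (u ∘ H.reflect)) D') : EqOn u (T (u ∘ H.reflect)) D := by
  have hsol := hT.isSolution (H.reflect '' D) u (H.refl.toHomeomorph.isOpenMap D hD)
    (by rintro _ ⟨y, hy, rfl⟩; exact H.reflect_mem_posSide.2 (hDG hy).1)
    (hu.mono (by rintro _ ⟨y, hy, rfl⟩; exact (hDG hy).2.2))
  rw [image_image] at hsol
  simp only [OrientedHyperplane.reflect_reflect, image_id'] at hsol
  exact hP.eqOn hD hDc (hu.mono fun y hy => (hDG hy).2.1) hsol hD' hsub hne h

theorem IsFlatAt.eqOn_reflection (hP : P.UniqueContinuation) (hT : P.IsReflectionOperator H T)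
    (hu : P.IsSolution G u) {x : Space N} (hx : P.IsFlatAt G u H x) {D : Set (Space N)}
    (hD : IsOpen D) (hDc : IsPreconnected D) (hDG : D ⊆ mirrorRegion H G) {r : ℝ} (hr : 0 < r)
    (hrD : Metric.ball x r ∩ H.negSide ⊆ D) : EqOn u (T (u ∘ H.reflect)) D := by
  obtain ⟨hxH, r₀, hr₀, hG, hv⟩ := hx
  have hsub : Metric.ball x (min r r₀) ⊆ Metric.ball x r :=
    Metric.ball_subset_ball (min_le_left _ _)
  have hsub₀ : Metric.ball x (min r r₀) ⊆ Metric.ball x r₀ :=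
    Metric.ball_subset_ball (min_le_right _ _)
  refine eqOn_reflection_of_subset hP hT hu hD hDc hDG
    (Metric.isOpen_ball.inter H.isOpen_negSide) ((inter_subset_inter_left _ hsub).trans hrD) ?_
    (eqOn_reflection_of_vanishOn hP hT hu hxH (lt_min hr hr₀) (hsub₀.trans hG)
      fun y hy => hv y ⟨hsub₀ hy.1, hy.2⟩)
  rw [inter_comm]
  exact H.nonempty_negSide_inter_ball hxH (lt_min hr hr₀)

theorem IsFlatAt.eqOn_component (hP : P.UniqueContinuation) (hT : P.IsReflectionOperator H T)
    (hG : IsOpen G) (hu : P.IsSolution G u) {x : Space N} (hx : P.IsFlatAt G u H x) {r : ℝ}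
    (hr : 0 < r) (hrG : Metric.ball x r ⊆ G) {p : Space N}
    (hp : p ∈ Metric.ball x r ∩ H.negSide) :
    EqOn u (T (u ∘ H.reflect)) (connectedComponentIn (mirrorRegion H G) p) :=
  hx.eqOn_reflection hP hT hu (isOpen_mirrorRegion hG).connectedComponentIn
    isPreconnected_connectedComponentIn (connectedComponentIn_subset _ _) hr <|
    ((convex_ball x r).inter H.convex_negSide).isPreconnected.subset_connectedComponentIn hp
      (ball_inter_negSide_subset_mirrorRegion hx.1 hrG)

theorem vanishOn_of_eqOn_reflection (hT : P.IsReflectionOperator H T) (hu : P.IsSolution G u)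
    {x : Space N} (hx : x ∈ H.plane) {r : ℝ} (hr : 0 < r) (hG : Metric.ball x r ⊆ G)
    (h : EqOn u (T (u ∘ H.reflect)) (Metric.ball x r ∩ H.negSide)) :
    P.VanishOn H.normal u (Metric.ball x r ∩ H.plane) ∧
      P.VanishOn H.reverse.normal u (Metric.ball x r ∩ H.plane) :=
  hT.vanish x hx r hr u (hu.mono hG) h

/-- The boundary condition at a flat point holds in the hyperplane on every ball inside `G`, for
both unit normals. -/
theorem IsFlatAt.vanishOn_ball (hP : P.Admissible) (hu : P.IsSolution G u) {x : Space N}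
    (hx : P.IsFlatAt G u H x) {r : ℝ} (hr : 0 < r) (hG : Metric.ball x r ⊆ G) :
    P.VanishOn H.normal u (Metric.ball x r ∩ H.plane) ∧
      P.VanishOn H.reverse.normal u (Metric.ball x r ∩ H.plane) := by
  obtain ⟨T, hT⟩ := hP.reflection H
  exact vanishOn_of_eqOn_reflection hT hu hx.1 hr hG <|
    hx.eqOn_reflection hP.uniqueContinuation hT hu (Metric.isOpen_ball.inter H.isOpen_negSide)
      ((convex_ball x r).inter H.convex_negSide).isPreconnected
      (ball_inter_negSide_subset_mirrorRegion hx.1 hG) hr subset_rfl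

theorem IsFlatAt.reverse (hP : P.Admissible) (hu : P.IsSolution G u) {x : Space N}
    (hx : P.IsFlatAt G u H x) : P.IsFlatAt G u H.reverse x := by
  obtain ⟨r, hr, hG, -⟩ := hx.2
  refine ⟨by simpa using hx.1, r, hr, hG, ?_⟩
  rw [H.plane_reverse]
  exact (hx.vanishOn_ball hP hu hr hG).2

theorem IsFlatAt.of_mem_ball (hP : P.Admissible) (hu : P.IsSolution G u) {x y : Space N}
    (hx : P.IsFlatAt G u H x) {r : ℝ} (hG : Metric.ball x r ⊆ G) (hy : y ∈ Metric.ball x r)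
    (hyH : y ∈ H.plane) : P.IsFlatAt G u H y := by
  obtain ⟨s, hs, hsr⟩ := Metric.isOpen_iff.1 Metric.isOpen_ball y hy
  exact ⟨hyH, s, hs, hsr.trans hG, fun z hz =>
    (hx.vanishOn_ball hP hu (Metric.pos_of_mem_ball hy) hG).1 z ⟨hsr hz.1, hz.2⟩⟩

/-- A component of the mirror region on which `u` coincides with its reflection touches the
hyperplane, inside `G`, in flat points only. -/
theorem isFlatAt_of_mem_frontier (hT : P.IsReflectionOperator H T) (hG : IsOpen G)
    (hu : P.IsSolution G u) {p y : Space N}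
    (h : EqOn u (T (u ∘ H.reflect)) (connectedComponentIn (mirrorRegion H G) p))
    (hy : y ∈ frontier (connectedComponentIn (mirrorRegion H G) p)) (hyG : y ∈ G)
    (hyH : y ∈ H.plane) : P.IsFlatAt G u H y := by
  obtain ⟨s, hs, hsG⟩ := Metric.isOpen_iff.1 hG y hyG
  refine ⟨hyH, s, hs, hsG, (vanishOn_of_eqOn_reflection hT hu hyH hs hsG (h.mono ?_)).1⟩
  obtain ⟨z, hzs, hz⟩ := mem_closure_iff.1 hy.1 _ Metric.isOpen_ball (Metric.mem_ball_self hs)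
  rw [connectedComponentIn_eq hz]
  exact ((convex_ball y s).inter H.convex_negSide).isPreconnected.subset_connectedComponentIn
    ⟨hzs, (connectedComponentIn_subset _ _ hz).1⟩ (ball_inter_negSide_subset_mirrorRegion hyH hsG)

theorem mem_frontier_mirrorRegion_component (hG : IsOpen G) {p y : Space N}
    (hy : y ∈ frontier (connectedComponentIn (mirrorRegion H G) p)) (hyG : y ∈ G) :
    y ∈ H.plane ∨ y ∈ H.negSide ∧ H.reflect y ∈ frontier G := by
  have hy' : y ∉ mirrorRegion H G := fun h =>
    (disjoint_frontier_connectedComponentIn (isOpen_mirrorRegion hG) p).le_bot ⟨h, hy⟩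
  have hcl : y ∈ closure (mirrorRegion H G) :=
    closure_mono (connectedComponentIn_subset _ _) hy.1
  rcases H.mem_negSide_or_mem_plane_or_mem_posSide y with h | h | h
  · refine .inr ⟨h, ?_⟩
    have h1 : H.reflect y ∉ G := fun h' => hy' ⟨h, hyG, h'⟩
    have h2 : H.reflect y ∈ closure G :=
      closure_mono (by rintro _ ⟨z, hz, rfl⟩; exact hz.2.2)
        (image_closure_subset_closure_image H.continuous_reflect ⟨y, hcl, rfl⟩)
    rw [hG.frontier_eq]; exact ⟨h2, h1⟩
  · exact .inl h
  · obtain ⟨z, hz, hz'⟩ := mem_closure_iff.1 hcl _ H.isOpen_posSide h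
    exact absurd (H.mem_posSide.1 hz) (not_lt.2 (H.mem_negSide.1 hz'.1).le)

/-! ### Reflection hyperplanes -/

/-- The part of the negative side of `H` that, like its mirror image, lies outside the ball of
radius `R`; the radius is enlarged because the ball removed is centred on the hyperplane. -/
def _root_.Polyhedral.OrientedHyperplane.far {N : ℕ} (H : OrientedHyperplane N) (R : ℝ) :
    Set (Space N) :=
  H.negSide \ Metric.closedBall (H.offset • H.normal) (R + |H.offset|)

theorem _root_.Polyhedral.OrientedHyperplane.offset_smul_normal_mem {N : ℕ}
    (H : OrientedHyperplane N) : H.offset • H.normal ∈ H.plane := by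
  rw [H.mem_plane, inner_smul_right, H.inner_normal_self, mul_one]

theorem _root_.Polyhedral.OrientedHyperplane.norm_offset_smul_normal {N : ℕ}
    (H : OrientedHyperplane N) : ‖H.offset • H.normal‖ = |H.offset| := by
  rw [norm_smul, H.norm_normal, mul_one, Real.norm_eq_abs]

theorem _root_.Polyhedral.OrientedHyperplane.mem_far {N : ℕ} (H : OrientedHyperplane N)
    {R : ℝ} {y : Space N} (hy : y ∈ H.negSide) (h : R + 2 * |H.offset| < ‖y‖) : y ∈ H.far R := by
  refine ⟨hy, fun hc => ?_⟩
  rw [Metric.mem_closedBall, dist_eq_norm] at hc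
  have h1 := norm_sub_norm_le y (H.offset • H.normal)
  rw [H.norm_offset_smul_normal] at h1
  linarith

theorem _root_.Polyhedral.OrientedHyperplane.isOpen_far {N : ℕ} (H : OrientedHyperplane N)
    {R : ℝ} : IsOpen (H.far R) :=
  H.isOpen_negSide.sdiff Metric.isClosed_closedBall

theorem far_subset_mirrorRegion {R : ℝ} (hR : Gᶜ ⊆ Metric.closedBall 0 R) :
    H.far R ⊆ mirrorRegion H G := by
  have key (y : Space N) (hy : y ∉ Metric.closedBall (H.offset • H.normal) (R + |H.offset|)) :
      y ∈ G := by
    by_contra hyG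
    have h1 := hR hyG
    rw [mem_closedBall_zero_iff] at h1
    rw [Metric.mem_closedBall, dist_eq_norm] at hy
    have h2 := norm_sub_le y (H.offset • H.normal)
    rw [H.norm_offset_smul_normal] at h2
    linarith
  refine fun y hy => ⟨hy.1, key y hy.2, key _ fun h => hy.2 ?_⟩
  rw [← H.reflect_eq_self.2 H.offset_smul_normal_mem] at h
  rwa [Metric.mem_closedBall, H.dist_reflect] at h

theorem isPreconnected_far {R : ℝ} (hR : 0 ≤ R) : IsPreconnected (H.far R) :=
  H.isPreconnected_negSide_diff H.offset_smul_normal_mem (by positivity)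

/-- An unbounded component of the mirror region contains a neighbourhood of infinity in the
half-space. -/
theorem far_subset_component {R : ℝ} (hR0 : 0 ≤ R) (hR : Gᶜ ⊆ Metric.closedBall 0 R) {p : Space N}
    (hb : ¬ Bornology.IsBounded (connectedComponentIn (mirrorRegion H G) p)) :
    H.far R ⊆ connectedComponentIn (mirrorRegion H G) p := by
  obtain ⟨y, hy, hyb⟩ : ∃ y ∈ connectedComponentIn (mirrorRegion H G) p,
      y ∉ Metric.closedBall (H.offset • H.normal) (R + |H.offset|) := by
    by_contra! h
    exact hb (Metric.isBounded_closedBall.subset h)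
  rw [connectedComponentIn_eq hy]
  exact (isPreconnected_far hR0).subset_connectedComponentIn
    ⟨(connectedComponentIn_subset _ _ hy).1, hyb⟩ (far_subset_mirrorRegion hR)

theorem ball_inter_negSide_subset_far {R : ℝ} {y : Space N} (hy : R + 2 * |H.offset| + 1 < ‖y‖) :
    Metric.ball y 1 ∩ H.negSide ⊆ H.far R := by
  rintro z ⟨hz, hzn⟩
  refine H.mem_far hzn ?_
  have := norm_sub_norm_le y z
  rw [Metric.mem_ball, dist_comm, dist_eq_norm] at hz
  linarith

theorem ball_subset_of_norm_gt {R : ℝ} (hR : Gᶜ ⊆ Metric.closedBall 0 R) {y : Space N}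
    (hy : R + 1 < ‖y‖) : Metric.ball y 1 ⊆ G := by
  intro z hz
  by_contra h
  have h1 := hR h
  rw [mem_closedBall_zero_iff] at h1
  have := norm_sub_norm_le y z
  rw [Metric.mem_ball, dist_comm, dist_eq_norm] at hz
  linarith

theorem isReflectionHyperplane_of_eqOn_far (hT : P.IsReflectionOperator H T)
    (hu : P.IsSolution G u) {R : ℝ} (hR0 : 0 ≤ R) (hR : Gᶜ ⊆ Metric.closedBall 0 R)
    (h : EqOn u (T (u ∘ H.reflect)) (H.far R)) : P.IsReflectionHyperplane u H := by
  refine ⟨R + 2 * |H.offset| + 1, by positivity, fun y hy => ?_⟩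
  have hy' : R + 2 * |H.offset| + 1 < ‖y‖ := by simpa using hy.2
  have hc := abs_nonneg H.offset
  exact (vanishOn_of_eqOn_reflection hT hu hy.1 one_pos (ball_subset_of_norm_gt hR (by linarith))
    (h.mono (ball_inter_negSide_subset_far hy'))).1 y ⟨Metric.mem_ball_self one_pos, hy.1⟩

theorem exists_mem_plane_norm_gt (hN : 2 ≤ N) (H : OrientedHyperplane N) (ρ : ℝ) :
    ∃ y ∈ H.plane, ρ < ‖y‖ := by
  obtain ⟨v, hv1, hv, -⟩ := H.exists_tangent hN 0
  refine ⟨H.offset • H.normal + (|ρ| + |H.offset| + 1) • v, ?_, ?_⟩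
  · rw [H.mem_plane, inner_add_right, H.mem_plane.1 H.offset_smul_normal_mem, inner_smul_right, hv,
      mul_zero, add_zero]
  · have h1 := norm_sub_norm_le ((|ρ| + |H.offset| + 1) • v) (-(H.offset • H.normal))
    rw [norm_neg, H.norm_offset_smul_normal, norm_smul, hv1, mul_one, sub_neg_eq_add,
      Real.norm_of_nonneg (by positivity)] at h1
    have := le_abs_self ρ
    rw [add_comm (H.offset • H.normal)]
    linarith

theorem IsReflectionHyperplane.eqOn_far (hN : 2 ≤ N) (hP : P.UniqueContinuation)
    (hT : P.IsReflectionOperator H T) (hu : P.IsSolution G u) {R : ℝ} (hR0 : 0 ≤ R)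
    (hR : Gᶜ ⊆ Metric.closedBall 0 R) (h : P.IsReflectionHyperplane u H) :
    EqOn u (T (u ∘ H.reflect)) (H.far R) := by
  obtain ⟨R', hR', hv⟩ := h
  obtain ⟨y, hyH, hy⟩ := exists_mem_plane_norm_gt hN H (R + 2 * |H.offset| + 1 + R' + 1)
  have hc := abs_nonneg H.offset
  have hflat : P.IsFlatAt G u H y := by
    refine ⟨hyH, 1, one_pos, ball_subset_of_norm_gt hR (by linarith), fun z hz => hv z ⟨hz.2, ?_⟩⟩
    rw [mem_closedBall_zero_iff, not_le]
    have h1 := norm_sub_norm_le y z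
    have h2 := hz.1
    rw [Metric.mem_ball, dist_comm, dist_eq_norm] at h2
    linarith
  exact hflat.eqOn_reflection hP hT hu H.isOpen_far (isPreconnected_far hR0)
    (far_subset_mirrorRegion hR) one_pos (ball_inter_negSide_subset_far (by linarith))

theorem IsFlatAt.isReflectionHyperplane_of_not_isBounded (hP : P.Admissible) (hG : IsOpen G)
    (hu : P.IsSolution G u) {R : ℝ} (hR0 : 0 ≤ R) (hR : Gᶜ ⊆ Metric.closedBall 0 R)
    {x : Space N} (hx : P.IsFlatAt G u H x) {r : ℝ} (hr : 0 < r) (hrG : Metric.ball x r ⊆ G)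
    {p : Space N} (hp : p ∈ Metric.ball x r ∩ H.negSide)
    (hb : ¬ Bornology.IsBounded (connectedComponentIn (mirrorRegion H G) p)) :
    P.IsReflectionHyperplane u H := by
  obtain ⟨T, hT⟩ := hP.reflection H
  exact isReflectionHyperplane_of_eqOn_far hT hu hR0 hR <|
    (hx.eqOn_component hP.uniqueContinuation hT hG hu hr hrG hp).mono
      (far_subset_component hR0 hR hb)

/-- Flat points outside a ball that contains the obstacle belong to reflection hyperplanes: along
a direction of the hyperplane that leads away from the ball, both sides of the hyperplane stay
outside the ball. -/
theorem IsFlatAt.isReflectionHyperplane_of_norm_gt (hN : 2 ≤ N) (hP : P.Admissible) (hG : IsOpen G)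
    (hu : P.IsSolution G u) {R : ℝ} (hR0 : 0 ≤ R) (hR : Gᶜ ⊆ Metric.closedBall 0 R)
    {x : Space N} (hx : P.IsFlatAt G u H x) (hxR : R < ‖x‖) : P.IsReflectionHyperplane u H := by
  obtain ⟨r, hr, hrR⟩ := Metric.isOpen_iff.1
    (Metric.isClosed_closedBall (x := (0 : Space N)) (ε := R)).isOpen_compl x (by simpa using hxR)
  obtain ⟨v, hv1, hv, hxv⟩ := H.exists_tangent hN x
  have hout {q : Space N} (hq : R < ‖q‖) : q ∈ G := by
    by_contra h
    have := hR h
    rw [mem_closedBall_zero_iff] at this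
    exact not_lt.2 this hq
  have hball {q : Space N} (hq : q ∈ Metric.ball x r) : R < ‖q‖ := by simpa using hrR hq
  have hpr : x + (r / 2) • H.normal ∈ Metric.ball x r := by
    rw [Metric.mem_ball, dist_eq_norm, add_sub_cancel_left, norm_smul, H.norm_normal, mul_one,
      Real.norm_of_nonneg (by positivity)]
    linarith
  have hpr' : x - (r / 2) • H.normal ∈ Metric.ball x r := by
    rw [Metric.mem_ball, dist_eq_norm, sub_sub_cancel_left, norm_neg, norm_smul, H.norm_normal,
      mul_one, Real.norm_of_nonneg (by positivity)]
    linarith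
  have hvx : 0 ≤ ⟪x + (r / 2) • H.normal, v⟫ := by
    rw [inner_add_left, real_inner_smul_left, hv, mul_zero, add_zero]; exact hxv
  have hvx' : 0 ≤ ⟪x - (r / 2) • H.normal, v⟫ := by
    rw [inner_sub_left, real_inner_smul_left, hv, mul_zero, sub_zero]; exact hxv
  have hmono {q : Space N} (hq : 0 ≤ ⟪q, v⟫) {s : ℝ} (hs : 0 ≤ s) : ‖q‖ ≤ ‖q + s • v‖ := by
    rw [← sq_le_sq₀ (norm_nonneg _) (norm_nonneg _), norm_add_sq_real, inner_smul_right]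
    nlinarith [mul_nonneg hs hq, sq_nonneg ‖s • v‖]
  have hpn := H.add_smul_normal_mem_negSide hx.1 (half_pos hr)
  have hray : (fun s : ℝ => x + (r / 2) • H.normal + s • v) '' Ici 0 ⊆ mirrorRegion H G := by
    rintro _ ⟨s, hs, rfl⟩
    have hs : 0 ≤ s := hs
    refine ⟨?_, hout ((hball hpr).trans_le (hmono hvx hs)), ?_⟩
    · rw [H.mem_negSide] at hpn ⊢
      rwa [inner_add_right, real_inner_smul_right _ v s, hv, mul_zero, add_zero]
    · have : H.reflect (x + (r / 2) • H.normal + s • v) = x - (r / 2) • H.normal + s • v := by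
        rw [OrientedHyperplane.reflect, inner_add_right, inner_add_right, inner_smul_right,
          inner_smul_right, hv, H.inner_normal_self, H.mem_plane.1 hx.1]
        module
      rw [mem_preimage, this]
      exact hout ((hball hpr').trans_le (hmono hvx' hs))
  refine hx.isReflectionHyperplane_of_not_isBounded hP hG hu hR0 hR hr
    (fun q hq => hout (hball hq)) ⟨hpr, hpn⟩ fun hb => ?_
  have hsub := (isPreconnected_Ici.image _ (by fun_prop)).subset_connectedComponentIn
    (x := x + (r / 2) • H.normal) ⟨0, self_mem_Ici, by simp⟩ hray
  obtain ⟨ρ, hρ⟩ := (hb.subset hsub).subset_closedBall (x + (r / 2) • H.normal)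
  have := hρ ⟨|ρ| + 1, by rw [mem_Ici]; positivity, rfl⟩
  rw [Metric.mem_closedBall, dist_eq_norm, add_sub_cancel_left, norm_smul, hv1, mul_one,
    Real.norm_of_nonneg (by positivity)] at this
  linarith [le_abs_self ρ]

end Operators

/-! ### The boundary of the obstacle -/

section Boundary

variable {N : ℕ} {S : Set (Space N)} {𝒞 : Set (Set (Space N))}
  {𝓛 : Set (OrientedHyperplane N)}

/-- If a relatively open part of a set is covered by finitely many closed sets, one of them contains
a relatively open part. -/
theorem exists_ball_subset_of_finite_cover {𝒞 : Set (Set (Space N))} (h𝒞 : 𝒞.Finite)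
    (hcl : ∀ C ∈ 𝒞, IsClosed C) {O E : Set (Space N)} (hO : IsOpen O) (hne : (O ∩ E).Nonempty)
    (hcov : O ∩ E ⊆ ⋃₀ 𝒞) :
    ∃ C ∈ 𝒞, ∃ z ∈ O ∩ E, ∃ r > 0, Metric.ball z r ⊆ O ∧ Metric.ball z r ∩ E ⊆ C := by
  induction 𝒞, h𝒞 using Set.Finite.induction_on generalizing O with
  | empty =>
    obtain ⟨x, hx⟩ := hne
    simpa using hcov hx
  | @insert C 𝒞 _ _ ih =>
    by_cases h : ((O \ C) ∩ E).Nonempty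
    · have hCc := hcl C (mem_insert _ _)
      obtain ⟨C', hC', z, hz, r, hr, hrO, hrC⟩ := ih
        (fun C' hC' => hcl C' (mem_insert_of_mem _ hC'))
        (hO.sdiff hCc) h (by
          rintro y ⟨⟨hyO, hyC⟩, hyE⟩
          obtain ⟨C', hC' | hC', hy⟩ := hcov ⟨hyO, hyE⟩
          · exact absurd (hC' ▸ hy) hyC
          · exact ⟨C', hC', hy⟩)
      exact ⟨C', mem_insert_of_mem _ hC', z, ⟨hz.1.1, hz.2⟩, r, hr, fun y hy => (hrO hy).1, hrC⟩
    · obtain ⟨z, hzO, hzE⟩ := hne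
      obtain ⟨r, hr, hrO⟩ := Metric.isOpen_iff.1 hO z hzO
      refine ⟨C, mem_insert _ _, z, ⟨hzO, hzE⟩, r, hr, hrO, fun y hy => ?_⟩
      by_contra hyC
      exact h ⟨y, ⟨hrO hy.1, hyC⟩, hy.2⟩

/-- A family of hyperplanes that carries the cells: each cell is a cell in one of them. -/
def CarriesCells (𝓛 : Set (OrientedHyperplane N)) (𝒞 : Set (Set (Space N))) : Prop :=
  ∀ C ∈ 𝒞, ∃ H ∈ 𝓛, IsCellIn H C

theorem IsCellDecomposition.exists_carriesCells (h : IsCellDecomposition S 𝒞) :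
    ∃ 𝓛 : Set (OrientedHyperplane N), 𝓛.Finite ∧ CarriesCells 𝓛 𝒞 := by
  choose f hf using h.isCell
  exact ⟨{H | ∃ C, ∃ hC : C ∈ 𝒞, f C hC = H}, h.finite.dependent_image f,
    fun C hC => ⟨f C hC, ⟨C, hC, rfl⟩, hf C hC⟩⟩

theorem IsCellIn.isClosed {H : OrientedHyperplane N} {C : Set (Space N)} (h : IsCellIn H C) :
    IsClosed C := by
  obtain ⟨U, -, rfl⟩ := h
  exact isClosed_closure

theorem IsCellIn.subset_plane {H : OrientedHyperplane N} {C : Set (Space N)} (h : IsCellIn H C) :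
    C ⊆ H.plane := by
  obtain ⟨U, -, rfl⟩ := h
  exact closure_minimal inter_subset_right H.isClosed_plane

theorem IsCellIn.congr {H H' : OrientedHyperplane N} {C : Set (Space N)} (h : IsCellIn H C)
    (hH : H.plane = H'.plane) : IsCellIn H' C := by
  rwa [IsCellIn, ← hH]

theorem exists_mem_plane_of_mem_frontier (h : IsCellDecomposition S 𝒞) (h𝓛 : CarriesCells 𝓛 𝒞)
    {z : Space N} (hz : z ∈ frontier S) : ∃ H ∈ 𝓛, z ∈ H.plane := by
  rw [h.frontier_eq] at hz
  obtain ⟨C, hC, hzC⟩ := hz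
  obtain ⟨H, hH, hHC⟩ := h𝓛 C hC
  exact ⟨H, hH, hHC.subset_plane hzC⟩

/-- Near a boundary point that lies on one hyperplane only, the boundary lies in this hyperplane. -/
theorem exists_ball_frontier_subset_plane (h : IsCellDecomposition S 𝒞) (h𝓛f : 𝓛.Finite)
    (h𝓛 : CarriesCells 𝓛 𝒞) {z : Space N} (hs : IsSimple 𝓛 z) :
    ∃ r > 0, ∀ H ∈ 𝓛, z ∈ H.plane → frontier S ∩ Metric.ball z r ⊆ H.plane := by
  obtain ⟨r, hr, hrz⟩ := exists_ball_avoiding h𝓛f z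
  refine ⟨r, hr, fun H hH hzH y hy => ?_⟩
  obtain ⟨H', hH', hyH'⟩ := exists_mem_plane_of_mem_frontier h h𝓛 hy.1
  rw [hs H hH H' hH' hzH (hrz H' hH' ⟨y, hyH', hy.2⟩)]
  exact hyH'

/-- Near a boundary point that lies on one hyperplane only, the complement of an obstacle is a
half-ball, as the obstacle has interior points nearby. -/
theorem exists_half_ball (hS : IsObstacle S) {z : Space N} (hz : z ∈ frontier S)
    {H₀ : OrientedHyperplane N} {ρ : ℝ} (hρ : 0 < ρ)
    (hfr : frontier S ∩ Metric.ball z ρ ⊆ H₀.plane) :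
    ∃ H : OrientedHyperplane N, H.plane = H₀.plane ∧
      Sᶜ ∩ Metric.ball z ρ = H.posSide ∩ Metric.ball z ρ := by
  have hSo : IsOpen Sᶜ := hS.isClosed.isOpen_compl
  have hzb := Metric.mem_ball_self (x := z) hρ
  have dich (H : OrientedHyperplane N) (hH : H.plane = H₀.plane) :
      ((H.negSide ∩ Metric.ball z ρ) ∩ Sᶜ).Nonempty → H.negSide ∩ Metric.ball z ρ ⊆ Sᶜ := by
    refine (H.convex_negSide.inter (convex_ball z ρ)).isPreconnected.subset_of_disjoint_frontier
      hSo ?_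
    rw [frontier_compl, disjoint_left]
    rintro y ⟨hyn, hyb⟩ hyf
    have : y ∈ H.plane := hH ▸ hfr ⟨hyf, hyb⟩
    exact (H.mem_negSide.1 hyn).ne' this
  have meets (V : Set (Space N)) (hV : IsOpen V) (hzV : z ∈ closure V) :
      ((H₀.negSide ∩ Metric.ball z ρ) ∩ V).Nonempty ∨
        ((H₀.posSide ∩ Metric.ball z ρ) ∩ V).Nonempty := by
    obtain ⟨w, hwb, hwV⟩ := mem_closure_iff.1 hzV _ Metric.isOpen_ball hzb
    rcases H₀.ball_subset_closure hwb with h | h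
    · obtain ⟨y, hyV, hy⟩ := mem_closure_iff.1 h V hV hwV
      exact .inl ⟨y, hy, hyV⟩
    · obtain ⟨y, hyV, hy⟩ := mem_closure_iff.1 h V hV hwV
      exact .inr ⟨y, hy, hyV⟩
  have conclude (H : OrientedHyperplane N) (hH : H.plane = H₀.plane)
      (hp : ((H.posSide ∩ Metric.ball z ρ) ∩ Sᶜ).Nonempty)
      (hn : ¬ ((H.negSide ∩ Metric.ball z ρ) ∩ Sᶜ).Nonempty) :
      Sᶜ ∩ Metric.ball z ρ = H.posSide ∩ Metric.ball z ρ := by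
    have hn' : H.negSide ∩ Metric.ball z ρ ⊆ S := fun y hy => by
      by_contra h
      exact hn ⟨y, hy, h⟩
    have hp' : H.posSide ∩ Metric.ball z ρ ⊆ Sᶜ := by
      have := dich H.reverse (by rwa [H.plane_reverse])
      rw [H.negSide_reverse] at this
      exact this hp
    refine Subset.antisymm ?_ fun y hy => ⟨hp' hy, hy.2⟩
    rintro y ⟨hyS, hyb⟩
    rcases H.mem_negSide_or_mem_plane_or_mem_posSide y with h | h | h
    · exact absurd (hn' ⟨h, hyb⟩) hyS
    · exact absurd (closure_minimal hn' hS.isClosed (H.mem_closure_negSide_inter_ball h hyb)) hyS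
    · exact ⟨h, hyb⟩
  have hout := meets Sᶜ hSo (by rw [← frontier_compl] at hz; exact hz.1)
  have hin := meets (interior S) isOpen_interior
    (by rw [hS.closure_interior]; exact hS.isClosed.frontier_subset hz)
  have excl (H : OrientedHyperplane N) (hH : H.plane = H₀.plane)
      (h : ((H.negSide ∩ Metric.ball z ρ) ∩ interior S).Nonempty) :
      ¬ ((H.negSide ∩ Metric.ball z ρ) ∩ Sᶜ).Nonempty := fun h' => by
    obtain ⟨y, hy, hyS⟩ := h
    exact dich H hH h' hy (interior_subset hyS)
  rcases hin with hin | hin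
  · have hn := excl H₀ rfl hin
    exact ⟨H₀, rfl, conclude H₀ rfl (hout.resolve_left hn) hn⟩
  · have hr : H₀.reverse.plane = H₀.plane := H₀.plane_reverse
    have hn := excl H₀.reverse hr (by rwa [H₀.negSide_reverse])
    refine ⟨H₀.reverse, hr, conclude H₀.reverse hr ?_ hn⟩
    rw [H₀.posSide_reverse]
    rw [H₀.negSide_reverse] at hn
    exact hout.resolve_right hn

end Boundary

namespace Operators

variable {N M L L₁ J J₁ : ℕ} {P : Operators N M L L₁ J J₁} {S : Set (Space N)}
  {𝒞 : Set (Set (Space N))} {𝓛 : Set (OrientedHyperplane N)} {u : Space N → Fin M → ℂ}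
  {H : OrientedHyperplane N} {T : (Space N → Fin M → ℂ) → Space N → Fin M → ℂ}

/-- The boundary condition holds on open parts of the flat boundary near every boundary point that
lies on one hyperplane only. Such a point itself need not be interior to a single cell. -/
theorem exists_vanishOnFrom (h𝒞 : IsCellDecomposition S 𝒞) (h𝓛 : CarriesCells 𝓛 𝒞)
    (hB : P.VanishOnCells S 𝒞 u) {z : Space N} {H : OrientedHyperplane N} (hzH : z ∈ H.plane)
    {r : ℝ} (hr : 0 < r) (hSr : Sᶜ ∩ Metric.ball z r = H.posSide ∩ Metric.ball z r)
    (h𝓛H : ∀ H' ∈ 𝓛, (H'.plane ∩ Metric.ball z r).Nonempty → H'.plane = H.plane) :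
    ∃ z' ∈ H.plane, ∃ r' > 0, Metric.ball z' r' ⊆ Metric.ball z r ∧
      P.VanishOnFrom H.posSide H.normal u (Metric.ball z' r' ∩ H.plane) := by
  have hcov : Metric.ball z r ∩ H.plane ⊆ ⋃₀ 𝒞 := by
    rintro y ⟨hyr, hyH⟩
    rw [← h𝒞.frontier_eq, ← frontier_compl]
    refine ⟨closure_mono ?_ (H.mem_closure_posSide_inter_ball hyH hyr), fun hy => ?_⟩
    · rw [← hSr]; exact inter_subset_left
    · have : y ∈ Sᶜ ∩ Metric.ball z r := ⟨interior_subset hy, hyr⟩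
      rw [hSr] at this
      exact (H.mem_posSide.1 this.1).ne hyH
  obtain ⟨C, hC, z', hz', r', hr', hr'z, hr'C⟩ := exists_ball_subset_of_finite_cover h𝒞.finite
    (fun C hC => by obtain ⟨H', -, h⟩ := h𝓛 C hC; exact h.isClosed) Metric.isOpen_ball
    ⟨z, Metric.mem_ball_self hr, hzH⟩ hcov
  obtain ⟨H', hH', hCH'⟩ := h𝓛 C hC
  have hCH : IsCellIn H C := hCH'.congr <| h𝓛H H' hH'
    ⟨z', hCH'.subset_plane (hr'C ⟨Metric.mem_ball_self hr', hz'.2⟩), hz'.1⟩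
  refine ⟨z', hz'.2, r', hr', hr'z, fun y hy => ?_⟩
  obtain ⟨s, hs, hsr⟩ := Metric.isOpen_iff.1 Metric.isOpen_ball y hy.1
  refine hB C hC H hCH y hy.2 s hs (fun w hw => hr'C ⟨hsr hw.1, hw.2⟩) (fun w hw => ?_) y rfl
  have : w ∈ H.posSide ∩ Metric.ball z r := ⟨hw.2, hr'z (hsr hw.1)⟩
  rw [← hSr] at this
  exact this.1

/-- Where the mirror image of a flat part of the boundary of the obstacle bounds, inside `Sᶜ`, a set
`D` on which `u` coincides with its reflection, it consists of flat points, and `D` is a half-ball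
there. -/
theorem exists_isFlatAt_of_mem_frontier (hP : P.Admissible) (hT : P.IsReflectionOperator H T)
    (hS : IsObstacle S) (h𝒞 : IsCellDecomposition S 𝒞) (h𝓛f : 𝓛.Finite) (h𝓛 : CarriesCells 𝓛 𝒞)
    (hu : P.IsSolution Sᶜ u) (hB : P.VanishOnCells S 𝒞 u) {D : Set (Space N)} (hD : IsOpen D)
    (hDS : D ⊆ mirrorRegion H Sᶜ) (hDu : EqOn u (T (u ∘ H.reflect)) D) {y : Space N}
    (hy : y ∈ frontier D) (hyS : y ∉ S) (hyH : y ∈ H.negSide) (hyS' : H.reflect y ∈ S)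
    (hys : IsSimple 𝓛 (H.reflect y))
    (hfr : ∀ H₀ ∈ 𝓛, H.reflect y ∈ H₀.plane →
      ∃ ρ > 0, ∀ w ∈ frontier D, w ∈ Metric.ball y ρ → H.reflect w ∈ H₀.plane) :
    ∃ H' : OrientedHyperplane N, P.IsFlatAt Sᶜ u H' y ∧
      (∃ H₀ ∈ 𝓛, H'.plane = (H₀.map H.refl).plane) ∧
      ∃ ρ > 0, D ∩ Metric.ball y ρ = H'.posSide ∩ Metric.ball y ρ := by
  have hSo : IsOpen Sᶜ := hS.isClosed.isOpen_compl
  have hzf : H.reflect y ∈ frontier S := by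
    rw [← frontier_compl, hSo.frontier_eq]
    exact ⟨closure_mono (by rintro _ ⟨w, hw, rfl⟩; exact (hDS hw).2.2)
      (image_closure_subset_closure_image H.continuous_reflect ⟨y, hy.1, rfl⟩), fun h => h hyS'⟩
  obtain ⟨H₀, hH₀, hzH₀⟩ := exists_mem_plane_of_mem_frontier h𝒞 h𝓛 hzf
  obtain ⟨ρ₀, hρ₀, hρ₀D⟩ := hfr H₀ hH₀ hzH₀
  obtain ⟨ρ₁, hρ₁, hρ₁S⟩ := exists_ball_frontier_subset_plane h𝒞 h𝓛f h𝓛 hys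
  obtain ⟨ρ₂, hρ₂, hρ₂𝓛⟩ := exists_ball_avoiding h𝓛f (H.reflect y)
  obtain ⟨ρ₃, hρ₃, hρ₃y⟩ := Metric.isOpen_iff.1 (hSo.inter H.isOpen_negSide) y ⟨hyS, hyH⟩
  obtain ⟨ρ, hρ, hle₀, hle₁, hle₂, hle₃⟩ : ∃ ρ > 0, ρ ≤ ρ₀ ∧ ρ ≤ ρ₁ ∧ ρ ≤ ρ₂ ∧ ρ ≤ ρ₃ :=
    ⟨min (min ρ₀ ρ₁) (min ρ₂ ρ₃), by positivity,
      (min_le_left _ _).trans (min_le_left _ _), (min_le_left _ _).trans (min_le_right _ _),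
      (min_le_right _ _).trans (min_le_left _ _), (min_le_right _ _).trans (min_le_right _ _)⟩
  obtain ⟨H₁, hH₁, hhalf⟩ := exists_half_ball hS hzf hρ
    ((inter_subset_inter_right _ (Metric.ball_subset_ball hle₁)).trans (hρ₁S H₀ hH₀ hzH₀))
  have hyball : Metric.ball y ρ ⊆ Sᶜ ∩ H.negSide := (Metric.ball_subset_ball hle₃).trans hρ₃y
  -- the mirror image of the half-ball
  have hpos {w : Space N} : w ∈ (H₁.map H.refl).posSide ↔ H.reflect w ∈ H₁.posSide := by
    have := H₁.map_mem_posSide (g := H.refl) (x := H.reflect w)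
    rwa [H.coe_refl, H.reflect_reflect] at this
  have hplane {w : Space N} : w ∈ (H₁.map H.refl).plane ↔ H.reflect w ∈ H₁.plane := by
    have := H₁.map_mem_plane (g := H.refl) (x := H.reflect w)
    rwa [H.coe_refl, H.reflect_reflect] at this
  have hyH' : y ∈ (H₁.map H.refl).plane := by rw [hplane, hH₁]; exact hzH₀
  have hDhalf : D ∩ Metric.ball y ρ = (H₁.map H.refl).posSide ∩ Metric.ball y ρ := by
    have hsub : D ∩ Metric.ball y ρ ⊆ (H₁.map H.refl).posSide ∩ Metric.ball y ρ := by
      rintro w ⟨hwD, hwb⟩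
      have : H.reflect w ∈ Sᶜ ∩ Metric.ball (H.reflect y) ρ :=
        ⟨(hDS hwD).2.2, H.reflect_mem_ball.2 hwb⟩
      rw [hhalf] at this
      exact ⟨hpos.2 this.1, hwb⟩
    refine hsub.antisymm fun w hw => ⟨?_, hw.2⟩
    refine ((H₁.map H.refl).convex_posSide.inter
      (convex_ball y ρ)).isPreconnected.subset_of_disjoint_frontier hD ?_ ?_ hw
    · rw [disjoint_left]
      rintro v ⟨hv, hvb⟩ hvf
      have : H.reflect v ∈ H₁.plane := by
        rw [hH₁]; exact hρ₀D v hvf (Metric.ball_subset_ball hle₀ hvb)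
      exact (H₁.mem_posSide.1 (hpos.1 hv)).ne this
    · obtain ⟨v, hvb, hvD⟩ := mem_closure_iff.1 hy.1 _ Metric.isOpen_ball (Metric.mem_ball_self hρ)
      exact ⟨v, hsub ⟨hvD, hvb⟩, hvD⟩
  -- an open part of the boundary where the boundary condition is given, within `ρ / 2`
  have hρ2 : Metric.ball (H.reflect y) (ρ / 2) ⊆ Metric.ball (H.reflect y) ρ :=
    Metric.ball_subset_ball (by linarith)
  obtain ⟨z', hz'H, r', hr', hr'z, hvan⟩ := exists_vanishOnFrom h𝒞 h𝓛 hB (z := H.reflect y)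
    (H := H₁) (by rw [hH₁]; exact hzH₀) (half_pos hρ)
    (by
      ext w
      have := Set.ext_iff.1 hhalf w
      exact ⟨fun h => ⟨(this.1 ⟨h.1, hρ2 h.2⟩).1, h.2⟩, fun h => ⟨(this.2 ⟨h.1, hρ2 h.2⟩).1, h.2⟩⟩)
    (fun H' hH' hne => by
      rw [hH₁]
      refine hys H' hH' H₀ hH₀ (hρ₂𝓛 H' hH' (hne.mono ?_)) hzH₀
      exact inter_subset_inter_right _ (hρ2.trans (Metric.ball_subset_ball hle₂)))
  have hr'z' : Metric.ball z' r' ⊆ Metric.ball (H.reflect y) ρ := hr'z.trans hρ2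
  have hback {w : Space N} (hw : w ∈ Metric.ball (H.reflect y) ρ) :
      H.reflect w ∈ Metric.ball y ρ := by
    rw [← H.reflect_mem_ball, H.reflect_reflect]; exact hw
  have htrans := hT.transport (Metric.ball z' r' ∩ H₁.posSide) u
    (Metric.isOpen_ball.inter H₁.isOpen_posSide)
    (fun w hw => H.reflect_mem_negSide.1 (hyball (hback (hr'z' hw.1))).2)
    (hu.mono fun w hw => by
      have : w ∈ H₁.posSide ∩ Metric.ball (H.reflect y) ρ := ⟨hw.2, hr'z' hw.1⟩
      rw [← hhalf] at this
      exact this.1)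
    H₁ z' hz'H r' hr' subset_rfl hvan
  rw [← H.coe_refl, ← H₁.map_posSide H.refl, ← H.map_refl_normal H₁] at htrans
  have hflat : P.IsFlatAt Sᶜ u (H₁.map H.refl) (H.reflect z') := by
    have hsubball : Metric.ball (H.reflect z') r' ⊆ Metric.ball y ρ := fun w hw => by
      have := hback (hr'z' (H.reflect_mem_ball.1 (by rwa [H.reflect_reflect] :
        H.reflect (H.reflect w) ∈ Metric.ball (H.reflect z') r')))
      rwa [H.reflect_reflect] at this
    refine ⟨by rw [hplane, H.reflect_reflect]; exact hz'H, r', hr',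
      fun w hw => (hyball (hsubball hw)).1, fun w hw k => ?_⟩
    have hwy := hsubball hw.1
    have hlim := htrans w ⟨H.reflect w,
      ⟨H.reflect_mem_ball.1 (by rw [H.reflect_reflect]; exact hw.1),
      hplane.1 hw.2⟩, H.reflect_reflect w⟩ k
    have : (𝓝[(H₁.map H.refl).posSide] w).NeBot := by
      rw [← mem_closure_iff_nhdsWithin_neBot]
      exact closure_mono inter_subset_left
        ((H₁.map H.refl).mem_closure_posSide_inter_ball hw.2 hwy)
    refine tendsto_nhds_unique ((hu.continuousAt_B hSo k _ (hyball hwy).1).tendsto.mono_left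
      nhdsWithin_le_nhds) (hlim.congr' ?_)
    filter_upwards [self_mem_nhdsWithin,
      mem_nhdsWithin_of_mem_nhds (Metric.isOpen_ball.mem_nhds hwy)] with v hv hvb
    have hvD : v ∈ D := by
      have : v ∈ (H₁.map H.refl).posSide ∩ Metric.ball y ρ := ⟨hv, hvb⟩
      rw [← hDhalf] at this
      exact this.1
    exact (B_eqOn hD hDu k _ hvD).symm
  refine ⟨H₁.map H.refl, ?_, ⟨H₀, hH₀, ?_⟩, ρ, hρ, hDhalf⟩
  · have hz'y : dist z' (H.reflect y) < ρ / 2 := hr'z (Metric.mem_ball_self hr')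
    have hd : dist (H.reflect z') y < ρ / 2 := by
      rwa [← H.dist_reflect, H.reflect_reflect]
    refine hflat.of_mem_ball hP hu (r := ρ / 2) (fun w hw => (hyball ?_).1) ?_ hyH'
    · rw [Metric.mem_ball] at hw ⊢
      linarith [dist_triangle w (H.reflect z') y]
    · rwa [Metric.mem_ball, dist_comm]
  · rw [H₁.map_plane, H₀.map_plane, hH₁]

/-- The case of a component of the mirror region, whose boundary off the hyperplane lies in the
mirror image of the boundary of the obstacle. -/
theorem exists_isFlatAt_of_mem_frontier_component (hP : P.Admissible)
    (hT : P.IsReflectionOperator H T) (hS : IsObstacle S) (h𝒞 : IsCellDecomposition S 𝒞)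
    (h𝓛f : 𝓛.Finite) (h𝓛 : CarriesCells 𝓛 𝒞) (hu : P.IsSolution Sᶜ u)
    (hB : P.VanishOnCells S 𝒞 u) {p y : Space N}
    (hDu : EqOn u (T (u ∘ H.reflect)) (connectedComponentIn (mirrorRegion H Sᶜ) p))
    (hy : y ∈ frontier (connectedComponentIn (mirrorRegion H Sᶜ) p)) (hyS : y ∉ S)
    (hyH : y ∉ H.plane) (hys : IsSimple 𝓛 (H.reflect y)) :
    ∃ H' : OrientedHyperplane N, P.IsFlatAt Sᶜ u H' y ∧
      (∃ H₀ ∈ 𝓛, H'.plane = (H₀.map H.refl).plane) ∧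
      ∃ ρ > 0, connectedComponentIn (mirrorRegion H Sᶜ) p ∩ Metric.ball y ρ =
        H'.posSide ∩ Metric.ball y ρ := by
  have hSo : IsOpen Sᶜ := hS.isClosed.isOpen_compl
  obtain ⟨hyn, hyf⟩ := (mem_frontier_mirrorRegion_component hSo hy hyS).resolve_left hyH
  rw [frontier_compl] at hyf
  refine exists_isFlatAt_of_mem_frontier hP hT hS h𝒞 h𝓛f h𝓛 hu hB
    (isOpen_mirrorRegion hSo).connectedComponentIn (connectedComponentIn_subset _ _) hDu hy hyS hyn
    (hS.isClosed.frontier_subset hyf) hys fun H₀ hH₀ hyH₀ => ?_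
  obtain ⟨r, hr, hrS⟩ := exists_ball_frontier_subset_plane h𝒞 h𝓛f h𝓛 hys
  obtain ⟨s, hs, hsy⟩ := Metric.isOpen_iff.1 (hSo.inter H.isOpen_negSide) y ⟨hyS, hyn⟩
  refine ⟨min r s, lt_min hr hs, fun w hw hwb => hrS H₀ hH₀ hyH₀ ⟨?_, ?_⟩⟩
  · have hw' := hsy (Metric.ball_subset_ball (min_le_right _ _) hwb)
    rcases mem_frontier_mirrorRegion_component hSo hw hw'.1 with h | h
    · exact absurd h (H.mem_negSide.1 hw'.2).ne'
    · rw [frontier_compl] at h; exact h.2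
  · exact H.reflect_mem_ball.2 (Metric.ball_subset_ball (min_le_left _ _) hwb)

end Operators

theorem IsSimple.of_map {N : ℕ} {𝓗 : Set (OrientedHyperplane N)} {g : Space N ≃ᵃⁱ[ℝ] Space N}
    {x : Space N} (h : IsSimple ((fun H => H.map g) '' 𝓗) (g x)) : IsSimple 𝓗 x := by
  intro H hH H' hH' hx hx'
  have := h _ ⟨H, hH, rfl⟩ _ ⟨H', hH', rfl⟩ (H.map_mem_plane.2 hx) (H'.map_mem_plane.2 hx')
  rw [H.map_plane, H'.map_plane] at this
  exact g.injective.image_injective this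

theorem IsSimple.mono {N : ℕ} {𝓗 𝓗' : Set (OrientedHyperplane N)} {x : Space N}
    (h : IsSimple 𝓗' x) (hsub : 𝓗 ⊆ 𝓗') : IsSimple 𝓗 x :=
  fun H hH H' hH' => h H (hsub hH) H' (hsub hH')

theorem isPreconnected_ray {N : ℕ} (p e : Space N) :
    IsPreconnected ((fun t : ℝ => p + t • e) '' Ici 0) :=
  isPreconnected_Ici.image _ (by fun_prop)

namespace Operators

variable {N M L L₁ J J₁ : ℕ} {P : Operators N M L L₁ J J₁} {S : Set (Space N)}
  {𝒞 : Set (Set (Space N))} {𝓛 : Set (OrientedHyperplane N)} {u : Space N → Fin M → ℂ}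
  {H : OrientedHyperplane N} {T : (Space N → Fin M → ℂ) → Space N → Fin M → ℂ}

/-! ### The group generated by the reflection hyperplanes -/

variable (P S 𝒞 𝓛 u) in
/-- The standing assumptions: a solution `u` outside a nonempty obstacle `S` that satisfies the
boundary condition on the cells, which are carried by the finite family `𝓛` of hyperplanes. -/
structure IsObstacleProblem : Prop where
  two_le : 2 ≤ N
  admissible : P.Admissible
  isObstacle : IsObstacle S
  nonempty : S.Nonempty
  decomposition : IsCellDecomposition S 𝒞
  finite : 𝓛.Finite
  carriesCells : CarriesCells 𝓛 𝒞
  isSolution : P.IsSolution Sᶜ u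
  vanishOnCells : P.VanishOnCells S 𝒞 u

variable (P u) in
/-- The group of isometries generated by the reflections in the reflection hyperplanes of `u`. -/
def reflectionGroup : Subgroup (Space N ≃ᵃⁱ[ℝ] Space N) :=
  Subgroup.closure {g | ∃ H, P.IsReflectionHyperplane u H ∧ H.refl = g}

variable (P S u) in
/-- The flat points with a hyperplane whose reflection does not belong to the reflection group. -/
def exceptionalSet : Set (Space N) :=
  {x | ∃ H, P.IsFlatAt Sᶜ u H x ∧ H.refl ∉ P.reflectionGroup u}

theorem IsReflectionHyperplane.refl_mem (h : P.IsReflectionHyperplane u H) :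
    H.refl ∈ P.reflectionGroup u :=
  Subgroup.subset_closure ⟨H, h, rfl⟩

theorem refl_mem_of_notMem_exceptionalSet {y : Space N} (hy : y ∉ P.exceptionalSet S u)
    (h : P.IsFlatAt Sᶜ u H y) : H.refl ∈ P.reflectionGroup u := by
  by_contra hH
  exact hy ⟨H, h, hH⟩

theorem linear_apply_of_mem_reflectionGroup {e : Space N}
    (he : ∀ H, P.IsReflectionHyperplane u H → ⟪H.normal, e⟫ = 0) {g : Space N ≃ᵃⁱ[ℝ] Space N}
    (hg : g ∈ P.reflectionGroup u) : g.linearIsometryEquiv e = e := by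
  induction hg using Subgroup.closure_induction with
  | mem g hg =>
    obtain ⟨H, hH, rfl⟩ := hg
    rw [H.refl_linear, OrientedHyperplane.reflectDir, he H hH]; simp
  | one => rfl
  | mul g g' _ _ h h' =>
    change g.linearIsometryEquiv (g'.linearIsometryEquiv e) = e
    rw [h', h]
  | inv g _ h =>
    change g.linearIsometryEquiv.symm e = e
    rw [LinearIsometryEquiv.symm_apply_eq, h]

theorem inner_eq_zero_of_refl_mem {e : Space N}
    (he : ∀ H, P.IsReflectionHyperplane u H → ⟪H.normal, e⟫ = 0)
    (hH : H.refl ∈ P.reflectionGroup u) : ⟪H.normal, e⟫ = 0 := by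
  have h := linear_apply_of_mem_reflectionGroup he hH
  rw [H.refl_linear] at h
  have h1 := H.inner_reflectDir e
  rw [h] at h1
  linarith

namespace IsObstacleProblem

theorem isOpen_compl (hS : IsObstacleProblem P S 𝒞 𝓛 u) : IsOpen Sᶜ :=
  hS.isObstacle.isClosed.isOpen_compl

theorem isCompact (hS : IsObstacleProblem P S 𝒞 𝓛 u) : IsCompact S :=
  Metric.isCompact_of_isClosed_isBounded hS.isObstacle.isClosed hS.isObstacle.isBounded

theorem nonempty_interior (hS : IsObstacleProblem P S 𝒞 𝓛 u) : (interior S).Nonempty := by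
  rw [← closure_nonempty_iff, hS.isObstacle.closure_interior]
  exact hS.nonempty

theorem exists_radius (hS : IsObstacleProblem P S 𝒞 𝓛 u) :
    ∃ R, 0 ≤ R ∧ S ⊆ Metric.closedBall 0 R := by
  obtain ⟨R, hR⟩ := hS.isObstacle.isBounded.subset_closedBall (0 : Space N)
  exact ⟨max R 0, le_max_right _ _,
    hR.trans (Metric.closedBall_subset_closedBall (le_max_left _ _))⟩

theorem exceptionalSet_subset_closedBall (hS : IsObstacleProblem P S 𝒞 𝓛 u) {R : ℝ}
    (hR0 : 0 ≤ R) (hR : S ⊆ Metric.closedBall 0 R) :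
    P.exceptionalSet S u ⊆ Metric.closedBall 0 R := by
  rintro x ⟨H, hx, hH⟩
  by_contra hxR
  exact hH (hx.isReflectionHyperplane_of_norm_gt hS.two_le hS.admissible hS.isOpen_compl
    hS.isSolution hR0 (by rwa [compl_compl]) (by simpa using hxR)).refl_mem

theorem isBounded_component (hS : IsObstacleProblem P S 𝒞 𝓛 u) {x : Space N}
    (hx : P.IsFlatAt Sᶜ u H x) (hH : H.refl ∉ P.reflectionGroup u) {r : ℝ} (hr : 0 < r)
    (hrS : Metric.ball x r ⊆ Sᶜ) {p : Space N} (hp : p ∈ Metric.ball x r ∩ H.negSide) :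
    Bornology.IsBounded (connectedComponentIn (mirrorRegion H Sᶜ) p) := by
  obtain ⟨R, hR0, hR⟩ := hS.exists_radius
  by_contra hb
  exact hH (hx.isReflectionHyperplane_of_not_isBounded hS.admissible hS.isOpen_compl hS.isSolution
    hR0 (by rwa [compl_compl]) hr hrS hp hb).refl_mem

/-! ### Reflections preserve the convex hull of the obstacle -/

/-- Rays in a direction `e` orthogonal to all normals of reflection hyperplanes, in general position
and in a half-space without exceptional points, do not cross the boundary of a component: they would
cross it in flat points whose hyperplanes are transversal to `e`. -/
theorem ray_notMem_frontier (hS : IsObstacleProblem P S 𝒞 𝓛 u) {e : Space N}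
    (he : ∀ H, P.IsReflectionHyperplane u H → ⟪H.normal, e⟫ = 0) (hT : P.IsReflectionOperator H T)
    {p q : Space N} (hpS : ∀ t : ℝ, 0 ≤ t → p + t • e ∉ S ∧ p + t • e ∉ P.exceptionalSet S u)
    (hpH : p ∉ H.plane) (hpL : ∀ H' ∈ (fun H' => H'.map H.refl) '' 𝓛, p ∉ H'.plane)
    (hps : ∀ t : ℝ, IsSimple ((fun H' => H'.map H.refl) '' 𝓛) (p + t • e))
    (hDu : EqOn u (T (u ∘ H.reflect)) (connectedComponentIn (mirrorRegion H Sᶜ) q)) :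
    Disjoint ((fun t : ℝ => p + t • e) '' Ici 0)
      (frontier (connectedComponentIn (mirrorRegion H Sᶜ) q)) := by
  rw [disjoint_left]
  rintro _ ⟨t, ht, rfl⟩ hy
  obtain ⟨htS, htE⟩ := hpS t ht
  have key (H' : OrientedHyperplane N) (h : P.IsFlatAt Sᶜ u H' (p + t • e)) : p ∈ H'.plane := by
    have h1 := inner_eq_zero_of_refl_mem he (refl_mem_of_notMem_exceptionalSet htE h)
    have h2 := h.1
    rwa [H'.mem_plane, inner_add_right, inner_smul_right, h1, mul_zero, add_zero] at h2
  have htH : p + t • e ∉ H.plane := fun h =>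
    hpH <| key H <| isFlatAt_of_mem_frontier hT hS.isOpen_compl hS.isSolution hDu hy htS h
  have hsim : IsSimple 𝓛 (H.reflect (p + t • e)) := by
    apply IsSimple.of_map (g := H.refl)
    rw [H.coe_refl, H.reflect_reflect]
    exact hps t
  obtain ⟨H', hflat, ⟨H₀, hH₀, hH'⟩, -⟩ := exists_isFlatAt_of_mem_frontier_component hS.admissible
    hT hS.isObstacle hS.decomposition hS.finite hS.carriesCells hS.isSolution hS.vanishOnCells hDu
    hy htS htH hsim
  have := key H' hflat
  rw [hH'] at this
  exact hpL _ ⟨H₀, hH₀, rfl⟩ this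

/-- A half-space that contains the obstacle contains the exceptional set: otherwise the bounded
component at an almost extremal exceptional point would contain a ray. -/
theorem exceptionalSet_subset_halfSpace (hS : IsObstacleProblem P S 𝒞 𝓛 u) {e ξ : Space N}
    (he : ∀ H, P.IsReflectionHyperplane u H → ⟪H.normal, e⟫ = 0) (hξ : 0 < ⟪ξ, e⟫) {a : ℝ}
    (ha : ∀ z ∈ S, ⟪ξ, z⟫ ≤ a) : ∀ z ∈ P.exceptionalSet S u, ⟪ξ, z⟫ ≤ a := by
  intro x₀ hx₀
  by_contra! hx₀a
  have hξ0 : 0 < ‖ξ‖ := norm_pos_iff.2 fun h => by simp [h] at hξ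
  obtain ⟨R, hR0, hR⟩ := hS.exists_radius
  have hbdd : BddAbove ((fun z => ⟪ξ, z⟫) '' P.exceptionalSet S u) := by
    refine ⟨‖ξ‖ * R, ?_⟩
    rintro _ ⟨z, hz, rfl⟩
    have h1 := hS.exceptionalSet_subset_closedBall hR0 hR hz
    rw [mem_closedBall_zero_iff] at h1
    exact (real_inner_le_norm _ _).trans (mul_le_mul_of_nonneg_left h1 hξ0.le)
  set b := sSup ((fun z => ⟪ξ, z⟫) '' P.exceptionalSet S u) with hb
  have hle : ∀ z ∈ P.exceptionalSet S u, ⟪ξ, z⟫ ≤ b := fun z hz => le_csSup hbdd ⟨z, hz, rfl⟩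
  have hab : a < b := hx₀a.trans_le (hle x₀ hx₀)
  obtain ⟨_, ⟨x, ⟨H, hx, hH⟩, rfl⟩, hxb⟩ :=
    exists_lt_of_lt_csSup (s := (fun z => ⟪ξ, z⟫) '' P.exceptionalSet S u) (b := (a + b) / 2)
      ⟨_, x₀, hx₀, rfl⟩ (by rw [← hb]; linarith)
  -- the ball about `x` that touches the half-space reaches beyond all exceptional points
  simp only at hxb
  have hr : 0 < (⟪ξ, x⟫ - a) / ‖ξ‖ := div_pos (by linarith) hξ0
  have hrS : Metric.ball x ((⟪ξ, x⟫ - a) / ‖ξ‖) ⊆ Sᶜ := fun w hw hwS => by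
    rw [Metric.mem_ball, dist_comm, dist_eq_norm, lt_div_iff₀ hξ0] at hw
    have h1 := real_inner_le_norm ξ (x - w)
    rw [inner_sub_right] at h1
    linarith [ha w hwS, mul_comm ‖ξ‖ ‖x - w‖]
  have hne : (Metric.ball x ((⟪ξ, x⟫ - a) / ‖ξ‖) ∩ {w | b < ⟪ξ, w⟫}).Nonempty := by
    refine ⟨x + (((b - a) / 2) / ‖ξ‖ ^ 2) • ξ, ?_, ?_⟩
    · rw [Metric.mem_ball, dist_eq_norm, add_sub_cancel_left, norm_smul,
        Real.norm_of_nonneg (by have := sub_pos.2 hab; positivity), lt_div_iff₀ hξ0]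
      have : (b - a) / 2 / ‖ξ‖ ^ 2 * ‖ξ‖ * ‖ξ‖ = (b - a) / 2 := by field_simp
      rw [this]; linarith
    · rw [mem_ofPred_eq, inner_add_right, inner_smul_right, real_inner_self_eq_norm_sq,
        div_mul_cancel₀ _ (by positivity)]
      linarith
  have hVo : IsOpen {w : Space N | b < ⟪ξ, w⟫} := isOpen_lt continuous_const (by fun_prop)
  obtain ⟨p, ⟨hpr, hpb⟩, hpL, hps⟩ := exists_line_isSimple
    ((hS.finite.image fun H' => H'.map H.refl).insert H) e (Metric.isOpen_ball.inter hVo) hne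
  have hpH : p ∉ H.plane := hpL H (mem_insert _ _)
  have hray : ∀ t : ℝ, 0 ≤ t → p + t • e ∉ S ∧ p + t • e ∉ P.exceptionalSet S u := by
    intro t ht
    have h1 : b < ⟪ξ, p + t • e⟫ := by
      rw [inner_add_right, inner_smul_right]
      have := mul_nonneg ht hξ.le
      have : b < ⟪ξ, p⟫ := hpb
      linarith
    exact ⟨fun h => by linarith [ha _ h], fun h => by linarith [hle _ h]⟩
  have key (H' : OrientedHyperplane N) (hH' : H'.refl = H.refl) (hx' : P.IsFlatAt Sᶜ u H' x)
      (hpH' : p ∉ H'.plane) (hpn : p ∈ H'.negSide) : False := by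
    obtain ⟨T, hT⟩ := hS.admissible.reflection H'
    have hDu := hx'.eqOn_component hS.admissible.uniqueContinuation hT hS.isOpen_compl
      hS.isSolution hr hrS ⟨hpr, hpn⟩
    have hdis := hS.ray_notMem_frontier he hT hray hpH'
      (by rw [hH']; exact fun K hK => hpL K (mem_insert_of_mem _ hK))
      (by rw [hH']; exact fun t => (hps t).mono (subset_insert _ _)) hDu
    have hpD : p ∈ connectedComponentIn (mirrorRegion H' Sᶜ) p := mem_connectedComponentIn <|
      ball_inter_negSide_subset_mirrorRegion hx'.1 hrS ⟨hpr, hpn⟩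
    have hsub := (isPreconnected_ray p e).subset_of_disjoint_frontier
      (isOpen_mirrorRegion hS.isOpen_compl).connectedComponentIn hdis
      ⟨p, ⟨0, self_mem_Ici, by simp⟩, hpD⟩
    have hbd := (hS.isBounded_component hx' (by rwa [hH']) hr hrS ⟨hpr, hpn⟩).subset hsub
    obtain ⟨ρ, hρ⟩ := hbd.subset_closedBall p
    have he0 : 0 < ‖e‖ := norm_pos_iff.2 fun h => by simp [h] at hξ
    have := hρ ⟨(|ρ| + 1) / ‖e‖, by rw [mem_Ici]; positivity, rfl⟩
    rw [Metric.mem_closedBall, dist_eq_norm, add_sub_cancel_left, norm_smul,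
      Real.norm_of_nonneg (by positivity), div_mul_cancel₀ _ he0.ne'] at this
    linarith [le_abs_self ρ]
  rcases H.mem_negSide_or_mem_plane_or_mem_posSide p with h | h | h
  · exact key H rfl hx hpH h
  · exact hpH h
  · exact key H.reverse H.refl_reverse (hx.reverse hS.admissible hS.isSolution)
      (by rwa [H.plane_reverse]) (by rwa [H.negSide_reverse])

end IsObstacleProblem

end Operators

namespace Operators

variable {N M L L₁ J J₁ : ℕ} {P : Operators N M L L₁ J J₁} {S : Set (Space N)}
  {𝒞 : Set (Set (Space N))} {𝓛 : Set (OrientedHyperplane N)} {u : Space N → Fin M → ℂ}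
  {H : OrientedHyperplane N} {T : (Space N → Fin M → ℂ) → Space N → Fin M → ℂ}

namespace IsObstacleProblem

/-- A half-space that contains the obstacle contains its mirror image in a reflection hyperplane:
a ray from a protruding point would enter, from the mirror image of the obstacle, the component that
reaches to infinity. -/
theorem reflect_mem_halfSpace (hS : IsObstacleProblem P S 𝒞 𝓛 u) {e ξ : Space N}
    (he : ∀ H, P.IsReflectionHyperplane u H → ⟪H.normal, e⟫ = 0) (hξ : 0 < ⟪ξ, e⟫) {a : ℝ}
    (ha : ∀ z ∈ S, ⟪ξ, z⟫ ≤ a) (hH : P.IsReflectionHyperplane u H)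
    (hH' : P.IsReflectionHyperplane u H.reverse) :
    ∀ z ∈ S, ⟪ξ, H.reflect z⟫ ≤ a := by
  intro z hz
  by_contra! hza
  obtain ⟨R, hR0, hR⟩ := hS.exists_radius
  have haE := hS.exceptionalSet_subset_halfSpace he hξ ha
  have hUo : IsOpen {w : Space N | a < ⟪ξ, w⟫} := isOpen_lt continuous_const (by fun_prop)
  have hne : (H.reflect ⁻¹' interior S ∩ {w | a < ⟪ξ, w⟫}).Nonempty := by
    have hzc : z ∈ closure (interior S) := by rwa [hS.isObstacle.closure_interior]
    obtain ⟨w, hw, hwS⟩ := mem_closure_iff.1 hzc _ (hUo.preimage H.continuous_reflect) hza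
    exact ⟨H.reflect w, by rwa [mem_preimage, H.reflect_reflect], hw⟩
  obtain ⟨p, ⟨hpS, hpa⟩, hpL, hps⟩ := exists_line_isSimple
    ((hS.finite.image fun H' => H'.map H.refl).insert H) e
    ((isOpen_interior.preimage H.continuous_reflect).inter hUo) hne
  have hpH : p ∉ H.plane := hpL H (mem_insert _ _)
  have hray : ∀ t : ℝ, 0 ≤ t → p + t • e ∉ S ∧ p + t • e ∉ P.exceptionalSet S u := by
    intro t ht
    have h1 : a < ⟪ξ, p + t • e⟫ := by
      rw [inner_add_right, inner_smul_right]
      have := mul_nonneg ht hξ.le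
      have : a < ⟪ξ, p⟫ := hpa
      linarith
    exact ⟨fun h => by linarith [ha _ h], fun h => by linarith [haE _ h]⟩
  have key (K : OrientedHyperplane N) (hK : K.refl = H.refl) (hKr : P.IsReflectionHyperplane u K)
      (hpK : p ∉ K.plane) (hpn : p ∈ K.negSide) : False := by
    obtain ⟨T, hT⟩ := hS.admissible.reflection K
    have hRc : (Sᶜ)ᶜ ⊆ Metric.closedBall 0 R := by rwa [compl_compl]
    have he0 : 0 < ‖e‖ := norm_pos_iff.2 fun h => by simp [h] at hξ
    have ht : 0 ≤ (R + 2 * |K.offset| + ‖p‖ + 1) / ‖e‖ := by positivity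
    have hqfar : p + ((R + 2 * |K.offset| + ‖p‖ + 1) / ‖e‖) • e ∈ K.far R := by
      refine K.mem_far ?_ ?_
      · rw [K.mem_negSide, inner_add_right, inner_smul_right, he K hKr, mul_zero, add_zero]
        exact hpn
      · have h1 := norm_sub_norm_le (((R + 2 * |K.offset| + ‖p‖ + 1) / ‖e‖) • e) (-p)
        rw [norm_neg, norm_smul, Real.norm_of_nonneg ht, div_mul_cancel₀ _ he0.ne',
          sub_neg_eq_add, add_comm _ p] at h1
        linarith
    have hfar := (isPreconnected_far (H := K) hR0).subset_connectedComponentIn hqfar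
      (far_subset_mirrorRegion hRc)
    have hDu := eqOn_reflection_of_subset hS.admissible.uniqueContinuation hT hS.isSolution
      (isOpen_mirrorRegion hS.isOpen_compl).connectedComponentIn isPreconnected_connectedComponentIn
      (connectedComponentIn_subset _ _) K.isOpen_far hfar ⟨_, hqfar⟩
      (hKr.eqOn_far hS.two_le hS.admissible.uniqueContinuation hT hS.isSolution hR0 hRc)
    have hdis := hS.ray_notMem_frontier he hT hray hpK
      (by rw [hK]; exact fun K hK => hpL K (mem_insert_of_mem _ hK))
      (by rw [hK]; exact fun t => (hps t).mono (subset_insert _ _)) hDu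
    have hsub := (isPreconnected_ray p e).subset_of_disjoint_frontier
      (isOpen_mirrorRegion hS.isOpen_compl).connectedComponentIn hdis
      ⟨_, ⟨_, ht, rfl⟩, hfar hqfar⟩
    have hpm : p ∈ mirrorRegion K Sᶜ :=
      connectedComponentIn_subset _ _ (hsub ⟨0, self_mem_Ici, by simp⟩)
    apply hpm.2.2
    have : K.reflect p = H.reflect p := by rw [← K.coe_refl, hK, H.coe_refl]
    rw [this]
    exact interior_subset hpS
  rcases H.mem_negSide_or_mem_plane_or_mem_posSide p with h | h | h
  · exact key H rfl hH hpH h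
  · exact hpH h
  · exact key H.reverse H.refl_reverse hH' (by rwa [H.plane_reverse]) (by rwa [H.negSide_reverse])

/-- The obstacle is locally invariant along the directions parallel to all hyperplanes through a
point. -/
theorem exists_forall_add_smul_mem (hS : IsObstacleProblem P S 𝒞 𝓛 u) {x w : Space N} (hx : x ∈ S)
    (hw : ∀ H ∈ 𝓛, x ∈ H.plane → ⟪H.normal, w⟫ = 0) :
    ∃ δ > 0, ∀ t : ℝ, |t| < δ → x + t • w ∈ S := by
  obtain ⟨r, hr, hrx⟩ := exists_ball_avoiding hS.finite x
  refine ⟨r / 2 / (‖w‖ + 1), by positivity, fun t ht => ?_⟩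
  rw [lt_div_iff₀ (by positivity)] at ht
  have hA : x ∈ closure ((interior S ∩ Metric.ball x (r / 2)) ∩
      {p | ∀ H ∈ 𝓛, p ∉ H.plane}) := by
    have h1 : x ∈ closure (interior S ∩ Metric.ball x (r / 2)) := by
      rw [← hS.isObstacle.closure_interior] at hx
      exact mem_closure_iff.2 fun V hV hxV => by
        obtain ⟨y, hy, hyS⟩ := mem_closure_iff.1 hx _ (hV.inter Metric.isOpen_ball)
          ⟨hxV, Metric.mem_ball_self (half_pos hr)⟩
        exact ⟨y, hy.1, hyS, hy.2⟩
    exact closure_minimal ((dense_avoiding_planes hS.finite).open_subset_closure_inter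
      (isOpen_interior.inter Metric.isOpen_ball)) isClosed_closure h1
  rw [← hS.isObstacle.isClosed.closure_eq]
  refine map_mem_closure (f := fun p => p + t • w) (by fun_prop) hA ?_
  rintro p ⟨⟨hpS, hpr⟩, hpL⟩
  -- the segment from `p` to `p + t • w` meets no hyperplane of the family
  have hseg : IsPreconnected ((fun s : ℝ => p + s • (t • w)) '' Icc 0 1) :=
    isPreconnected_Icc.image _ (by fun_prop)
  refine interior_subset (hseg.subset_of_disjoint_frontier isOpen_interior ?_
    ⟨p, ⟨0, by simp, by simp⟩, hpS⟩ ⟨1, by simp, by simp⟩)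
  rw [disjoint_left]
  rintro _ ⟨s, hs, rfl⟩ hf
  obtain ⟨H, hH, hyH⟩ := exists_mem_plane_of_mem_frontier hS.decomposition hS.carriesCells
    (frontier_interior_subset hf)
  have hball : p + s • (t • w) ∈ Metric.ball x r := by
    have h1 : ‖s • (t • w)‖ ≤ |t| * (‖w‖ + 1) := by
      rw [norm_smul, norm_smul, Real.norm_of_nonneg hs.1, Real.norm_eq_abs]
      nlinarith [hs.2, hs.1, abs_nonneg t, norm_nonneg w, mul_nonneg (abs_nonneg t) (norm_nonneg w)]
    rw [Metric.mem_ball, dist_eq_norm] at hpr ⊢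
    have h2 := norm_add_le (p - x) (s • (t • w))
    rw [sub_add_eq_add_sub] at h2
    linarith
  have h0 := hw H hH (hrx H hH ⟨_, hyH, hball⟩)
  rw [H.mem_plane, inner_add_right, inner_smul_right, inner_smul_right, h0, mul_zero, mul_zero,
    add_zero] at hyH
  exact hpL H hH hyH

/-- The vertices of the obstacle, where the normals of the hyperplanes of `𝓛` span, are finite in
number, and the obstacle lies in their convex hull. -/
theorem exists_finite_subset_convexHull (hS : IsObstacleProblem P S 𝒞 𝓛 u) :
    ∃ V : Set (Space N), V.Finite ∧ V ⊆ S ∧ S ⊆ convexHull ℝ V := by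
  let V : Set (Space N) :=
    {x ∈ S | ∀ w, (∀ H ∈ 𝓛, x ∈ H.plane → ⟪H.normal, w⟫ = 0) → w = 0}
  have hVf : V.Finite := by
    refine Set.Finite.of_finite_image (f := fun x => {H ∈ 𝓛 | x ∈ H.plane})
      (hS.finite.finite_subsets.subset ?_) ?_
    · rintro _ ⟨x, -, rfl⟩
      exact sep_subset _ _
    · intro x hx y _ hxy
      refine (sub_eq_zero.1 (hx.2 (y - x) fun H hH hxH => ?_)).symm
      have h1 : H ∈ {H ∈ 𝓛 | x ∈ H.plane} := ⟨hH, hxH⟩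
      simp only at hxy
      rw [hxy] at h1
      rw [inner_sub_right, H.mem_plane.1 h1.2, H.mem_plane.1 hxH, sub_self]
  refine ⟨V, hVf, sep_subset _ _, fun x hx => ?_⟩
  by_contra hxV
  obtain ⟨f, c, hf, hfx⟩ := geometric_hahn_banach_closed_point (convex_convexHull ℝ V)
    (hVf.isClosed_convexHull ℝ) hxV
  obtain ⟨y, hy, hymax⟩ := hS.isCompact.exists_isMaxOn ⟨x, hx⟩ f.continuous.continuousOn
  -- an extreme point of the set where `f` is maximal is a vertex
  have hFc : IsCompact (S ∩ {z | f z = f y}) :=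
    hS.isCompact.inter_right (isClosed_eq f.continuous continuous_const)
  obtain ⟨v, hv⟩ := hFc.extremePoints_nonempty ⟨y, hy, rfl⟩
  obtain ⟨⟨hvS, hvy⟩, hvext⟩ := mem_extremePoints.1 hv
  have hvV : v ∈ V := by
    refine ⟨hvS, fun w hw => ?_⟩
    obtain ⟨δ, hδ, hδS⟩ := hS.exists_forall_add_smul_mem hvS hw
    have h1 := hδS (δ / 2) (by rw [abs_of_pos (half_pos hδ)]; linarith)
    have h2 := hδS (-(δ / 2)) (by rw [abs_neg, abs_of_pos (half_pos hδ)]; linarith)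
    have hm1 : f (v + (δ / 2) • w) ≤ f y := hymax h1
    have hm2 : f (v + (-(δ / 2)) • w) ≤ f y := hymax h2
    have hvy : f v = f y := hvy
    rw [map_add, map_smul, hvy, smul_eq_mul] at hm1 hm2
    have hfw : δ / 2 * f w = 0 := by linarith
    have hseg : v ∈ openSegment ℝ (v + (δ / 2) • w) (v + (-(δ / 2)) • w) :=
      ⟨1 / 2, 1 / 2, by norm_num, by norm_num, by norm_num, by module⟩
    have := (hvext _ ⟨h1, by simp [hvy, hfw]⟩ _ ⟨h2, by simp [hvy, hfw]⟩ hseg).1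
    rw [add_eq_left, smul_eq_zero] at this
    exact this.resolve_left (half_pos hδ).ne'
  have h1 := hf v (subset_convexHull ℝ V hvV)
  have h2 : f x ≤ f y := hymax hx
  have h3 : f v = f y := hvy
  linarith

theorem exists_finite_convexHull_eq (hS : IsObstacleProblem P S 𝒞 𝓛 u) :
    ∃ V : Set (Space N), V.Finite ∧ convexHull ℝ S = convexHull ℝ V := by
  obtain ⟨V, hVf, hVS, hSV⟩ := hS.exists_finite_subset_convexHull
  exact ⟨V, hVf, (convexHull_min hSV (convex_convexHull ℝ V)).antisymm (convexHull_mono hVS)⟩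

theorem isReflectionHyperplane_reverse (hS : IsObstacleProblem P S 𝒞 𝓛 u)
    (hH : P.IsReflectionHyperplane u H) : P.IsReflectionHyperplane u H.reverse := by
  obtain ⟨T, hT⟩ := hS.admissible.reflection H
  obtain ⟨R, hR0, hR⟩ := hS.exists_radius
  have hRc : (Sᶜ)ᶜ ⊆ Metric.closedBall 0 R := by rwa [compl_compl]
  have h := hH.eqOn_far hS.two_le hS.admissible.uniqueContinuation hT hS.isSolution hR0 hRc
  refine ⟨R + 2 * |H.offset| + 1, by positivity, fun y hy => ?_⟩
  have hy' : R + 2 * |H.offset| + 1 < ‖y‖ := by simpa using hy.2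
  have hyH : y ∈ H.plane := by simpa using hy.1
  have hc := abs_nonneg H.offset
  exact (vanishOn_of_eqOn_reflection hT hS.isSolution hyH one_pos
    (ball_subset_of_norm_gt hRc (by linarith))
    (h.mono (ball_inter_negSide_subset_far hy'))).2 y ⟨Metric.mem_ball_self one_pos, hyH⟩

theorem reflect_mem_convexHull (hS : IsObstacleProblem P S 𝒞 𝓛 u) {e : Space N} (he0 : e ≠ 0)
    (he : ∀ H, P.IsReflectionHyperplane u H → ⟪H.normal, e⟫ = 0)
    (hH : P.IsReflectionHyperplane u H) : ∀ z ∈ S, H.reflect z ∈ convexHull ℝ S := by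
  intro z hz
  by_contra hzS
  obtain ⟨V, hVf, hV⟩ := hS.exists_finite_convexHull_eq
  rw [hV] at hzS
  obtain ⟨f, c, hf, hfz⟩ := geometric_hahn_banach_closed_point (convex_convexHull ℝ V)
    (hVf.isClosed_convexHull ℝ) hzS
  obtain ⟨ξ, hξ⟩ : ∃ ξ : Space N, ∀ y, f y = ⟪ξ, y⟫ :=
    ⟨(InnerProductSpace.toDual ℝ (Space N)).symm f, fun y => by simp⟩
  obtain ⟨R, hR0, hR⟩ := hS.exists_radius
  have key (d : Space N) (hd0 : d ≠ 0)
      (hd : ∀ H, P.IsReflectionHyperplane u H → ⟪H.normal, d⟫ = 0) (hξd : 0 ≤ ⟪ξ, d⟫) : False := by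
    -- a small multiple of `d` makes the functional strictly increasing along `d`
    have hle (ε : ℝ) (hε : 0 < ε) : ⟪ξ, H.reflect z⟫ - c ≤ ε * (‖d‖ * (R + ‖H.reflect z‖)) := by
      have h1 : 0 < ⟪ξ + ε • d, d⟫ := by
        rw [inner_add_left, real_inner_smul_left, real_inner_self_eq_norm_sq]
        have := norm_pos_iff.2 hd0
        positivity
      have h2 := hS.reflect_mem_halfSpace hd h1 (a := c + ε * (‖d‖ * R)) (fun y hy => by
        have h3 := hf y (by rw [← hV]; exact subset_convexHull ℝ S hy)
        have h4 := real_inner_le_norm d y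
        have h5 := mem_closedBall_zero_iff.1 (hR hy)
        rw [inner_add_left, real_inner_smul_left, ← hξ]
        have h6 := mul_le_mul_of_nonneg_left
          (h4.trans (mul_le_mul_of_nonneg_left h5 (norm_nonneg d))) hε.le
        linarith) hH (hS.isReflectionHyperplane_reverse hH) z hz
      rw [inner_add_left, real_inner_smul_left] at h2
      have h7 := neg_le_of_abs_le (abs_real_inner_le_norm d (H.reflect z))
      have h8 := mul_le_mul_of_nonneg_left h7 hε.le
      linarith
    have hpos : 0 < ⟪ξ, H.reflect z⟫ - c := by rw [← hξ]; linarith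
    have hK : 0 ≤ ‖d‖ * (R + ‖H.reflect z‖) := by positivity
    have := hle ((⟪ξ, H.reflect z⟫ - c) / (‖d‖ * (R + ‖H.reflect z‖) + 1)) (by positivity)
    rw [div_mul_eq_mul_div, le_div_iff₀ (by positivity)] at this
    linarith
  rcases le_total 0 ⟪ξ, e⟫ with h | h
  · exact key e he0 he h
  · exact key (-e) (neg_ne_zero.2 he0) (fun K hK => by rw [inner_neg_right, he K hK, neg_zero])
      (by rw [inner_neg_right]; linarith)

theorem image_convexHull_eq (hS : IsObstacleProblem P S 𝒞 𝓛 u) {e : Space N} (he0 : e ≠ 0)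
    (he : ∀ H, P.IsReflectionHyperplane u H → ⟪H.normal, e⟫ = 0) {g : Space N ≃ᵃⁱ[ℝ] Space N}
    (hg : g ∈ P.reflectionGroup u) : g '' convexHull ℝ S = convexHull ℝ S := by
  induction hg using Subgroup.closure_induction with
  | mem g hg =>
    obtain ⟨H, hH, rfl⟩ := hg
    have hsub : H.refl '' convexHull ℝ S ⊆ convexHull ℝ S := by
      have h1 : H.refl '' convexHull ℝ S = convexHull ℝ (H.refl '' S) :=
        AffineMap.image_convexHull H.refl.toAffineEquiv.toAffineMap S
      rw [h1]
      refine convexHull_min ?_ (convex_convexHull ℝ S)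
      rintro _ ⟨z, hz, rfl⟩
      exact hS.reflect_mem_convexHull he0 he hH z hz
    refine hsub.antisymm fun x hx => ⟨H.refl x, hsub ⟨x, hx, rfl⟩, H.reflect_reflect x⟩
  | one => simp
  | mul g g' _ _ h h' => rw [AffineIsometryEquiv.coe_mul, image_comp, h', h]
  | inv g _ h =>
    conv_lhs => rw [← h, ← image_comp]
    have : (g⁻¹ : Space N ≃ᵃⁱ[ℝ] Space N) ∘ g = id := by
      ext1 x; exact g.symm_apply_apply x
    rw [this, image_id]

/-- The reflection group permutes the finitely many extreme points of the convex hull of the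
obstacle. -/
theorem finite_reflectionGroup (hS : IsObstacleProblem P S 𝒞 𝓛 u) {e : Space N} (he0 : e ≠ 0)
    (he : ∀ H, P.IsReflectionHyperplane u H → ⟪H.normal, e⟫ = 0) :
    Finite (P.reflectionGroup u) := by
  obtain ⟨V, hVf, hV⟩ := hS.exists_finite_convexHull_eq
  set X := (convexHull ℝ S).extremePoints ℝ with hX
  have hXf : X.Finite := hVf.subset (by rw [hX, hV]; exact extremePoints_convexHull_subset)
  have hXX (g : P.reflectionGroup u) (x : X) : (g : Space N ≃ᵃⁱ[ℝ] Space N) x ∈ X := by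
    have hx := mem_extremePoints.1 x.2
    have hinv := hS.image_convexHull_eq he0 he g.2
    refine mem_extremePoints.2 ⟨hinv ▸ mem_image_of_mem _ hx.1, fun x₁ hx₁ x₂ hx₂ hseg => ?_⟩
    rw [← hinv] at hx₁ hx₂
    obtain ⟨y₁, hy₁, rfl⟩ := hx₁
    obtain ⟨y₂, hy₂, rfl⟩ := hx₂
    have h1 := image_openSegment ℝ (g : Space N ≃ᵃⁱ[ℝ] Space N).toAffineEquiv.toAffineMap y₁ y₂
    have h2 : (x : Space N) ∈ openSegment ℝ y₁ y₂ := by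
      rw [← (g : Space N ≃ᵃⁱ[ℝ] Space N).injective.mem_set_image]
      exact h1 ▸ hseg
    obtain ⟨h3, h4⟩ := hx.2 y₁ hy₁ y₂ hy₂ h2
    exact ⟨congrArg _ h3, congrArg _ h4⟩
  have : Finite X := hXf
  refine Finite.of_injective (fun (g : P.reflectionGroup u) (x : X) => (⟨_, hXX g x⟩ : X)) ?_
  intro g g' h
  have hagree : X.EqOn (g : Space N ≃ᵃⁱ[ℝ] Space N).toAffineEquiv
      (g' : Space N ≃ᵃⁱ[ℝ] Space N).toAffineEquiv := fun x hx =>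
    congrArg Subtype.val (congrFun h ⟨x, hx⟩)
  have hcl : convexHull ℝ X = convexHull ℝ S := by
    have h1 := closure_convexHull_extremePoints (s := convexHull ℝ S)
      (by rw [hV]; exact hVf.isCompact_convexHull ℝ) (convex_convexHull ℝ S)
    rwa [← hX, (hXf.isClosed_convexHull ℝ).closure_eq] at h1
  have hspan : affineSpan ℝ X = ⊤ := by
    rw [← affineSpan_convexHull, hcl, affineSpan_convexHull]
    exact affineSpan_eq_top_of_nonempty_interior
      (hS.nonempty_interior.mono (interior_mono (subset_convexHull ℝ _)))
  exact Subtype.ext (AffineIsometryEquiv.toAffineEquiv_injective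
    (AffineEquiv.ext_on hspan _ _ hagree))

end IsObstacleProblem

end Operators

/-! ### Sets invariant under a finite group of isometries -/

section Invariant

variable {N : ℕ} {Γ : Subgroup (Space N ≃ᵃⁱ[ℝ] Space N)}

theorem OrientedHyperplane.map_map (H : OrientedHyperplane N)
    (g g' : Space N ≃ᵃⁱ[ℝ] Space N) : (H.map g).map g' = H.map (g' * g) := by
  have h1 : g' (g 0) = g'.linearIsometryEquiv (g 0) + g' 0 := by
    have := g'.map_vadd 0 (g 0)
    simpa using this
  have h2 : (g' * g).linearIsometryEquiv H.normal =
      g'.linearIsometryEquiv (g.linearIsometryEquiv H.normal) := rfl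
  simp only [OrientedHyperplane.map, h2, OrientedHyperplane.mk.injEq, true_and]
  rw [AffineIsometryEquiv.coe_mul, Function.comp_apply, h1, inner_add_right,
    LinearIsometryEquiv.inner_map_map]
  ring

/-- The images of a family of hyperplanes under the elements of a group. -/
def orbitFamily (Γ : Subgroup (Space N ≃ᵃⁱ[ℝ] Space N)) (𝓗 : Set (OrientedHyperplane N)) :
    Set (OrientedHyperplane N) :=
  ⋃ g : Γ, (fun H => H.map (g : Space N ≃ᵃⁱ[ℝ] Space N)) '' 𝓗

theorem finite_orbitFamily [Finite Γ] {𝓗 : Set (OrientedHyperplane N)} (h : 𝓗.Finite) :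
    (orbitFamily Γ 𝓗).Finite :=
  finite_iUnion fun _ => h.image _

theorem map_mem_orbitFamily {𝓗 : Set (OrientedHyperplane N)} {H : OrientedHyperplane N}
    (hH : H ∈ 𝓗) {g : Space N ≃ᵃⁱ[ℝ] Space N} (hg : g ∈ Γ) : H.map g ∈ orbitFamily Γ 𝓗 :=
  mem_iUnion.2 ⟨⟨g, hg⟩, H, hH, rfl⟩

theorem IsSimple.of_orbitFamily {𝓗 : Set (OrientedHyperplane N)} {y : Space N}
    (h : IsSimple (orbitFamily Γ 𝓗) y) {g : Space N ≃ᵃⁱ[ℝ] Space N} (hg : g ∈ Γ) :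
    IsSimple 𝓗 (g y) := by
  apply IsSimple.of_map (g := g⁻¹)
  have : (g⁻¹ : Space N ≃ᵃⁱ[ℝ] Space N) (g y) = y := g.symm_apply_apply y
  rw [this]
  refine h.mono ?_
  rintro _ ⟨H, hH, rfl⟩
  exact map_mem_orbitFamily hH (Γ.inv_mem hg)

theorem IsSimple.orbitFamily_apply {𝓗 : Set (OrientedHyperplane N)} {y : Space N}
    (h : IsSimple (orbitFamily Γ 𝓗) y) {g : Space N ≃ᵃⁱ[ℝ] Space N} (hg : g ∈ Γ) :
    IsSimple (orbitFamily Γ 𝓗) (g y) := by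
  apply IsSimple.of_map (g := g⁻¹)
  have : (g⁻¹ : Space N ≃ᵃⁱ[ℝ] Space N) (g y) = y := g.symm_apply_apply y
  rw [this]
  refine h.mono ?_
  rintro _ ⟨H', hH', rfl⟩
  obtain ⟨g', H, hH, rfl⟩ := mem_iUnion.1 hH'
  simp only [H.map_map]
  exact map_mem_orbitFamily hH (Γ.mul_mem (Γ.inv_mem hg) g'.2)

/-- The unbounded component of the complement of the orbit of a compact set under a finite group of
isometries is invariant under the group. -/
theorem exists_invariant_exterior (hN : 2 ≤ N) [Finite Γ] {K : Set (Space N)} (hK : IsCompact K) :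
    ∃ W : Set (Space N), IsOpen W ∧ IsPreconnected W ∧ (∀ g ∈ Γ, ∀ x ∈ W, g x ∈ W) ∧
      (∃ ρ, 0 ≤ ρ ∧ Wᶜ ⊆ Metric.closedBall 0 ρ) ∧ Disjoint W K ∧
      ∀ x ∈ frontier W, ∃ g ∈ Γ, g x ∈ K := by
  let KΓ : Set (Space N) := ⋃ g : Γ, (g : Space N ≃ᵃⁱ[ℝ] Space N) ⁻¹' K
  have hcl : IsClosed KΓ := isClosed_iUnion_of_finite fun g =>
    hK.isClosed.preimage (g : Space N ≃ᵃⁱ[ℝ] Space N).continuous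
  have hbd : Bornology.IsBounded KΓ := Bornology.isBounded_iUnion.2 fun g =>
    (g : Space N ≃ᵃⁱ[ℝ] Space N).isometry.antilipschitz.isBounded_preimage hK.isBounded
  obtain ⟨ρ₀, hρ₀⟩ := hbd.subset_closedBall (0 : Space N)
  set ρ := max ρ₀ 0
  have hρ : KΓ ⊆ Metric.closedBall 0 ρ :=
    hρ₀.trans (Metric.closedBall_subset_closedBall (le_max_left _ _))
  obtain ⟨q, hq⟩ := exists_norm_gt hN ρ
  have hfar : (Metric.closedBall (0 : Space N) ρ)ᶜ ⊆ connectedComponentIn KΓᶜ q :=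
    (isPreconnected_compl_closedBall hN (le_max_right _ _)).subset_connectedComponentIn
      (by rw [mem_compl_iff, mem_closedBall_zero_iff, not_le]; exact hq) (compl_subset_compl.2 hρ)
  refine ⟨connectedComponentIn KΓᶜ q, hcl.isOpen_compl.connectedComponentIn,
    isPreconnected_connectedComponentIn, fun g hg => ?_,
    ⟨ρ, le_max_right _ _, compl_subset_comm.1 hfar⟩, ?_, fun x hx => ?_⟩
  · -- the image of the component is connected and contains points near infinity of the component
    obtain ⟨x, hx⟩ := exists_norm_gt hN (ρ + ‖g 0‖)
    have hxW : x ∈ connectedComponentIn KΓᶜ q := hfar <| by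
      have := norm_nonneg (g 0)
      simp only [mem_compl_iff, mem_closedBall_zero_iff, not_le]; linarith
    have hgx : g.symm x ∈ connectedComponentIn KΓᶜ q := hfar <| by
      have h1 : ‖g.symm x‖ = ‖x - g 0‖ := by
        rw [← dist_zero_right, ← g.dist_map, g.apply_symm_apply, dist_eq_norm]
      have h2 := norm_sub_norm_le x (g 0)
      simp only [mem_compl_iff, mem_closedBall_zero_iff, not_le, h1]
      linarith
    have hsub : g '' connectedComponentIn KΓᶜ q ⊆ connectedComponentIn KΓᶜ x := by
      refine (isPreconnected_connectedComponentIn.image g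
        g.continuous.continuousOn).subset_connectedComponentIn ⟨_, hgx, g.apply_symm_apply x⟩ ?_
      rintro _ ⟨y, hy, rfl⟩ hgy
      obtain ⟨g', hg'⟩ := mem_iUnion.1 hgy
      exact connectedComponentIn_subset _ _ hy
        (mem_iUnion.2 ⟨⟨(g' : Space N ≃ᵃⁱ[ℝ] Space N) * g, Γ.mul_mem g'.2 hg⟩, hg'⟩)
    intro y hy
    rw [connectedComponentIn_eq hxW]
    exact hsub ⟨y, hy, rfl⟩
  · rw [disjoint_left]
    intro x hx hxK
    exact connectedComponentIn_subset _ _ hx (mem_iUnion.2 ⟨1, hxK⟩)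
  · by_contra! h
    refine (disjoint_frontier_connectedComponentIn hcl.isOpen_compl q).le_bot ⟨fun hxK => ?_, hx⟩
    obtain ⟨g, hg⟩ := mem_iUnion.1 hxK
    exact h g g.2 hg

theorem apply_mem_closure {W : Set (Space N)} (hW : ∀ g ∈ Γ, ∀ x ∈ W, g x ∈ W)
    {g : Space N ≃ᵃⁱ[ℝ] Space N} (hg : g ∈ Γ) {x : Space N} (hx : x ∈ closure W) :
    g x ∈ closure W :=
  map_mem_closure g.continuous hx (hW g hg)

theorem apply_mem_frontier {W : Set (Space N)} (hWo : IsOpen W)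
    (hW : ∀ g ∈ Γ, ∀ x ∈ W, g x ∈ W) {g : Space N ≃ᵃⁱ[ℝ] Space N} (hg : g ∈ Γ) {x : Space N}
    (hx : x ∈ frontier W) : g x ∈ frontier W := by
  rw [hWo.frontier_eq] at hx ⊢
  refine ⟨apply_mem_closure hW hg hx.1, fun h => hx.2 ?_⟩
  have := hW _ (Γ.inv_mem hg) _ h
  rwa [show (g⁻¹ : Space N ≃ᵃⁱ[ℝ] Space N) (g x) = x from g.symm_apply_apply x] at this

/-- A connected open set that is symmetric with respect to a hyperplane has a connected part on
either side: paths can be folded. -/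
theorem isPreconnected_inter_negSide {W : Set (Space N)} (hW : IsOpen W) (hWc : IsPreconnected W)
    {H : OrientedHyperplane N} (hWH : ∀ x ∈ W, H.reflect x ∈ W) :
    IsPreconnected (W ∩ H.negSide) := by
  rcases (W ∩ H.negSide).eq_empty_or_nonempty with h | ⟨p, hp⟩
  · rw [h]; exact isPreconnected_empty
  set Q := connectedComponentIn (W ∩ H.negSide) p with hQ
  have hO : IsOpen (W ∩ H.negSide) := hW.inter H.isOpen_negSide
  have hQo : IsOpen Q := hO.connectedComponentIn
  have hQsub : Q ⊆ W ∩ H.negSide := connectedComponentIn_subset _ _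
  have hQcl {y : Space N} (hy : y ∈ closure Q) (hyW : y ∈ W) (hyH : y ∈ H.negSide) : y ∈ Q := by
    by_contra h
    refine (disjoint_frontier_connectedComponentIn hO p).le_bot ⟨⟨hyW, hyH⟩, ?_⟩
    rw [← hQ, hQo.frontier_eq]
    exact ⟨hy, h⟩
  have hpos {y : Space N} (hy : y ∈ closure Q) : y ∉ H.posSide := fun h => by
    obtain ⟨z, hz, hzQ⟩ := mem_closure_iff.1 hy _ H.isOpen_posSide h
    exact absurd (H.mem_posSide.1 hz) (not_lt.2 (H.mem_negSide.1 (hQsub hzQ).2).le)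
  have hC : IsClosed (closure Q ∪ H.reflect ⁻¹' closure Q) :=
    isClosed_closure.union (isClosed_closure.preimage H.continuous_reflect)
  have hWC : W ⊆ closure Q ∪ H.reflect ⁻¹' closure Q := by
    refine subset_of_mem_nhds_of_isSimple (finite_singleton H) hW hWc hC (fun y hyW hyC _ => ?_)
      ⟨p, hp.1, interior_mono (subset_closure.trans subset_union_left) ?_⟩
    · rcases H.mem_negSide_or_mem_plane_or_mem_posSide y with h | h | h
      · have hyQ : y ∈ Q := hQcl (hyC.resolve_right fun h' =>
          hpos h' (H.reflect_mem_posSide.2 h)) hyW h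
        exact mem_of_superset (hQo.mem_nhds hyQ) (subset_closure.trans subset_union_left)
      · have hyQ : y ∈ closure Q := hyC.elim id fun h' => by
          rwa [mem_preimage, H.reflect_eq_self.2 h] at h'
        obtain ⟨s, hs, hsW⟩ := Metric.isOpen_iff.1 hW y hyW
        obtain ⟨z, hzs, hzQ⟩ := mem_closure_iff.1 hyQ _ Metric.isOpen_ball (Metric.mem_ball_self hs)
        have hsub : Metric.ball y s ∩ H.negSide ⊆ Q := by
          rw [hQ, connectedComponentIn_eq hzQ]
          exact ((convex_ball y s).inter H.convex_negSide).isPreconnected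
            |>.subset_connectedComponentIn
            ⟨hzs, (hQsub hzQ).2⟩ fun w hw => ⟨hsW hw.1, hw.2⟩
        refine mem_of_superset (Metric.ball_mem_nhds y hs) fun w hw => ?_
        have hw' : H.reflect w ∈ Metric.ball y s := by
          rw [← H.reflect_eq_self.2 h]; exact H.reflect_mem_ball.2 hw
        rcases H.mem_negSide_or_mem_plane_or_mem_posSide w with h' | h' | h'
        · exact .inl (subset_closure (hsub ⟨hw, h'⟩))
        · refine .inl (closure_mono hsub ?_)
          rw [inter_comm]
          exact H.mem_closure_negSide_inter_ball h' hw
        · exact .inr (subset_closure (hsub ⟨hw', H.reflect_mem_negSide.2 h'⟩))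
      · have hyQ : H.reflect y ∈ Q := hQcl (hyC.resolve_left fun h' => hpos h' h) (hWH y hyW)
          (H.reflect_mem_negSide.2 h)
        exact mem_of_superset ((hQo.preimage H.continuous_reflect).mem_nhds hyQ)
          fun w hw => .inr (subset_closure hw)
    · rw [hQo.interior_eq]
      exact mem_connectedComponentIn hp
  have : W ∩ H.negSide = Q := Subset.antisymm (fun y hy => hQcl ((hWC hy.1).resolve_right fun h' =>
    hpos h' (H.reflect_mem_posSide.2 hy.2)) hy.1 hy.2) hQsub
  rw [this]
  exact isPreconnected_connectedComponentIn

/-- A bounded set cannot meet an unbounded connected open set `W` that is invariant under a finite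
group if, within `W`, it is bounded by hyperplanes whose reflections belong to the group: its orbit
would fill `W`. -/
theorem false_of_isBounded [Finite Γ] {W D : Set (Space N)} (hW : IsOpen W)
    (hWc : IsPreconnected W) (hWΓ : ∀ g ∈ Γ, ∀ x ∈ W, g x ∈ W) (hWb : ¬ Bornology.IsBounded W)
    (hD : IsOpen D) (hDb : Bornology.IsBounded D) (hDW : (W ∩ D).Nonempty)
    {𝓗 : Set (OrientedHyperplane N)} (h𝓗 : 𝓗.Finite)
    (h : ∀ y ∈ W, y ∈ frontier D → IsSimple 𝓗 y → ∃ H : OrientedHyperplane N,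
      y ∈ H.plane ∧ H.refl ∈ Γ ∧ ∃ ρ > 0, H.posSide ∩ Metric.ball y ρ ⊆ D) : False := by
  obtain ⟨C, hCeq, hmem⟩ : ∃ C : Set (Space N),
      C = ⋃ g : Γ, (g : Space N ≃ᵃⁱ[ℝ] Space N) ⁻¹' closure D ∧
        ∀ x, x ∈ C ↔ ∃ g ∈ Γ, g x ∈ closure D := ⟨_, rfl, fun x => by simp⟩
  have hC : IsClosed C := hCeq ▸ isClosed_iUnion_of_finite fun g =>
    isClosed_closure.preimage (g : Space N ≃ᵃⁱ[ℝ] Space N).continuous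
  have hCb : Bornology.IsBounded C := hCeq ▸ Bornology.isBounded_iUnion.2 fun g =>
    (g : Space N ≃ᵃⁱ[ℝ] Space N).isometry.antilipschitz.isBounded_preimage hDb.closure
  have hDC : D ⊆ C := fun x hx => (hmem x).2 ⟨1, one_mem _, subset_closure hx⟩
  refine hWb (hCb.subset (subset_of_mem_nhds_of_isSimple (finite_orbitFamily (Γ := Γ) h𝓗) hW hWc hC
    (fun y hyW hyC hys => ?_) ?_))
  · obtain ⟨g, hg, hgy⟩ := (hmem y).1 hyC
    by_cases hgD : g y ∈ D
    · have hO : IsOpen (g ⁻¹' D) := hD.preimage g.continuous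
      exact mem_of_superset (hO.mem_nhds hgD) fun x hx => (hmem x).2 ⟨g, hg, subset_closure hx⟩
    · obtain ⟨H, hyH, hHΓ, ρ, hρ, hρD⟩ := h (g y) (hWΓ g hg y hyW)
        (by rw [hD.frontier_eq]; exact ⟨hgy, hgD⟩) (hys.of_orbitFamily hg)
      have hO : IsOpen (g ⁻¹' Metric.ball (g y) ρ) := Metric.isOpen_ball.preimage g.continuous
      have hyO : y ∈ g ⁻¹' Metric.ball (g y) ρ := mem_preimage.2 (Metric.mem_ball_self hρ)
      refine mem_of_superset (hO.mem_nhds hyO) fun x hx => (hmem x).2 ?_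
      have hx : g x ∈ Metric.ball (g y) ρ := hx
      rcases H.mem_negSide_or_mem_plane_or_mem_posSide (g x) with h' | h' | h'
      · have hb : H.reflect (g x) ∈ Metric.ball (g y) ρ := by
          rw [← H.reflect_eq_self.2 hyH]
          exact H.reflect_mem_ball.2 hx
        have hcl : H.reflect (g x) ∈ closure D :=
          subset_closure (hρD ⟨H.reflect_mem_posSide.2 h', hb⟩)
        refine ⟨H.refl * g, Γ.mul_mem hHΓ hg, ?_⟩
        rwa [AffineIsometryEquiv.coe_mul, Function.comp_apply, H.coe_refl]
      · exact ⟨g, hg, closure_mono hρD (H.mem_closure_posSide_inter_ball h' hx)⟩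
      · exact ⟨g, hg, subset_closure (hρD ⟨h', hx⟩)⟩
  · obtain ⟨x, hxW, hxD⟩ := hDW
    exact ⟨x, hxW, interior_maximal hDC hD hxD⟩

end Invariant

namespace Operators

variable {N M L L₁ J J₁ : ℕ} {P : Operators N M L L₁ J J₁} {S : Set (Space N)}
  {𝒞 : Set (Set (Space N))} {𝓛 : Set (OrientedHyperplane N)} {u : Space N → Fin M → ℂ}
  {H : OrientedHyperplane N} {T : (Space N → Fin M → ℂ) → Space N → Fin M → ℂ}

namespace IsObstacleProblem

/-! ### The symmetric exterior region -/

/-- In a symmetric connected neighbourhood of infinity the solution coincides with its reflection in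
a reflection hyperplane. -/
theorem eqOn_reflection_exterior (hS : IsObstacleProblem P S 𝒞 𝓛 u) {W : Set (Space N)}
    (hW : IsOpen W) (hWc : IsPreconnected W) {ρ : ℝ} (hWρ : Wᶜ ⊆ Metric.closedBall 0 ρ)
    (hWS : Disjoint W S) (hH : P.IsReflectionHyperplane u H) (hT : P.IsReflectionOperator H T)
    (hWH : ∀ x ∈ W, H.reflect x ∈ W) :
    W ∩ H.negSide ⊆ mirrorRegion H Sᶜ ∧ EqOn u (T (u ∘ H.reflect)) (W ∩ H.negSide) := by
  obtain ⟨R₀, hR₀, hSR₀⟩ := hS.exists_radius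
  have hR0 : 0 ≤ max ρ R₀ := hR₀.trans (le_max_right _ _)
  have hWR : Wᶜ ⊆ Metric.closedBall 0 (max ρ R₀) :=
    hWρ.trans (Metric.closedBall_subset_closedBall (le_max_left _ _))
  have hSR : (Sᶜ)ᶜ ⊆ Metric.closedBall 0 (max ρ R₀) := by
    rw [compl_compl]
    exact hSR₀.trans (Metric.closedBall_subset_closedBall (le_max_right _ _))
  have hsub : W ∩ H.negSide ⊆ mirrorRegion H Sᶜ := fun x hx =>
    ⟨hx.2, hWS.subset_compl_right hx.1, hWS.subset_compl_right (hWH x hx.1)⟩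
  refine ⟨hsub, eqOn_reflection_of_subset hS.admissible.uniqueContinuation hT hS.isSolution
    (hW.inter H.isOpen_negSide) (isPreconnected_inter_negSide hW hWc hWH) hsub H.isOpen_far
    (fun x hx => ⟨(far_subset_mirrorRegion hWR hx).2.1, hx.1⟩)
    ?_ (hH.eqOn_far hS.two_le hS.admissible.uniqueContinuation hT hS.isSolution hR0 hSR)⟩
  obtain ⟨y, hyH, hy⟩ := exists_mem_plane_norm_gt hS.two_le H (max ρ R₀ + 2 * |H.offset| + 1)
  obtain ⟨z, hz, hzb⟩ := H.nonempty_negSide_inter_ball hyH one_pos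
  exact ⟨z, ball_inter_negSide_subset_far hy ⟨hzb, hz⟩⟩

/-- Suppose that `W` is bounded by images of the obstacle only. Then, at points on one hyperplane
only, the part of its boundary that lies in the obstacle is symmetric with respect to every
reflection hyperplane. Otherwise the mirror image would contain flat points; the reflections in
their hyperplanes cannot leave `W` invariant, as `W` lies on one side. -/
theorem reflect_mem_of_mem_frontier (hS : IsObstacleProblem P S 𝒞 𝓛 u)
    [Finite (P.reflectionGroup u)] {W : Set (Space N)} (hW : IsOpen W) (hWc : IsPreconnected W)
    (hWΓ : ∀ g ∈ P.reflectionGroup u, ∀ x ∈ W, g x ∈ W) {ρ : ℝ}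
    (hWρ : Wᶜ ⊆ Metric.closedBall 0 ρ) (hWS : Disjoint W S)
    (hfr : ∀ x ∈ frontier W, ∃ g ∈ P.reflectionGroup u, g x ∈ S)
    (hE : ∀ x ∈ frontier W, x ∈ P.exceptionalSet S u → x ∈ S)
    (hH : P.IsReflectionHyperplane u H) {z : Space N} (hz : z ∈ frontier W) (hzS : z ∈ S)
    (hzs : IsSimple (orbitFamily (P.reflectionGroup u) 𝓛) z) : H.reflect z ∈ S := by
  by_contra hyS
  have key (K : OrientedHyperplane N) (hK : P.IsReflectionHyperplane u K)
      (hyS : K.reflect z ∉ S) (hyK : K.reflect z ∈ K.negSide) : False := by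
    obtain ⟨T, hT⟩ := hS.admissible.reflection K
    have hWK : ∀ x ∈ W, K.reflect x ∈ W := hWΓ _ hK.refl_mem
    obtain ⟨hsub, hDu⟩ := hS.eqOn_reflection_exterior hW hWc hWρ hWS hK hT hWK
    have hDo : IsOpen (W ∩ K.negSide) := hW.inter K.isOpen_negSide
    have hyW : K.reflect z ∈ frontier W := apply_mem_frontier hW hWΓ hK.refl_mem hz
    have hfrD {w : Space N} (hw : w ∈ K.negSide) (h : w ∈ frontier (W ∩ K.negSide)) :
        w ∈ frontier W := by
      rw [hDo.frontier_eq] at h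
      rw [hW.frontier_eq]
      exact ⟨closure_mono inter_subset_left h.1, fun h' => h.2 ⟨h', hw⟩⟩
    have hyD : K.reflect z ∈ frontier (W ∩ K.negSide) := by
      rw [hW.frontier_eq] at hyW
      rw [hDo.frontier_eq]
      refine ⟨mem_closure_iff.2 fun V hV hyV => ?_, fun h => hyW.2 h.1⟩
      obtain ⟨w, hw, hwW⟩ := mem_closure_iff.1 hyW.1 _ (hV.inter K.isOpen_negSide) ⟨hyV, hyK⟩
      exact ⟨w, hw.1, hwW, hw.2⟩
    have hone : (1 : Space N ≃ᵃⁱ[ℝ] Space N) ∈ P.reflectionGroup u := one_mem _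
    obtain ⟨H', hflat, -, r, hr, hhalf⟩ := exists_isFlatAt_of_mem_frontier hS.admissible hT
      hS.isObstacle hS.decomposition hS.finite hS.carriesCells hS.isSolution hS.vanishOnCells hDo
      hsub hDu hyD hyS hyK (by rwa [K.reflect_reflect])
      (by rw [K.reflect_reflect]; exact hzs.of_orbitFamily hone)
      (by
        rw [K.reflect_reflect]
        intro H₀ hH₀ hzH₀
        obtain ⟨s, hs, hsz⟩ := exists_ball_avoiding
          (finite_orbitFamily (Γ := P.reflectionGroup u) hS.finite) z
        obtain ⟨s', hs', hs'K⟩ := Metric.isOpen_iff.1 K.isOpen_negSide _ hyK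
        refine ⟨min s s', lt_min hs hs', fun w hw hwb => ?_⟩
        have hwW := apply_mem_frontier hW hWΓ hK.refl_mem
          (hfrD (hs'K (Metric.ball_subset_ball (min_le_right _ _) hwb)) hw)
        rw [K.coe_refl] at hwW
        obtain ⟨g, hg, hgw⟩ := hfr _ hwW
        have hgS : g (K.reflect w) ∈ frontier S := by
          rw [← frontier_compl, hS.isOpen_compl.frontier_eq]
          exact ⟨closure_mono hWS.subset_compl_right
            (apply_mem_closure hWΓ hg hwW.1), fun h => h hgw⟩
        obtain ⟨H₁, hH₁, hgH₁⟩ := exists_mem_plane_of_mem_frontier hS.decomposition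
          hS.carriesCells hgS
        have hmem := map_mem_orbitFamily (Γ := P.reflectionGroup u) hH₁ (inv_mem hg)
        have hwH₁ : K.reflect w ∈ (H₁.map g⁻¹).plane := by
          rw [← H₁.map_mem_plane (g := g⁻¹)] at hgH₁
          rwa [show (g⁻¹ : Space N ≃ᵃⁱ[ℝ] Space N) (g (K.reflect w)) = K.reflect w from
            g.symm_apply_apply _] at hgH₁
        have hzb : K.reflect w ∈ Metric.ball z s := by
          rw [← K.reflect_mem_ball, K.reflect_reflect]
          exact Metric.ball_subset_ball (min_le_left _ _) hwb
        have hzH₁ := hsz _ hmem ⟨_, hwH₁, hzb⟩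
        have h1 : (H₀.map 1).plane = H₀.plane := by rw [H₀.map_plane]; simp
        have h2 := hzs _ (map_mem_orbitFamily hH₀ hone) _ hmem (by rwa [h1]) hzH₁
        rw [← h1, h2]
        exact hwH₁)
    have hHΓ : H'.refl ∈ P.reflectionGroup u :=
      refl_mem_of_notMem_exceptionalSet (fun h => hyS (hE _ hyW h)) hflat
    obtain ⟨s', hs', hs'K⟩ := Metric.isOpen_iff.1 K.isOpen_negSide _ hyK
    obtain ⟨w, hwn, hwb⟩ := H'.nonempty_negSide_inter_ball hflat.1 (lt_min hr hs')
    have hball {v : Space N} (hv : v ∈ Metric.ball (K.reflect z) (min r s')) :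
        v ∈ Metric.ball (K.reflect z) r := Metric.ball_subset_ball (min_le_left _ _) hv
    have hwb' : H'.reflect w ∈ Metric.ball (K.reflect z) (min r s') := by
      rw [← H'.reflect_eq_self.2 hflat.1]; exact H'.reflect_mem_ball.2 hwb
    have hw' : H'.reflect w ∈ H'.posSide ∩ Metric.ball (K.reflect z) r :=
      ⟨H'.reflect_mem_posSide.2 hwn, hball hwb'⟩
    rw [← hhalf] at hw'
    have hwW : w ∈ W := by
      have := hWΓ _ hHΓ _ hw'.1.1
      rwa [H'.coe_refl, H'.reflect_reflect] at this
    have hw : w ∈ (W ∩ K.negSide) ∩ Metric.ball (K.reflect z) r :=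
      ⟨⟨hwW, hs'K (Metric.ball_subset_ball (min_le_right _ _) hwb)⟩, hball hwb⟩
    rw [hhalf] at hw
    exact absurd (H'.mem_posSide.1 hw.1) (not_lt.2 (H'.mem_negSide.1 hwn).le)
  rcases H.mem_negSide_or_mem_plane_or_mem_posSide (H.reflect z) with h | h | h
  · exact key H hH hyS h
  · rw [H.reflect_mem_plane] at h
    rw [H.reflect_eq_self.2 h] at hyS
    exact hyS hzS
  · exact key H.reverse (hS.isReflectionHyperplane_reverse hH) (by rwa [H.reflect_reverse])
      (by rwa [H.reflect_reverse, H.negSide_reverse])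

/-- If the symmetric exterior region `W` is bounded by images of the obstacle only, it is the whole
complement of the obstacle. -/
theorem compl_subset_exterior (hS : IsObstacleProblem P S 𝒞 𝓛 u)
    [Finite (P.reflectionGroup u)] {W : Set (Space N)} (hW : IsOpen W) (hWc : IsPreconnected W)
    (hWΓ : ∀ g ∈ P.reflectionGroup u, ∀ x ∈ W, g x ∈ W) (hne : W.Nonempty) {ρ : ℝ}
    (hWρ : Wᶜ ⊆ Metric.closedBall 0 ρ) (hWS : Disjoint W S)
    (hfr : ∀ x ∈ frontier W, ∃ g ∈ P.reflectionGroup u, g x ∈ S)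
    (hE : ∀ x ∈ frontier W, x ∈ P.exceptionalSet S u → x ∈ S) : Sᶜ ⊆ W := by
  have hinv (g : Space N ≃ᵃⁱ[ℝ] Space N) (hg : g ∈ P.reflectionGroup u) :
      ∀ z ∈ frontier W, IsSimple (orbitFamily (P.reflectionGroup u) 𝓛) z → (z ∈ S ↔ g z ∈ S) := by
    induction hg using Subgroup.closure_induction with
    | mem g hg =>
      obtain ⟨H, hH, rfl⟩ := hg
      intro z hz hzs
      refine ⟨fun hzS => hS.reflect_mem_of_mem_frontier hW hWc hWΓ hWρ hWS hfr hE hH hz hzS hzs,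
        fun h => ?_⟩
      have := hS.reflect_mem_of_mem_frontier hW hWc hWΓ hWρ hWS hfr hE hH
        (apply_mem_frontier hW hWΓ hH.refl_mem hz) h (hzs.orbitFamily_apply hH.refl_mem)
      rwa [H.coe_refl, H.reflect_reflect] at this
    | one => exact fun z _ _ => Iff.rfl
    | mul g g' _ hg' h h' =>
      exact fun z hz hzs => (h' z hz hzs).trans
        (h _ (apply_mem_frontier hW hWΓ hg' hz) (hzs.orbitFamily_apply hg'))
    | inv g hg h =>
      intro z hz hzs
      have := h _ (apply_mem_frontier hW hWΓ (inv_mem hg) hz)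
        (hzs.orbitFamily_apply (inv_mem hg))
      rw [show g ((g⁻¹ : Space N ≃ᵃⁱ[ℝ] Space N) z) = z from g.apply_symm_apply z] at this
      exact this.symm
  have hcl : Sᶜ ⊆ closure W := by
    refine subset_of_mem_nhds_of_isSimple
      (finite_orbitFamily (Γ := P.reflectionGroup u) hS.finite) hS.isOpen_compl
      hS.isObstacle.isConnected_compl.isPreconnected isClosed_closure (fun y hyS hyW hys => ?_) ?_
    · by_cases hy : y ∈ W
      · exact mem_of_superset (hW.mem_nhds hy) subset_closure
      · have hyf : y ∈ frontier W := by rw [hW.frontier_eq]; exact ⟨hyW, hy⟩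
        obtain ⟨g, hg, hgy⟩ := hfr y hyf
        exact absurd ((hinv g hg y hyf hys).2 hgy) hyS
    · obtain ⟨x, hx⟩ := hne
      exact ⟨x, hWS.subset_compl_right hx, interior_maximal subset_closure hW hx⟩
  intro y hyS
  by_contra hyW
  have hyf : y ∈ frontier W := by rw [hW.frontier_eq]; exact ⟨hcl hyS, hyW⟩
  obtain ⟨g, hg, hgy⟩ := hfr y hyf
  -- near `y` the mirror image of the interior of the obstacle would be disjoint from `W`
  rw [← hS.isObstacle.closure_interior] at hgy
  have hgS : IsOpen (g.symm ⁻¹' Sᶜ) := hS.isOpen_compl.preimage g.symm.continuous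
  obtain ⟨w, hw, hwS⟩ := mem_closure_iff.1 hgy _ hgS (by simpa using hyS)
  obtain ⟨v, hv, hvW⟩ := mem_closure_iff.1 (hcl hw) (g ⁻¹' interior S)
    (isOpen_interior.preimage g.continuous) (by simpa using hwS)
  exact hWS.le_bot ⟨hWΓ g hg v hvW, interior_subset hv⟩

/-- Every flat point belongs to a hyperplane whose reflection is in the reflection group, and the
complement of the obstacle is invariant under this group, provided that the group is finite. -/
theorem exceptionalSet_eq_empty_and_invariant (hS : IsObstacleProblem P S 𝒞 𝓛 u)
    [Finite (P.reflectionGroup u)] :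
    P.exceptionalSet S u = ∅ ∧ ∀ g ∈ P.reflectionGroup u, ∀ x ∈ Sᶜ, g x ∈ Sᶜ := by
  obtain ⟨R, hR0, hR⟩ := hS.exists_radius
  have hKc : IsCompact (S ∪ closure (P.exceptionalSet S u)) :=
    hS.isCompact.union (Metric.isBounded_closedBall.subset
      (hS.exceptionalSet_subset_closedBall hR0 hR)).isCompact_closure
  obtain ⟨W, hW, hWc, hWΓ, ⟨ρ, hρ0, hWρ⟩, hWK, hfr⟩ :=
    exists_invariant_exterior (Γ := P.reflectionGroup u) hS.two_le hKc
  have hWS : Disjoint W S := hWK.mono_right subset_union_left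
  have hWE : Disjoint W (P.exceptionalSet S u) :=
    hWK.mono_right (subset_closure.trans subset_union_right)
  have hWb : ¬ Bornology.IsBounded W := fun h =>
    not_isBounded_compl_closedBall hS.two_le ρ (h.subset (compl_subset_comm.1 hWρ))
  have hne : W.Nonempty := by
    by_contra h
    rw [not_nonempty_iff_eq_empty] at h
    exact hWb (h ▸ Bornology.isBounded_empty)
  by_cases hcase : ∀ x ∈ frontier W, x ∈ closure (P.exceptionalSet S u) → x ∈ S
  · have hSW : Sᶜ ⊆ W := hS.compl_subset_exterior hW hWc hWΓ hne hWρ hWS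
      (fun x hx => by
        obtain ⟨g, hg, hgS | hgE⟩ := hfr x hx
        · exact ⟨g, hg, hgS⟩
        · exact ⟨g, hg, hcase _ (apply_mem_frontier hW hWΓ hg hx) hgE⟩)
      fun x hx hxE => hcase x hx (subset_closure hxE)
    have hWeq : W = Sᶜ := hWS.subset_compl_right.antisymm hSW
    refine ⟨?_, hWeq ▸ hWΓ⟩
    rw [eq_empty_iff_forall_notMem]
    rintro x ⟨H, hx, hH⟩
    obtain ⟨r, hr, hrS, -⟩ := hx.2
    exact hWE.le_bot ⟨hSW (hrS (Metric.mem_ball_self hr)), H, hx, hH⟩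
  · -- a bounded component at an exceptional point near the boundary of `W` meets `W`
    exfalso
    push Not at hcase
    obtain ⟨x₀, hx₀W, hx₀E, hx₀S⟩ := hcase
    obtain ⟨r, hr, hrS⟩ := Metric.isOpen_iff.1 hS.isOpen_compl x₀ hx₀S
    obtain ⟨x, ⟨H, hx, hH⟩, hxx₀⟩ := Metric.mem_closure_iff.1 hx₀E (r / 2) (half_pos hr)
    have hballS : Metric.ball x (r / 2) ⊆ Sᶜ := fun y hy => hrS <| by
      rw [Metric.mem_ball] at hy ⊢
      linarith [dist_triangle y x x₀, dist_comm x x₀]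
    obtain ⟨y, hyb, hyW⟩ := mem_closure_iff.1 hx₀W.1 _ Metric.isOpen_ball
      (show x₀ ∈ Metric.ball x (r / 2) from hxx₀)
    obtain ⟨p, ⟨hpb, hpW⟩, hpH⟩ := (dense_avoiding_planes (finite_singleton H)).inter_open_nonempty
      (Metric.ball x (r / 2) ∩ W) (Metric.isOpen_ball.inter hW) ⟨y, hyb, hyW⟩
    have key (K : OrientedHyperplane N) (hKH : K.refl = H.refl) (hx' : P.IsFlatAt Sᶜ u K x)
        (hpn : p ∈ K.negSide) : False := by
      obtain ⟨T, hT⟩ := hS.admissible.reflection K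
      have hpb' : p ∈ Metric.ball x (r / 2) ∩ K.negSide := ⟨hpb, hpn⟩
      have hDu := hx'.eqOn_component hS.admissible.uniqueContinuation hT hS.isOpen_compl
        hS.isSolution (half_pos hr) hballS hpb'
      have hpD := mem_connectedComponentIn
        (ball_inter_negSide_subset_mirrorRegion hx'.1 hballS hpb')
      refine false_of_isBounded hW hWc hWΓ hWb
        (isOpen_mirrorRegion hS.isOpen_compl).connectedComponentIn
        (hS.isBounded_component hx' (by rwa [hKH]) (half_pos hr) hballS hpb') ⟨p, hpW, hpD⟩
        (hS.finite.image fun H' => H'.map K.refl) fun z hzW hzD hzs => ?_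
      have hzS : z ∉ S := fun h => hWS.le_bot ⟨hzW, h⟩
      have hzE : z ∉ P.exceptionalSet S u := fun h => hWE.le_bot ⟨hzW, h⟩
      have hzK : z ∉ K.plane := fun h => by
        refine hH (hKH ▸ refl_mem_of_notMem_exceptionalSet hzE ?_)
        exact isFlatAt_of_mem_frontier hT hS.isOpen_compl hS.isSolution hDu hzD hzS h
      obtain ⟨H', hflat, -, s, hs, hhalf⟩ := exists_isFlatAt_of_mem_frontier_component hS.admissible
        hT hS.isObstacle hS.decomposition hS.finite hS.carriesCells hS.isSolution hS.vanishOnCells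
        hDu hzD hzS hzK
        (by apply IsSimple.of_map (g := K.refl); rwa [K.coe_refl, K.reflect_reflect])
      exact ⟨H', hflat.1, refl_mem_of_notMem_exceptionalSet hzE hflat, s, hs,
        hhalf ▸ inter_subset_left⟩
    rcases H.mem_negSide_or_mem_plane_or_mem_posSide p with h | h | h
    · exact key H rfl hx h
    · exact hpH H rfl h
    · exact key H.reverse H.refl_reverse (hx.reverse hS.admissible hS.isSolution)
        (by rwa [H.negSide_reverse])

/-- No bounded open set outside the obstacle is bounded, within the complement of the obstacle, by
flat points. -/
theorem false_of_frontier_flat (hS : IsObstacleProblem P S 𝒞 𝓛 u)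
    [Finite (P.reflectionGroup u)] {D : Set (Space N)} (hD : IsOpen D) (hDS : D ⊆ Sᶜ)
    (hne : D.Nonempty) (hDb : Bornology.IsBounded D)
    (hflat : ∀ x ∈ frontier D, x ∉ S → ∃ H, P.IsFlatAt Sᶜ u H x) : False := by
  obtain ⟨hE, hinv⟩ := hS.exceptionalSet_eq_empty_and_invariant
  obtain ⟨R, -, hR⟩ := hS.exists_radius
  have hSb : ¬ Bornology.IsBounded Sᶜ := fun h =>
    not_isBounded_compl_closedBall hS.two_le R (h.subset (compl_subset_compl.2 hR))
  -- one hyperplane for each reflection in the group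
  let f : (Space N ≃ᵃⁱ[ℝ] Space N) → Set (OrientedHyperplane N) := fun g =>
    {H | ∃ h : ∃ H' : OrientedHyperplane N, H'.refl = g, H = h.choose}
  have hf (g) : (f g).Finite := Set.Subsingleton.finite <| by
    rintro _ ⟨h, rfl⟩ _ ⟨h', rfl⟩; rfl
  let 𝓗 : Set (OrientedHyperplane N) := ⋃ g : P.reflectionGroup u, f g
  have h𝓗 : 𝓗.Finite := finite_iUnion fun g => hf g
  have hΓ {H : OrientedHyperplane N} (hH : H ∈ 𝓗) : H.refl ∈ P.reflectionGroup u := by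
    obtain ⟨g, h, rfl⟩ := mem_iUnion.1 hH
    rw [h.choose_spec]; exact g.2
  have hcov (x : Space N) (hx : x ∈ frontier D) (hxS : x ∉ S) : ∃ H ∈ 𝓗, x ∈ H.plane := by
    obtain ⟨H, hxH⟩ := hflat x hx hxS
    have hg : H.refl ∈ P.reflectionGroup u :=
      refl_mem_of_notMem_exceptionalSet (S := S) (by rw [hE]; exact notMem_empty x) hxH
    have hex : ∃ H' : OrientedHyperplane N, H'.refl = H.refl := ⟨H, rfl⟩
    refine ⟨hex.choose, mem_iUnion.2 ⟨⟨_, hg⟩, hex, rfl⟩, ?_⟩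
    rw [← OrientedHyperplane.reflect_eq_self, ← OrientedHyperplane.coe_refl, hex.choose_spec,
      H.coe_refl, H.reflect_eq_self]
    exact hxH.1
  refine false_of_isBounded hS.isOpen_compl hS.isObstacle.isConnected_compl.isPreconnected hinv hSb
    hD hDb (by rwa [inter_eq_right.2 hDS]) h𝓗 fun y hyS hyD hys => ?_
  obtain ⟨H, hH, hyH⟩ := hcov y hyD hyS
  obtain ⟨r, hr, hry⟩ := exists_ball_avoiding h𝓗 y
  obtain ⟨r', hr', hr'S⟩ := Metric.isOpen_iff.1 hS.isOpen_compl y hyS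
  have hs : 0 < min r r' := lt_min hr hr'
  have hfr : frontier D ∩ Metric.ball y (min r r') ⊆ H.plane := by
    rintro w ⟨hwD, hwb⟩
    obtain ⟨H', hH', hwH'⟩ := hcov w hwD (hr'S (Metric.ball_subset_ball (min_le_right _ _) hwb))
    rw [hys H hH H' hH' hyH
      (hry H' hH' ⟨w, hwH', Metric.ball_subset_ball (min_le_left _ _) hwb⟩)]
    exact hwH'
  have key (K : OrientedHyperplane N) (hK : K.plane = H.plane) (hKΓ : K.refl ∈ P.reflectionGroup u)
      (hm : ((K.posSide ∩ Metric.ball y (min r r')) ∩ D).Nonempty) :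
      ∃ H : OrientedHyperplane N, y ∈ H.plane ∧ H.refl ∈ P.reflectionGroup u ∧
        ∃ ρ > 0, H.posSide ∩ Metric.ball y ρ ⊆ D := by
    refine ⟨K, by rwa [hK], hKΓ, _, hs,
      (K.convex_posSide.inter (convex_ball y _)).isPreconnected.subset_of_disjoint_frontier
        hD ?_ hm⟩
    rw [disjoint_left]
    rintro w ⟨hw, hwb⟩ hwD
    have : w ∈ K.plane := hK ▸ hfr ⟨hwD, hwb⟩
    exact (K.mem_posSide.1 hw).ne this
  obtain ⟨w, hwb, hwD⟩ := mem_closure_iff.1 hyD.1 _ Metric.isOpen_ball (Metric.mem_ball_self hs)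
  rcases H.ball_subset_closure hwb with h | h
  · obtain ⟨v, hvD, hv⟩ := mem_closure_iff.1 h D hD hwD
    exact key H.reverse H.plane_reverse (by rw [H.refl_reverse]; exact hΓ hH)
      ⟨v, by rwa [H.posSide_reverse], hvD⟩
  · obtain ⟨v, hvD, hv⟩ := mem_closure_iff.1 h D hD hwD
    exact key H rfl (hΓ hH) ⟨v, hv, hvD⟩

end IsObstacleProblem

end Operators

/-! ### Polyhedra and the unbounded component -/

theorem IsConvexPolytope.isCompact {N : ℕ} {Q : Set (Space N)} (h : IsConvexPolytope Q) :
    IsCompact Q := by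
  obtain ⟨⟨V, rfl⟩, -⟩ := h
  exact V.finite_toSet.isCompact_convexHull ℝ

theorem IsConvexPolytope.subset_closure_interior {N : ℕ} {Q : Set (Space N)}
    (h : IsConvexPolytope Q) : Q ⊆ closure (interior Q) := by
  have hc : Convex ℝ Q := by
    obtain ⟨⟨V, rfl⟩, -⟩ := h
    exact convex_convexHull ℝ _
  rw [hc.closure_interior_eq_closure_of_nonempty_interior h.2]
  exact subset_closure

theorem IsPolyhedron.isCompact {N : ℕ} {Q : Set (Space N)} (h : IsPolyhedron Q) : IsCompact Q := by
  obtain ⟨𝒬, hf, -, h𝒬, rfl⟩ := h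
  exact hf.isCompact_sUnion fun K hK => (h𝒬 K hK).isCompact

theorem IsPolyhedron.subset_closure_interior {N : ℕ} {Q : Set (Space N)} (h : IsPolyhedron Q) :
    Q ⊆ closure (interior Q) := by
  obtain ⟨𝒬, -, -, h𝒬, rfl⟩ := h
  exact sUnion_subset fun K hK => (h𝒬 K hK).subset_closure_interior.trans
    (closure_mono (interior_mono (subset_sUnion_of_mem hK)))

theorem isOpen_unboundedComponent {N : ℕ} {W : Set (Space N)} (hW : IsOpen W) :
    IsOpen (unboundedComponent W) := by
  rw [isOpen_iff_mem_nhds]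
  rintro x ⟨hxW, hx⟩
  refine mem_of_superset (hW.connectedComponentIn.mem_nhds (mem_connectedComponentIn hxW))
    fun y hy => ⟨connectedComponentIn_subset _ _ hy, ?_⟩
  rwa [← connectedComponentIn_eq hy]

theorem compl_closedBall_subset_unboundedComponent {N : ℕ} (hN : 2 ≤ N) {W : Set (Space N)} {ρ : ℝ}
    (hρ : 0 ≤ ρ) (hW : Wᶜ ⊆ Metric.closedBall 0 ρ) :
    (Metric.closedBall 0 ρ)ᶜ ⊆ unboundedComponent W := by
  have hsub : (Metric.closedBall (0 : Space N) ρ)ᶜ ⊆ W := compl_subset_comm.1 hW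
  exact fun x hx => ⟨hsub hx, fun hb => not_isBounded_compl_closedBall hN ρ (hb.subset
    ((isPreconnected_compl_closedBall hN hρ).subset_connectedComponentIn hx hsub))⟩

/-! ### Independent normals -/

/-- If no `N` members of a set of vectors of `ℝ^N` are linearly independent, some direction is
orthogonal to all of them. -/
theorem exists_orthogonal_of_forall_not_linearIndependent {N : ℕ} {s : Set (Space N)}
    (h : ∀ v : Fin N → Space N, (∀ i, v i ∈ s) → ¬ LinearIndependent ℝ v) :
    ∃ e : Space N, e ≠ 0 ∧ ∀ v ∈ s, ⟪v, e⟫ = 0 := by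
  obtain ⟨b, hbs, hspan, hb⟩ := exists_linearIndependent ℝ s
  have htop : Submodule.span ℝ s ≠ ⊤ := by
    intro htop
    rw [← hspan] at htop
    let B : Module.Basis b ℝ (Space N) := .mk hb (by rw [Subtype.range_coe]; exact htop.ge)
    let B' := B.reindex (B.indexEquiv (EuclideanSpace.basisFun (Fin N) ℝ).toBasis)
    refine h B' (fun i => ?_) B'.linearIndependent
    rw [Module.Basis.reindex_apply, Module.Basis.mk_apply]
    exact hbs (Subtype.coe_prop _)
  rw [Ne, ← Submodule.orthogonal_eq_bot_iff] at htop
  obtain ⟨e, he, he0⟩ := Submodule.exists_mem_ne_zero_of_ne_bot htop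
  exact ⟨e, he0, fun v hv => (Submodule.mem_orthogonal _ _).1 he v (Submodule.subset_span hv)⟩

end Polyhedral

end

theorem theorem2p2 {N M L L₁ J J₁ : ℕ} (hN : 2 ≤ N)
    (hM : 0 < M) (hL : 0 < L) (hL₁ : 0 < L₁) (hJ : 0 < J) (hJ₁ : 0 < J₁)
    (P : Polyhedral.Operators N M L L₁ J J₁) (hP : P.Admissible)
    (S : Set (Polyhedral.Space N)) (hS : Polyhedral.IsObstacle S) (hS_ne : S.Nonempty)
    (𝒞 : Set (Set (Polyhedral.Space N))) (h𝒞 : Polyhedral.IsCellDecomposition S 𝒞)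
    (u : Polyhedral.Space N → Fin M → ℂ) (hu : P.IsSolution Sᶜ u)
    (hB : P.VanishOnCells S 𝒞 u)
    (𝓠 : Set (Set (Polyhedral.Space N))) (h𝓠_fin : 𝓠.Finite)
    (h𝓠 : ∀ Q ∈ 𝓠, Polyhedral.IsPolyhedron Q)
    (S' : Set (Polyhedral.Space N)) (hS' : S' = ⋃₀ 𝓠) (hne : (S' \ S).Nonempty)
    (hflat : ∀ x ∈ frontier (Polyhedral.unboundedComponent (S ∪ S')ᶜ) ∩ Sᶜ,
      P.IsFlatPoint Sᶜ u x) :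
    ∃ H : Fin N → Polyhedral.OrientedHyperplane N,
      (∀ i, P.IsReflectionHyperplane u (H i)) ∧
      LinearIndependent ℝ (fun i => (H i).normal) := by
  by_contra hcon
  obtain ⟨e, he0, he⟩ := Polyhedral.exists_orthogonal_of_forall_not_linearIndependent
    (s := {v | ∃ H, P.IsReflectionHyperplane u H ∧ H.normal = v}) fun v hv hlin => hcon <| by
      choose H hH hHv using hv
      exact ⟨H, hH, by rwa [funext hHv]⟩
  obtain ⟨𝓛, h𝓛, hcarries⟩ := h𝒞.exists_carriesCells
  have hprob : Polyhedral.Operators.IsObstacleProblem P S 𝒞 𝓛 u :=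
    ⟨hN, hP, hS, hS_ne, h𝒞, h𝓛, hcarries, hu, hB⟩
  have := hprob.finite_reflectionGroup he0 fun H hH => he _ ⟨H, hH, rfl⟩
  have hS'c : IsCompact S' := hS' ▸ h𝓠_fin.isCompact_sUnion fun Q hQ => (h𝓠 Q hQ).isCompact
  have hS'i : S' ⊆ closure (interior S') := by
    rw [hS']
    exact sUnion_subset fun Q hQ => (h𝓠 Q hQ).subset_closure_interior.trans
      (closure_mono (interior_mono (subset_sUnion_of_mem hQ)))
  set W := Polyhedral.unboundedComponent (S ∪ S')ᶜ with hWdef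
  have hWo : IsOpen W :=
    Polyhedral.isOpen_unboundedComponent (hS.isClosed.union hS'c.isClosed).isOpen_compl
  obtain ⟨ρ, hρ⟩ := (hS.isBounded.union hS'c.isBounded).subset_closedBall (0 : Polyhedral.Space N)
  have hWρ : (Metric.closedBall 0 (max ρ 0))ᶜ ⊆ W :=
    Polyhedral.compl_closedBall_subset_unboundedComponent hN (le_max_right _ _) <| by
      rw [compl_compl]
      exact hρ.trans (Metric.closedBall_subset_closedBall (le_max_left _ _))
  have hDo : IsOpen (Sᶜ ∩ (closure W)ᶜ) :=
    hS.isClosed.isOpen_compl.inter isClosed_closure.isOpen_compl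
  refine hprob.false_of_frontier_flat hDo inter_subset_left ?_ ?_ fun x hx hxS => ?_
  · obtain ⟨x, hxS', hxS⟩ := hne
    obtain ⟨y, hyS, hy⟩ := mem_closure_iff.1 (hS'i hxS') _ hS.isClosed.isOpen_compl hxS
    refine ⟨y, hyS, fun hyW => ?_⟩
    obtain ⟨z, hz, hzW⟩ := mem_closure_iff.1 hyW _ isOpen_interior hy
    exact hzW.1 (.inr (interior_subset hz))
  · exact Metric.isBounded_closedBall.subset fun y hy =>
      not_not.1 fun h => hy.2 (subset_closure (hWρ h))
  · rw [hDo.frontier_eq] at hx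
    have hxW : x ∈ frontier W := by
      rw [hWo.frontier_eq]
      refine ⟨not_not.1 fun h => hx.2 ⟨hxS, h⟩, fun h => ?_⟩
      obtain ⟨y, hyW, hy⟩ := mem_closure_iff.1 hx.1 _ hWo h
      exact hy.2 (subset_closure hyW)
    exact hflat x ⟨hxW, hxS⟩
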